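/- Throughout, $s\ge 1$ and $m\ge 2$ are integers. A matrix $[\alpha_{i,j}]$ is *persymmetric* if $\alpha_{i,j}=\alpha_{r,t}$ whenever $i+j=r+t$. For $k\ge 1$, $\mu\ge 0$ and $\sigma\ge 1$ let $\Gamma_i^{[\sigma,\mu]\times k}$ be the number of matrices of rank $i$ over $\mathbb F_2$ of the form $\begin{bmatrix}A\\B\\C\end{bmatrix}$ with $A$ a $\sigma\times k$ persymmetric matrix and $B$, $C$ two $(\sigma+\mu)\times k$ persymmetric matrices; this is $\Gamma_i^{\left[\sigma\atop{\sigma+\mu\atop \sigma+\mu}\right]\times k}$. Write $\Gamma_i(k)=\Gamma_i^{[s,m]\times k}$. **(1) Non-square case.** - $\Gamma_0(k)=1$ for $k\ge1$. - $\Gamma_i(k)=105\cdot2^{4i-6}-21\cdot2^{3i-5}$ for $1\le i\le s-1$, $k\ge i+1$. - $\Gamma_s(k)=2^{k+s-1}-2^{2s}+21(5\cdot2^{4s-6}-2^{3s-5})$ for $k\ge s+1$. - $\Gamma_{s+j}(k)=(21\cdot2^{j-1}-3)2^{k+s+2j-4}+21(5\cdot2^{4s+4j-6}-2^{3s+3j-5}-5\cdot2^{2s+4j-6}+2^{2s+3j-5})$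 for $1\le j\le m-1$, $k\ge s+j+1$. - $\Gamma_{s+m}(k)=(21\cdot2^{s+3m-5}+45\cdot2^{s+2m-4})(2^k-2^{s+m+1})+105\cdot2^{4s+4m-6}-21\cdot2^{3s+3m-5}-21\cdot2^{2s+4m-6}+9\cdot2^{2s+3m-5}$ for $k\ge s+m+1$. - $\Gamma_{s+m+j}(k)=21\,[\,2^{k+s+3m+3j-5}+35\cdot2^{k+s+2m+4j-7}-9\cdot2^{k+s+2m+3j-6}+5\cdot2^{4s+4m+4j-6}-2^{3s+3m+3j-5}-5\cdot2^{2s+4m+4j-6}-155\cdot2^{2s+3m+5j-8}+45\cdot2^{2s+3m+4j-7}]$ for $1\le j\le s-1$, $k\ge s+m+j+1$. - $\Gamma_{2s+m}(k)=3\cdot2^{2k+2s+m-2}+21\cdot2^{k+4s+3m-5}+735\cdot2^{k+5s+2m-7}-477\cdot2^{k+4s+2m-6}+105\cdot2^{8s+4m-6}-105\cdot2^{6s+4m-6}-3255\cdot2^{7s+3m-8}+1629\cdot2^{6s+3m-7}$ for $k\ge 2s+m+1$. - $\Gamma_{2s+m+1+j}(k)=21\cdot2^{2k+2s+m+3j-2}+21\cdot2^{k+4s+3m+3j-2}+735\cdot2^{k+5s+2m+4j-3}-945\cdot2^{k+4s+2m+4j-3}+105\cdot2^{8s+4m+4j-2}-105\cdot2^{6s+4m+4j-2}-3255\cdot2^{7s+3m+5j-3}+3255\cdot2^{6s+3m+5j-3}$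 for $0\le j\le m-2$, $k\ge 2s+m+2+j$. - $\Gamma_{2s+2m}(k)=53\cdot2^{2s-1}(2^{2k+4m-4}-2^{4s+8m-2})+(735\cdot2^{5s-1}-1629\cdot2^{4s-1})(2^{k+6m-6}-2^{2s+8m-5})+21\,[5\cdot2^{8s+8m-6}+3\cdot2^{6s+8m-8}-15\cdot2^{7s+8m-8}]$ for $k\ge 2s+2m+1$. - $\Gamma_{2s+2m+1+j}(k)=105(2^{2k+2s+4m+4j-2}+7\cdot2^{k+5s+6m+4j-3}-31\cdot2^{k+4s+6m+5j-3})+105(2^{8s+8m+4j-2}-31\cdot2^{7s+8m+5j-3}+93\cdot2^{6s+8m+6j-3})$ for $0\le j\le s-2$, $k\ge 2s+2m+2+j$. - $\Gamma_{3s+2m}(k)=2^{3k+2m+3s-3}-7\cdot2^{2k+4m+6s-6}+7\cdot2^{k+6m+9s-8}-2^{8m+12s-9}$ for $k\ge 3s+2m$. **(2) Case $k=i$.** - $\Gamma_i(i)=2^{3s+2m+3i-3}-7\cdot2^{4i-6}+3\cdot2^{3i-5}$ for $1\le i\le s+1$. - For $i=s+j$, $1\le j\le m+1$: $\Gamma_i(i)=2^{6s+2m+3j-3}-7\cdot2^{4s+4j-6}+3\cdot2^{3s+3j-5}+(2^{j-1}-1)2^{2s+3j-5}$.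 - For $i=s+m+j$, $1\le j\le s-1$: $\Gamma_i(i)=2^{6s+5m+3j-3}-7\cdot2^{4s+4m+4j-6}+3\cdot2^{3s+3m+3j-5}+2^{2s+4m+4j-6}+7\cdot2^{2s+3m+5j-8}-9\cdot2^{2s+3m+4j-7}$. - For $i=2s+m$: $\Gamma_i(i)=2^{9s+5m-3}-7\cdot2^{8s+4m-6}+7\cdot2^{7s+3m-8}+3\cdot2^{6s+3m-7}+2^{6s+4m-6}$. - For $i=2s+m+1+j$, $0\le j\le m-2$: $\Gamma_i(i)=2^{9s+5m+3j}-7\cdot2^{8s+4m+4j-2}+7\cdot2^{7s+3m+5j-3}-3\cdot2^{6s+3m+5j-3}+2^{6s+4m+4j-2}$. - For $i=2s+2m$: $\Gamma_i(i)=2^{9s+8m-3}-7\cdot2^{8s+8m-6}+7\cdot2^{7s+8m-8}+2^{6s+8m-8}$. - For $i=2s+2m+1+j$, $0\le j\le s-2$: $\Gamma_i(i)=2^{9s+8m+3j}-7\cdot2^{8s+8m+4j-2}+7\cdot2^{7s+8m+5j-3}-2^{6s+8m+6j-3}$. - For $i=3s+2m$: $\Gamma_i(i)=21\cdot2^{8m+12s-9}$.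 **(3) Reduction formulas.** - $\Gamma_{2s+m+1+j}^{[s,m]\times k}=16^{2j}\,\Gamma_{2s+1+(m-j)}^{[s,m-j]\times(k-2j)}$ for $0\le j\le m-2$, $k\ge 2s+m+2+j$. - $\Gamma_{2s+2m}^{[s,m]\times k}=16^{2m-2}\,\Gamma_{2s+2}^{[s,1]\times(k-2(m-1))}$ for $k\ge 2s+2m+1$. - $\Gamma_{2s+2m+1+j}^{[s,m]\times k}=16^{2m+3j}\,\Gamma_{2(s-j)+1}^{[s-j,0]\times(k-2m-3j)}$ for $0\le j\le s-2$, $k\ge 2s+2m+2+j$. - $\Gamma_{3s+2m}^{[s,m]\times k}=16^{2m+3s-3}\,\Gamma_{3}^{[1,0]\times(k-2m-3s+3)}$ for $k\ge 3s+2m$. **(4) Exponential sum.** Let $\mathbb K=\mathbb F_2((T^{-1}))$, let $\mathbb P=\{\sum_{i\ge1}\alpha_iT^{-i}\}$ be its unit interval, let $dt$ be the Haar measure on $\mathbb K$ with $\int_{\mathbb P}dt=1$, and let $E(t)=(-1)^{c}$, where $c$ is the coefficient of $T^{-1}$ in $t\in\mathbb K$. For $k\ge1$ and $(t,\eta,\xi)\in\mathbb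 P^3$ put $$g(t,\eta,\xi)=\sum_{\deg Y\le k-1}\ \sum_{\deg Z\le s-1}E(tYZ)\sum_{\deg U\le s+m-1}E(\eta YU)\sum_{\deg V\le s+m-1}E(\xi YV),$$ the sums being over polynomials in $\mathbb F_2[T]$, zero included. Let $D(t,\eta,\xi)$ be the $(3s+2m)\times k$ matrix whose three blocks have $s$, $s+m$, $s+m$ rows and have as entry in row $a$ and column $b$ the coefficient of $T^{-(a+b-1)}$ in $t$, $\eta$, $\xi$ respectively, and let $r$ be its rank. Then $$g(t,\eta,\xi)=2^{3s+2m+k-r},$$ and for every integer $q\ge1$ $$\int_{\mathbb P^3}g^q(t,\eta,\xi)\,dt\,d\eta\,d\xi=2^{(k+3s+2m)q-(3k+3s+2m-3)}\sum_{i=0}^{\min(k,3s+2m)}\Gamma_i^{[s,m]\times k}\,2^{-iq}.$$ **(5) Number of solutions.** For $k,q\ge1$, let $R_q(k,s,m)$ be the number of solutions $(Y_1,Z_1,U_1,V_1,\dots,Y_q,Z_q,U_q,V_q)$ in $\mathbb F_2[T]$ of $$\sum_{i=1}^qY_iZ_i=0,\qquad \sum_{i=1}^qY_iU_i=0,\qquad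 \sum_{i=1}^qY_iV_i=0$$ with $\deg Y_i\le k-1$, $\deg Z_i\le s-1$, $\deg U_i\le s+m-1$, $\deg V_i\le s+m-1$ for $1\le i\le q$. Then $R_q(k,s,m)=\int_{\mathbb P^3}g^q\,dt\,d\eta\,d\xi$, which equals the linear combination of the $\Gamma_i^{[s,m]\times k}$ in (4). -/

import Mathlib

open MeasureTheory Polynomial
open scoped LaurentSeries

namespace TriplePersymmetric

/-- The field `𝔽₂((T⁻¹))`: Laurent series over `𝔽₂` in the variable `X = T⁻¹`, so that the
coefficient of `T⁻ⁱ` in `t` is `t.coeff i`. It carries the valuation topology, in which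
`|t| < 1` means that only the powers `T⁻¹, T⁻², …` occur in `t`. -/
abbrev K : Type := LaurentSeries (ZMod 2)

/-- The embedding `𝔽₂[T] → 𝔽₂((T⁻¹))`, which sends `T` to `X⁻¹`. -/
noncomputable def ofPoly : (ZMod 2)[X] →+* K :=
  Polynomial.eval₂RingHom (HahnSeries.C : ZMod 2 →+* K) (HahnSeries.single (-1 : ℤ) (1 : ZMod 2))

/-- The additive character `E(t) = (-1)^(t₋₁)`, where `t₋₁` is the coefficient of `T⁻¹`. -/
noncomputable def E (t : K) : ℤ := if t.coeff 1 = 0 then 1 else -1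

/-- The unit interval `ℙ`: the series `∑_{i ≥ 1} αᵢ T⁻ⁱ`. -/
def unitInterval : Set K := {t | ∀ n : ℤ, n ≤ 0 → t.coeff n = 0}

theorem mem_unitInterval_iff (t : K) :
    t ∈ unitInterval ↔ Valued.v t ≤ WithZero.exp (-1 : ℤ) := by
  rw [LaurentSeries.valuation_le_iff_coeff_lt_eq_zero]
  exact ⟨fun h n hn => h n (by omega), fun h n hn => h n (by omega)⟩

/-- The series with prescribed coefficients at `T⁻¹, T⁻², …`. -/
noncomputable def ofDigits (c : ℕ → ZMod 2) : K :=
  HahnSeries.ofSuppBddBelow (fun n : ℤ => if 1 ≤ n then c (n - 1).toNat else 0)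
    ⟨1, fun n hn => by
      by_contra h
      exact hn (if_neg h)⟩

theorem coeff_ofDigits (c : ℕ → ZMod 2) (n : ℤ) :
    (ofDigits c).coeff n = if 1 ≤ n then c (n - 1).toNat else 0 := rfl

theorem range_ofDigits : Set.range ofDigits = unitInterval := by
  ext t
  constructor
  · rintro ⟨c, rfl⟩ n hn
    rw [coeff_ofDigits, if_neg (by omega)]
  · intro ht
    refine ⟨fun i => t.coeff (i + 1), ?_⟩
    ext n
    rw [coeff_ofDigits]
    split_ifs with h
    · congr 1
      omega
    · exact (ht n (by omega)).symm

theorem continuous_ofDigits : Continuous ofDigits := by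
  rw [continuous_iff_continuousAt]
  intro c U hU
  obtain ⟨γ, hγ⟩ := Valued.mem_nhds.mp hU
  set D : ℤ := -(WithZero.log (MonoidWithZeroHom.ValueGroup₀.embedding γ.1) - 1) with hD₀
  have hD : WithZero.exp (-D) < MonoidWithZeroHom.ValueGroup₀.embedding γ.1 := by
    rw [← WithZero.lt_log_iff_exp_lt (by simp), hD₀]
    simp
  have hev : ∀ᶠ c' in nhds c, ∀ n ∈ Finset.range D.toNat, c' n = c n := by
    rw [Filter.eventually_all_finset]
    intro n _
    have ho : IsOpen ((fun c' : ℕ → ZMod 2 => c' n) ⁻¹' {c n}) :=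
      (isOpen_discrete _).preimage (continuous_apply n)
    exact ho.mem_nhds rfl
  refine Filter.mem_map.mpr (Filter.mem_of_superset hev fun c' hc' => hγ ?_)
  change Valued.v.restrict (ofDigits c' - ofDigits c) < γ.1
  rw [Valuation.restrict_lt_iff_lt_embedding]
  refine lt_of_le_of_lt ?_ hD
  rw [LaurentSeries.valuation_le_iff_coeff_lt_eq_zero]
  intro n hn
  rw [HahnSeries.coeff_sub, coeff_ofDigits, coeff_ofDigits]
  split_ifs with h
  · rw [hc' _ (Finset.mem_range.mpr (by omega)), sub_self]
  · exact sub_self 0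

theorem isCompact_unitInterval : IsCompact unitInterval := by
  rw [← range_ofDigits]
  exact isCompact_range continuous_ofDigits

theorem unitInterval_mem_nhds : unitInterval ∈ nhds (0 : K) := by
  have h0 : Valued.v.restrict (HahnSeries.single (1 : ℤ) (1 : ZMod 2) : K) ≠ 0 := by
    rw [Ne, Valuation.restrict_eq_zero_iff, LaurentSeries.valuation_single_zpow]
    simp
  rw [Valued.mem_nhds_zero]
  refine ⟨Units.mk0 _ h0, fun t ht => ?_⟩
  have h1 := (Valuation.restrict_lt_iff _).mp ht
  rw [LaurentSeries.valuation_single_zpow] at h1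
  exact (mem_unitInterval_iff t).mpr h1.le

/-- The unit interval as a compact set with non-empty interior. -/
noncomputable def unitCompacts : TopologicalSpace.PositiveCompacts K where
  carrier := unitInterval
  isCompact' := isCompact_unitInterval
  interior_nonempty' := ⟨0, mem_interior_iff_mem_nhds.mpr unitInterval_mem_nhds⟩

noncomputable instance : MeasurableSpace K := borel K

instance : BorelSpace K := ⟨rfl⟩

/-- The Haar measure `dt` of `𝔽₂((T⁻¹))`, normalized so that `∫_ℙ dt = 1`. -/
noncomputable def haarK : Measure K := Measure.addHaarMeasure unitCompacts

/-- The Haar measure restricted to the unit interval `ℙ`. -/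
noncomputable def haarP : Measure K := haarK.restrict unitInterval

instance : IsProbabilityMeasure haarP :=
  ⟨by rw [haarP, Measure.restrict_apply_univ]; exact Measure.addHaarMeasure_self⟩

theorem finite_degree_lt (n : ℕ) : {p : (ZMod 2)[X] | p.degree < n}.Finite := by
  have : Finite (Polynomial.degreeLT (ZMod 2) n) :=
    Finite.of_equiv _ (Polynomial.degreeLTEquiv (ZMod 2) n).symm.toEquiv
  refine Set.Finite.subset (Set.toFinite (Polynomial.degreeLT (ZMod 2) n : Set (ZMod 2)[X])) ?_
  intro p hp
  exact Polynomial.mem_degreeLT.mpr hp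

/-- The polynomials of degree at most `n - 1` over `𝔽₂`, the zero polynomial included. -/
noncomputable def polys (n : ℕ) : Finset (ZMod 2)[X] := (finite_degree_lt n).toFinset

/-- The exponential sum
`g(t,η,ξ) = ∑_{deg Y ≤ k-1} ∑_{deg Z ≤ s-1} E(tYZ) ∑_{deg U ≤ s+m-1} E(ηYU) ∑_{deg V ≤ s+m-1} E(ξYV)`.
-/
noncomputable def g (k s m : ℕ) (t η ξ : K) : ℤ :=
  ∑ Y ∈ polys k,
    (∑ Z ∈ polys s, E (t * ofPoly Y * ofPoly Z)) *
      (∑ U ∈ polys (s + m), E (η * ofPoly Y * ofPoly U)) *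
        (∑ V ∈ polys (s + m), E (ξ * ofPoly Y * ofPoly V))

/-- A matrix `[α i j]` is persymmetric if `α i j = α r s` whenever `i + j = r + s`. -/
def IsPersymmetric {a k : ℕ} (A : Matrix (Fin a) (Fin k) (ZMod 2)) : Prop :=
  ∀ (i r : Fin a) (j s : Fin k), (i : ℕ) + j = r + s → A i j = A r s

/-- The three blocks `A`, `B`, `C` on top of each other. -/
def stack {a b c k : ℕ} (A : Matrix (Fin a) (Fin k) (ZMod 2))
    (B : Matrix (Fin b) (Fin k) (ZMod 2)) (C : Matrix (Fin c) (Fin k) (ZMod 2)) :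
    Matrix (Fin a ⊕ Fin b ⊕ Fin c) (Fin k) (ZMod 2) :=
  Matrix.fromRows A (Matrix.fromRows B C)

/-- The number of rank `i` triple persymmetric matrices, with persymmetric blocks of sizes `a × k`,
`b × k` and `c × k` over `𝔽₂`. -/
noncomputable def numRank (a b c k i : ℕ) : ℕ :=
  Set.ncard {M : Matrix (Fin a ⊕ Fin b ⊕ Fin c) (Fin k) (ZMod 2) |
    (∃ A B C, IsPersymmetric A ∧ IsPersymmetric B ∧ IsPersymmetric C ∧ M = stack A B C) ∧
      M.rank = i}

/-- The number `Γ_i^{[s over s+m over s+m] × k}`. -/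
noncomputable def Γ (s m k i : ℕ) : ℕ := numRank s (s + m) (s + m) k i

/-- The `a × k` persymmetric matrix whose entry in row `i` and column `j` (counted from `1`) is the
coefficient of `T^{-(i+j-1)}` in `t`. -/
def persym (a k : ℕ) (t : K) : Matrix (Fin a) (Fin k) (ZMod 2) :=
  Matrix.of fun i j => t.coeff ((i : ℤ) + j + 1)

/-- The triple persymmetric matrix `D^{[s over s+m over s+m] × k}(t,η,ξ)`. -/
def D (s m k : ℕ) (t η ξ : K) : Matrix (Fin s ⊕ Fin (s + m) ⊕ Fin (s + m)) (Fin k) (ZMod 2) :=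
  stack (persym s k t) (persym (s + m) k η) (persym (s + m) k ξ)

/-- The number `R_q(k,s,m)` of solutions `(Y₁,Z₁,U₁,V₁,…,Y_q,Z_q,U_q,V_q)` of
`∑ YᵢZᵢ = ∑ YᵢUᵢ = ∑ YᵢVᵢ = 0` in polynomials over `𝔽₂` with `deg Yᵢ ≤ k-1`, `deg Zᵢ ≤ s-1`,
`deg Uᵢ ≤ s+m-1` and `deg Vᵢ ≤ s+m-1`. -/
noncomputable def R (q k s m : ℕ) : ℕ :=
  Set.ncard {x : (Fin q → (ZMod 2)[X]) × (Fin q → (ZMod 2)[X]) ×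
      (Fin q → (ZMod 2)[X]) × (Fin q → (ZMod 2)[X]) |
    (∀ i, (x.1 i).degree < k ∧ (x.2.1 i).degree < s ∧
      (x.2.2.1 i).degree < (s + m : ℕ) ∧ (x.2.2.2 i).degree < (s + m : ℕ)) ∧
    ∑ i, x.1 i * x.2.1 i = 0 ∧ ∑ i, x.1 i * x.2.2.1 i = 0 ∧ ∑ i, x.1 i * x.2.2.2 i = 0}

end TriplePersymmetric

namespace PersymmetricRank

/-! ### Residues modulo a binary form, and kernels of digit strings -/

section Algebra

variable {F : Type*} [Field F]

instance finite_degreeLT (n : ℕ) : FiniteDimensional F (degreeLT F n) :=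
  (degreeLTEquiv F n).symm.finiteDimensional

theorem finrank_degreeLT (n : ℕ) : Module.finrank F (degreeLT F n) = n := by
  rw [(degreeLTEquiv F n).finrank_eq, Module.finrank_fin_fun]

theorem natDegree_le_of_mem_degreeLT {n : ℕ} {p : F[X]} (hp : p ∈ degreeLT F n) :
    p.natDegree ≤ n - 1 := by
  rw [mem_degreeLT] at hp
  rcases eq_or_ne p 0 with rfl | h0
  · simp
  · have := (natDegree_lt_iff_degree_lt h0).mpr hp
    omega

theorem mul_mem_degreeLT {r n l : ℕ} (h : r + n = l + 1) {p q : F[X]} (hp : p ∈ degreeLT F r)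
    (hq : q ∈ degreeLT F n) : p * q ∈ degreeLT F l := by
  rcases eq_or_ne p 0 with rfl | hp0
  · simp
  rcases eq_or_ne q 0 with rfl | hq0
  · simp
  rw [mem_degreeLT] at hp hq ⊢
  rw [← natDegree_lt_iff_degree_lt hp0] at hp
  rw [← natDegree_lt_iff_degree_lt hq0] at hq
  rw [← natDegree_lt_iff_degree_lt (mul_ne_zero hp0 hq0), natDegree_mul hp0 hq0]
  omega

/-- Preimages of subspaces under a surjective linear map. -/
theorem finrank_comap_of_surjective {V W : Type*} [AddCommGroup V] [Module F V]
    [FiniteDimensional F V] [AddCommGroup W] [Module F W] {f : V →ₗ[F] W}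
    (hf : Function.Surjective f) (S : Submodule F W) :
    Module.finrank F (S.comap f) =
      Module.finrank F S + Module.finrank F (LinearMap.ker f) := by
  have h := LinearMap.finrank_range_add_finrank_ker (f.domRestrict (S.comap f))
  have h1 : LinearMap.range (f.domRestrict (S.comap f)) = S := by
    ext w
    constructor
    · rintro ⟨⟨v, hv⟩, rfl⟩
      exact hv
    · intro hw
      obtain ⟨v, rfl⟩ := hf w
      exact ⟨⟨v, hw⟩, rfl⟩
  have h2 : Module.finrank F (LinearMap.ker (f.domRestrict (S.comap f))) =
      Module.finrank F (LinearMap.ker f) := by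
    refine LinearEquiv.finrank_eq
      { toFun := fun v => ⟨v.1.1, v.2⟩
        invFun := fun v => ⟨⟨v.1, by
          have : f v.1 = 0 := v.2
          simp [this]⟩, v.2⟩
        map_add' := fun _ _ => rfl
        map_smul' := fun _ _ => rfl
        left_inv := fun _ => rfl
        right_inv := fun _ => rfl }
  rw [h1, h2] at h
  exact h.symm

/-- The ring `F[X]/(Y) × F[X]/(X^v)`: residues modulo the form attached to `Y`, which vanishes
at infinity to order `v`. -/
abbrev ResidueRing (Y : F[X]) (v : ℕ) : Type _ := AdjoinRoot Y × AdjoinRoot ((X : F[X]) ^ v)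

/-- The residue of a polynomial, considered as a form of degree `n - 1`. -/
noncomputable def residue (Y : F[X]) (v n : ℕ) : F[X] →ₗ[F] ResidueRing Y v where
  toFun p := (AdjoinRoot.mk Y p, AdjoinRoot.mk (X ^ v) (reflect (n - 1) p))
  map_add' p q := by simp [reflect_add]
  map_smul' c p := by
    change (AdjoinRoot.mk Y (c • p), AdjoinRoot.mk (X ^ v) (reflect (n - 1) (c • p))) =
      (c • AdjoinRoot.mk Y p, c • AdjoinRoot.mk (X ^ v) (reflect (n - 1) p))
    rw [Polynomial.smul_eq_C_mul, reflect_C_mul, map_mul, map_mul, AdjoinRoot.mk_C,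
      AdjoinRoot.mk_C, Algebra.smul_def, Algebra.smul_def, AdjoinRoot.algebraMap_eq,
      AdjoinRoot.algebraMap_eq]

/-- Forms of degrees r - 1 and n - 1 multiply to a form of degree l - 1, and reflection at these
nominal degrees, the expansion at infinity, is multiplicative. -/
theorem residue_mul (Y : F[X]) (v : ℕ) {r n l : ℕ} (h : r + n = l + 1) {p q : F[X]}
    (hp : p ∈ degreeLT F r) (hq : q ∈ degreeLT F n) :
    residue Y v l (p * q) = residue Y v r p * residue Y v n q := by
  rcases Nat.eq_zero_or_pos r with rfl | hr
  · have : p = 0 := by simpa [mem_degreeLT] using hp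
    simp [this]
  rcases Nat.eq_zero_or_pos n with rfl | hn
  · have : q = 0 := by simpa [mem_degreeLT] using hq
    simp [this]
  have hl : l - 1 = (r - 1) + (n - 1) := by omega
  have := reflect_mul p q (natDegree_le_of_mem_degreeLT hp) (natDegree_le_of_mem_degreeLT hq)
  simp only [residue, LinearMap.coe_mk, AddHom.coe_mk, Prod.mk_mul_mk, ← map_mul, hl, this]

/-- The condition modulo `Y` is divisibility at the finite places; the condition modulo `X ^ v` is a
drop of v in the degree. Together they are divisibility by one form of degree deg Y + v. -/
theorem residue_eq_zero_iff {Y : F[X]} (hY : Y ≠ 0) {v n : ℕ} (hn : Y.natDegree + v ≤ n)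
    {p : F[X]} (hp : p ∈ degreeLT F n) :
    residue Y v n p = 0 ↔ ∃ q ∈ degreeLT F (n - (Y.natDegree + v)), p = Y * q := by
  have key : ∀ p : F[X], residue Y v n p = 0 ↔ Y ∣ p ∧ X ^ v ∣ reflect (n - 1) p := by
    intro p
    simp [residue, Prod.ext_iff, AdjoinRoot.mk_eq_zero]
  rw [key, X_pow_dvd_iff]
  constructor
  · rintro ⟨⟨q, rfl⟩, h⟩
    refine ⟨q, ?_, rfl⟩
    rcases eq_or_ne q 0 with rfl | hq
    · simp
    rw [mem_degreeLT, ← natDegree_lt_iff_degree_lt hq]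
    have hd : (Y * q).natDegree < n := by
      rw [mem_degreeLT] at hp
      exact (natDegree_lt_iff_degree_lt (mul_ne_zero hY hq)).mpr hp
    by_contra hlt
    have hmul := natDegree_mul hY hq
    -- The reflection carries the leading coefficient to this index, so too large a degree
    -- contradicts vanishing to order v.
    have h1 := h (n - 1 - (Y * q).natDegree) (by omega)
    rw [coeff_reflect, revAt_le (by omega), show n - 1 - (n - 1 - (Y * q).natDegree) =
      (Y * q).natDegree by omega, coeff_natDegree, leadingCoeff_eq_zero] at h1
    exact mul_ne_zero hY hq h1
  · rintro ⟨q, hq, rfl⟩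
    refine ⟨dvd_mul_right _ _, fun d hd => ?_⟩
    rcases eq_or_ne q 0 with rfl | hq0
    · simp
    rw [mem_degreeLT, ← natDegree_lt_iff_degree_lt hq0] at hq
    rw [coeff_reflect, revAt_le (by omega)]
    apply coeff_eq_zero_of_natDegree_lt
    rw [natDegree_mul hY hq0]
    omega

theorem finrank_residueRing {Y : F[X]} (hY : Y ≠ 0) (v : ℕ) :
    Module.finrank F (ResidueRing Y v) = Y.natDegree + v := by
  have hX : (X : F[X]) ^ v ≠ 0 := pow_ne_zero _ X_ne_zero
  have : FiniteDimensional F (AdjoinRoot Y) := (AdjoinRoot.powerBasis hY).finite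
  have : FiniteDimensional F (AdjoinRoot ((X : F[X]) ^ v)) := (AdjoinRoot.powerBasis hX).finite
  rw [Module.finrank_prod, (AdjoinRoot.powerBasis hY).finrank, (AdjoinRoot.powerBasis hX).finrank,
    AdjoinRoot.powerBasis_dim, AdjoinRoot.powerBasis_dim, natDegree_X_pow]

theorem finite_residueRing {Y : F[X]} (hY : Y ≠ 0) (v : ℕ) :
    FiniteDimensional F (ResidueRing Y v) := by
  have hX : (X : F[X]) ^ v ≠ 0 := pow_ne_zero _ X_ne_zero
  have : FiniteDimensional F (AdjoinRoot Y) := (AdjoinRoot.powerBasis hY).finite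
  have : FiniteDimensional F (AdjoinRoot ((X : F[X]) ^ v)) := (AdjoinRoot.powerBasis hX).finite
  infer_instance

/-- The residue map on polynomials of degree less than `n`. -/
noncomputable def residueLT (Y : F[X]) (v n : ℕ) : degreeLT F n →ₗ[F] ResidueRing Y v :=
  (residue Y v n).domRestrict (degreeLT F n)

theorem finrank_ker_residueLT {Y : F[X]} (hY : Y ≠ 0) {v n : ℕ} (hn : Y.natDegree + v ≤ n) :
    Module.finrank F (LinearMap.ker (residueLT Y v n)) = n - (Y.natDegree + v) := by
  have hmem : ∀ q ∈ degreeLT F (n - (Y.natDegree + v)), Y * q ∈ degreeLT F n := by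
    intro q hq
    refine degreeLT_mono (m := n - v) (by omega) (mul_mem_degreeLT (r := Y.natDegree + 1)
      (by omega) ?_ hq)
    rw [mem_degreeLT, ← natDegree_lt_iff_degree_lt hY]
    omega
  let f : degreeLT F (n - (Y.natDegree + v)) →ₗ[F] LinearMap.ker (residueLT Y v n) :=
    { toFun := fun q => ⟨⟨Y * q.1, hmem q.1 q.2⟩,
        (residue_eq_zero_iff hY hn (hmem q.1 q.2)).mpr ⟨q.1, q.2, rfl⟩⟩
      map_add' := fun p q => by ext1; ext1; simp [mul_add]
      map_smul' := fun c q => by ext1; ext1; simp }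
  have hf : Function.Bijective f := by
    constructor
    · intro p q hpq
      have h1 : Y * p.1 = Y * q.1 := congrArg (fun z => z.1.1) hpq
      exact Subtype.ext (mul_left_cancel₀ hY h1)
    · rintro ⟨⟨p, hp⟩, h0⟩
      obtain ⟨q, hq, rfl⟩ := (residue_eq_zero_iff hY hn hp).mp h0
      exact ⟨⟨q, hq⟩, rfl⟩
  rw [← (LinearEquiv.ofBijective f hf).finrank_eq, finrank_degreeLT]

/-- Dimension count: the kernel consists of the multiples of `Y` and leaves deg Y + v dimensions for
the image, which is all of the ring. -/
theorem residueLT_surjective {Y : F[X]} (hY : Y ≠ 0) {v n : ℕ} (hn : Y.natDegree + v ≤ n) :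
    Function.Surjective (residueLT Y v n) := by
  have := finite_residueRing hY v
  rw [← LinearMap.range_eq_top]
  apply Submodule.eq_top_of_finrank_eq
  have h := LinearMap.finrank_range_add_finrank_ker (residueLT Y v n)
  rw [finrank_ker_residueLT hY hn, finrank_degreeLT] at h
  rw [finrank_residueRing hY]
  omega

/-- The pairing of a digit string of length `l` with polynomials. -/
noncomputable def pair {l : ℕ} (x : Fin l → F) : F[X] →ₗ[F] F :=
  ∑ i : Fin l, x i • Polynomial.lcoeff F i

theorem pair_apply {l : ℕ} (x : Fin l → F) (p : F[X]) : pair x p = ∑ i, x i * p.coeff i := by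
  simp [pair]

theorem pair_X_pow {l : ℕ} (x : Fin l → F) (i : Fin l) : pair x (X ^ (i : ℕ)) = x i := by
  rw [pair_apply, Finset.sum_eq_single i]
  · simp
  · intro j _ hj
    rw [coeff_X_pow, if_neg (fun h => hj (Fin.ext h)), mul_zero]
  · simp

theorem eq_on_degreeLT {W : Type*} [AddCommGroup W] [Module F W] {l : ℕ} {f g : F[X] →ₗ[F] W}
    (h : ∀ i : Fin l, f (X ^ (i : ℕ)) = g (X ^ (i : ℕ))) {p : F[X]} (hp : p ∈ degreeLT F l) :
    f p = g p := by
  classical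
  rw [degreeLT_eq_span_X_pow] at hp
  refine LinearMap.eqOn_span (f := f) (g := g) ?_ hp
  intro q hq
  simp only [Finset.coe_image, Set.mem_image, Finset.mem_coe, Finset.mem_range] at hq
  obtain ⟨i, hi, rfl⟩ := hq
  exact h ⟨i, hi⟩

/-- The digit strings of length `l` that annihilate the multiples of `Y` correspond to the linear
functionals on the residue ring. -/
noncomputable def dualEquiv {Y : F[X]} (hY : Y ≠ 0) {v l : ℕ} (hl : Y.natDegree + v ≤ l) :
    Module.Dual F (ResidueRing Y v) ≃
      {x : Fin l → F // ∀ q ∈ degreeLT F (l - (Y.natDegree + v)), pair x (Y * q) = 0} :=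
  Equiv.ofBijective
    (fun φ => ⟨fun i => φ (residue Y v l (X ^ (i : ℕ))), fun q hq => by
      have hmem : Y * q ∈ degreeLT F l := by
        refine degreeLT_mono (m := l - v) (by omega) (mul_mem_degreeLT (r := Y.natDegree + 1)
          (by omega) ?_ hq)
        rw [mem_degreeLT, ← natDegree_lt_iff_degree_lt hY]
        omega
      rw [eq_on_degreeLT (f := pair fun i : Fin l => φ (residue Y v l (X ^ (i : ℕ))))
        (g := φ ∘ₗ residue Y v l) (fun i => pair_X_pow _ i) hmem,
        LinearMap.comp_apply, (residue_eq_zero_iff hY hl hmem).mpr ⟨q, hq, rfl⟩, map_zero]⟩) (by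
    constructor
    · intro φ ψ h
      have h1 : ∀ i : Fin l, (φ ∘ₗ residue Y v l) (X ^ (i : ℕ)) =
          (ψ ∘ₗ residue Y v l) (X ^ (i : ℕ)) := fun i => congrFun (congrArg Subtype.val h) i
      refine LinearMap.ext fun z => ?_
      obtain ⟨⟨p, hp⟩, rfl⟩ := residueLT_surjective hY hl z
      exact eq_on_degreeLT h1 hp
    · rintro ⟨x, hx⟩
      -- A functional that kills the kernel of the residue map factors through it; this is the dual
      -- of the exact sequence of multiples, polynomials and residues.
      have h0 : (pair x).domRestrict (degreeLT F l) ∈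
          LinearMap.range (residueLT Y v l).dualMap := by
        have := finite_residueRing hY v
        rw [LinearMap.range_dualMap_eq_dualAnnihilator_ker, Submodule.mem_dualAnnihilator]
        rintro ⟨p, hp⟩ hk
        obtain ⟨q, hq, rfl⟩ := (residue_eq_zero_iff hY hl hp).mp hk
        exact hx q hq
      obtain ⟨φ, hφ⟩ := h0
      refine ⟨φ, Subtype.ext (funext fun i => ?_)⟩
      have hm : (X : F[X]) ^ (i : ℕ) ∈ degreeLT F l := by
        rw [mem_degreeLT, degree_X_pow]
        exact_mod_cast i.2
      have := LinearMap.congr_fun hφ ⟨_, hm⟩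
      simpa [residueLT, pair_X_pow] using this)

theorem pair_dualEquiv {Y : F[X]} (hY : Y ≠ 0) {v l : ℕ} (hl : Y.natDegree + v ≤ l)
    (φ : Module.Dual F (ResidueRing Y v)) {p : F[X]} (hp : p ∈ degreeLT F l) :
    pair (dualEquiv hY hl φ).1 p = φ (residue Y v l p) :=
  eq_on_degreeLT (g := φ ∘ₗ residue Y v l) (fun i => pair_X_pow _ i) hp

variable {ι : Type*}

/-- The polynomials `Z` of degree less than `n` such that all multiples `QZ` with
`deg Q < r b` are orthogonal to the digit string `x b`, for all blocks `b`. -/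
noncomputable def kerSpace (L r : ι → ℕ) (n : ℕ) (x : ∀ b, Fin (L b) → F) :
    Submodule F (degreeLT F n) where
  carrier := {Z | ∀ b, ∀ Q ∈ degreeLT F (r b), pair (x b) (Q * Z.1) = 0}
  add_mem' := fun hz hw b Q hQ => by
    rw [Submodule.coe_add, mul_add, map_add, hz b Q hQ, hw b Q hQ, add_zero]
  zero_mem' := fun b Q _ => by simp
  smul_mem' := fun c Z hZ b Q hQ => by
    rw [Submodule.coe_smul, mul_smul_comm, map_smul, hZ b Q hQ, smul_zero]

theorem mem_kerSpace {L r : ι → ℕ} {n : ℕ} {x : ∀ b, Fin (L b) → F} {Z : degreeLT F n} :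
    Z ∈ kerSpace L r n x ↔ ∀ b, ∀ Q ∈ degreeLT F (r b), pair (x b) (Q * Z.1) = 0 := Iff.rfl

/-- The analogue of `kerSpace` in the residue ring. -/
noncomputable def residueKer (Y : F[X]) (v : ℕ) (r : ι → ℕ)
    (φ : ι → Module.Dual F (ResidueRing Y v)) : Submodule F (ResidueRing Y v) where
  carrier := {z | ∀ b, ∀ Q ∈ degreeLT F (r b), φ b (residue Y v (r b) Q * z) = 0}
  add_mem' := fun hz hw b Q hQ => by
    rw [mul_add, map_add, hz b Q hQ, hw b Q hQ, add_zero]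
  zero_mem' := fun b Q _ => by simp
  smul_mem' := fun c Z hZ b Q hQ => by
    rw [mul_smul_comm, map_smul, hZ b Q hQ, smul_zero]

/-- The kernel is the preimage of `residueKer` under reduction modulo the form. The residue part
does not depend on the number n of columns, so the length of the strings enters only through the
explicit summand. -/
theorem finrank_kerSpace {Y : F[X]} (hY : Y ≠ 0) {v n : ℕ} {L r : ι → ℕ}
    (hn : Y.natDegree + v ≤ n) (hL : ∀ b, Y.natDegree + v ≤ L b) (hr : ∀ b, r b + n = L b + 1)
    (φ : ι → Module.Dual F (ResidueRing Y v)) :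
    Module.finrank F (kerSpace L r n fun b => (dualEquiv hY (hL b) (φ b)).1) =
      Module.finrank F (residueKer Y v r φ) + (n - (Y.natDegree + v)) := by
  rw [← finrank_ker_residueLT hY hn, ← finrank_comap_of_surjective (residueLT_surjective hY hn)]
  suffices h : (kerSpace L r n fun b => (dualEquiv hY (hL b) (φ b)).1) =
      (residueKer Y v r φ).comap (residueLT Y v n) by rw [h]
  ext Z
  simp only [mem_kerSpace, Submodule.mem_comap, residueKer, Submodule.mem_mk, AddSubmonoid.mem_mk,
    AddSubsemigroup.mem_mk, Set.mem_ofPred_eq]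
  refine forall_congr' fun b => forall₂_congr fun Q hQ => ?_
  rw [pair_dualEquiv hY (hL b) _ (mul_mem_degreeLT (hr b) hQ Z.2),
    residue_mul Y v (hr b) hQ Z.2]
  rfl

theorem finrank_kerSpace_le {L r : ι → ℕ} {n : ℕ} (x : ∀ b, Fin (L b) → F) :
    Module.finrank F (kerSpace L r n x) ≤ n := by
  have := Submodule.finrank_le (kerSpace L r n x)
  rwa [finrank_degreeLT] at this

/-- The kernel space as a space of polynomials. -/
noncomputable def polyKer (L r : ι → ℕ) (n : ℕ) (x : ∀ b, Fin (L b) → F) : Submodule F F[X] :=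
  (kerSpace L r n x).map (degreeLT F n).subtype

theorem mem_polyKer {L r : ι → ℕ} {n : ℕ} {x : ∀ b, Fin (L b) → F} {Z : F[X]} :
    Z ∈ polyKer L r n x ↔
      Z ∈ degreeLT F n ∧ ∀ b, ∀ Q ∈ degreeLT F (r b), pair (x b) (Q * Z) = 0 := by
  constructor
  · intro h
    obtain ⟨W, hW, rfl⟩ := Submodule.mem_map.mp h
    exact ⟨W.2, mem_kerSpace.mp hW⟩
  · rintro ⟨h1, h2⟩
    exact Submodule.mem_map.mpr ⟨⟨Z, h1⟩, mem_kerSpace.mpr h2, rfl⟩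

theorem finrank_polyKer (L r : ι → ℕ) (n : ℕ) (x : ∀ b, Fin (L b) → F) :
    Module.finrank F (polyKer L r n x) = Module.finrank F (kerSpace L r n x) :=
  Submodule.finrank_map_subtype_eq _ _

instance finite_polyKer (L r : ι → ℕ) (n : ℕ) (x : ∀ b, Fin (L b) → F) :
    FiniteDimensional F (polyKer L r n x) :=
  Module.Finite.map (kerSpace L r n x) (degreeLT F n).subtype

theorem finrank_kerSpace_mono (α : ι → ℕ) (k : ℕ) (x : ∀ b, Fin (α b + k) → F) :
    Module.finrank F (kerSpace (fun b => α b + k) (fun b => α b + 1) k x) ≤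
      Module.finrank F (kerSpace (fun b => α b + k) α (k + 1) x) := by
  rw [← finrank_polyKer, ← finrank_polyKer]
  refine Submodule.finrank_mono fun Z hZ => ?_
  rw [mem_polyKer] at hZ ⊢
  exact ⟨degreeLT_mono (Nat.le_succ k) hZ.1,
    fun b Q hQ => hZ.2 b Q (degreeLT_mono (Nat.le_succ _) hQ)⟩

theorem coeff_eq_zero_of_mem_degreeLT {n : ℕ} {p : F[X]} (hp : p ∈ degreeLT F n) {m : ℕ}
    (hm : n ≤ m) : p.coeff m = 0 :=
  (degree_lt_iff_coeff_zero p n).mp (mem_degreeLT.mp hp) m hm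

theorem mem_degreeLT_of_succ {n : ℕ} {p : F[X]} (hp : p ∈ degreeLT F (n + 1))
    (h0 : p.coeff n = 0) : p ∈ degreeLT F n := by
  rw [mem_degreeLT, degree_lt_iff_coeff_zero]
  intro m hm
  rcases hm.eq_or_lt with rfl | hm
  · exact h0
  · exact coeff_eq_zero_of_mem_degreeLT hp hm

/-- The smaller kernel is cut out of the larger one by one equation per block, its last row, and one
more that removes the top coefficient. -/
theorem finrank_kerSpace_le_add [Fintype ι] (α : ι → ℕ) (k : ℕ) (x : ∀ b, Fin (α b + k) → F) :
    Module.finrank F (kerSpace (fun b => α b + k) α (k + 1) x) ≤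
      Module.finrank F (kerSpace (fun b => α b + k) (fun b => α b + 1) k x) +
        (Fintype.card ι + 1) := by
  rw [← finrank_polyKer, ← finrank_polyKer]
  let f : F[X] →ₗ[F] (ι → F) × F :=
    (LinearMap.pi fun b => pair (x b) ∘ₗ LinearMap.mulLeft F (X ^ α b)).prod (lcoeff F k)
  let S := polyKer (fun b => α b + k) α (k + 1) x
  have h := LinearMap.finrank_range_add_finrank_ker (K := F) (f.domRestrict S)
  have h1 : Module.finrank F (LinearMap.range (f.domRestrict S)) ≤ Fintype.card ι + 1 := by
    refine (Submodule.finrank_le _).trans (le_of_eq ?_)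
    rw [Module.finrank_prod, Module.finrank_fintype_fun_eq_card, Module.finrank_self]
  have h2 : Module.finrank F (LinearMap.ker (f.domRestrict S)) ≤
      Module.finrank F (polyKer (fun b => α b + k) (fun b => α b + 1) k x) := by
    rw [← Submodule.finrank_map_subtype_eq S]
    refine Submodule.finrank_mono fun Z hZ => ?_
    obtain ⟨W, hW, rfl⟩ := Submodule.mem_map.mp hZ
    have hf : f W.1 = 0 := LinearMap.mem_ker.mp hW
    have hc : W.1.coeff k = 0 := congrArg Prod.snd hf
    have hS := mem_polyKer.mp W.2
    refine mem_polyKer.mpr ⟨mem_degreeLT_of_succ hS.1 hc, fun b Q hQ => ?_⟩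
    have hb : pair (x b) (X ^ α b * W.1) = 0 := congrFun (congrArg Prod.fst hf) b
    -- Without its top term `Q` is a combination of the old rows; the top term is the new row,
    -- handled by `hb`.
    have hQ' := hS.2 b (Q - C (Q.coeff (α b)) * X ^ α b) (by
      refine mem_degreeLT_of_succ (sub_mem hQ ?_) (by simp)
      rw [mem_degreeLT]
      exact (degree_C_mul_X_pow_le _ _).trans_lt (by exact_mod_cast Nat.lt_succ_self _))
    rw [sub_mul, map_sub, mul_assoc, ← Polynomial.smul_eq_C_mul, map_smul, hb, smul_zero,
      sub_zero] at hQ'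
    exact hQ'
  change Module.finrank F S ≤ _
  omega

end Algebra

/-! ### Double counting of strings and kernel vectors -/

section Count

variable {ι : Type*}

/-- Digit strings of prescribed lengths over `𝔽₂`. -/
abbrev Digits (L : ι → ℕ) : Type _ := ∀ b, Fin (L b) → ZMod 2

/-- The number of digit strings whose kernel space has dimension `d`. -/
noncomputable def kerCount (L r : ι → ℕ) (n d : ℕ) : ℕ :=
  Nat.card {x : Digits L // Module.finrank (ZMod 2) (kerSpace L r n x) = d}

/-- The number of digit strings with kernel spaces of dimension `d` for blocks with `α b + 1` rows
and `k` columns, and of dimension `d + n` for blocks with `α b` rows and `k + 1` columns. -/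
noncomputable def jointCount (α : ι → ℕ) (k d n : ℕ) : ℕ :=
  Nat.card {x : Digits (fun b => α b + k) //
    Module.finrank (ZMod 2) (kerSpace (fun b => α b + k) (fun b => α b + 1) k x) = d ∧
    Module.finrank (ZMod 2) (kerSpace (fun b => α b + k) α (k + 1) x) = d + n}

/-- When r rows just fill the length, having `Y` in the kernel means orthogonality to all multiples
of the form in that length, so `dualEquiv` applies block by block. The right side involves the
length only through `P`. -/
theorem card_annihilator {F : Type*} [Field F] {Y : F[X]} (hY : Y ≠ 0) {v : ℕ} {L r : ι → ℕ}
    (hr : ∀ b, r b + (Y.natDegree + v) = L b) (hL : ∀ b, Y.natDegree + v ≤ L b)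
    (P : (∀ b, Fin (L b) → F) → Prop) :
    Nat.card {x : ∀ b, Fin (L b) → F //
      (∀ b, ∀ Q ∈ degreeLT F (r b), pair (x b) (Q * Y) = 0) ∧ P x} =
    Nat.card {φ : ι → Module.Dual F (ResidueRing Y v) //
      P fun b => (dualEquiv hY (hL b) (φ b)).1} := by
  have hr' : ∀ b, L b - (Y.natDegree + v) = r b := fun b => by have := hr b; omega
  symm
  refine Nat.card_eq_of_bijective (fun φ => ⟨fun b => (dualEquiv hY (hL b) (φ.1 b)).1,
    fun b Q hQ => ?_, φ.2⟩) ⟨?_, ?_⟩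
  · rw [mul_comm]
    exact (dualEquiv hY (hL b) (φ.1 b)).2 Q (by rwa [hr'])
  · rintro ⟨φ, hφ⟩ ⟨ψ, hψ⟩ h
    refine Subtype.ext (funext fun b => (dualEquiv hY (hL b)).injective (Subtype.ext ?_))
    exact congrFun (congrArg Subtype.val h) b
  · rintro ⟨x, hx, hP⟩
    have hx' : ∀ b, ∀ q ∈ degreeLT F (L b - (Y.natDegree + v)), pair (x b) (Y * q) = 0 := by
      intro b q hq
      rw [mul_comm]
      exact hx b q (by rwa [← hr'])
    have he : (fun b => (dualEquiv hY (hL b) ((dualEquiv hY (hL b)).symm ⟨x b, hx' b⟩)).1) = x := by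
      funext b
      rw [Equiv.apply_symm_apply]
    exact ⟨⟨fun b => (dualEquiv hY (hL b)).symm ⟨x b, hx' b⟩, by rwa [he]⟩, Subtype.ext he⟩

/-- Both sides are counted by families of functionals on the same residue ring; the extra digit only
shifts the kernel dimensions. -/
theorem card_fixed_vector (α : ι → ℕ) (k d n : ℕ) (Y : degreeLT (ZMod 2) (k + 1)) (hY : Y ≠ 0) :
    Nat.card {x : Digits (fun b => α b + (k + 1)) //
      Y ∈ kerSpace (fun b => α b + (k + 1)) (fun b => α b + 1) (k + 1) x ∧
      Module.finrank (ZMod 2)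
        (kerSpace (fun b => α b + (k + 1)) (fun b => α b + 1) (k + 1) x) = d + 1 ∧
      Module.finrank (ZMod 2)
        (kerSpace (fun b => α b + (k + 1)) α (k + 1 + 1) x) = d + 1 + n} =
    Nat.card {x : Digits (fun b => α b + k) //
      Y ∈ kerSpace (fun b => α b + k) α (k + 1) x ∧
      Module.finrank (ZMod 2) (kerSpace (fun b => α b + k) (fun b => α b + 1) k x) = d ∧
      Module.finrank (ZMod 2) (kerSpace (fun b => α b + k) α (k + 1) x) = d + n} := by
  have hY0 : Y.1 ≠ 0 := fun h => hY (Subtype.ext h)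
  have hdeg : Y.1.natDegree ≤ k := natDegree_le_of_mem_degreeLT Y.2
  -- As a form of degree k, `Y` vanishes at infinity to order v = k - deg Y.
  obtain ⟨v, hv⟩ := Nat.exists_eq_add_of_le hdeg
  have h1 := card_annihilator hY0 (v := v) (L := fun b => α b + (k + 1)) (r := fun b => α b + 1)
    (fun b => by omega) (fun b => by omega) (fun x => Module.finrank (ZMod 2)
        (kerSpace (fun b => α b + (k + 1)) (fun b => α b + 1) (k + 1) x) = d + 1 ∧
      Module.finrank (ZMod 2)
        (kerSpace (fun b => α b + (k + 1)) α (k + 1 + 1) x) = d + 1 + n)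
  have h2 := card_annihilator hY0 (v := v) (L := fun b => α b + k) (r := α)
    (fun b => by omega) (fun b => by omega) (fun x =>
      Module.finrank (ZMod 2) (kerSpace (fun b => α b + k) (fun b => α b + 1) k x) = d ∧
      Module.finrank (ZMod 2) (kerSpace (fun b => α b + k) α (k + 1) x) = d + n)
  refine h1.trans (Eq.trans ?_ h2.symm)
  refine Nat.card_congr (Equiv.subtypeEquivRight fun φ => ?_)
  -- As deg Y + v = k, the four kernels exceed their residue parts by 1, 2, 0 and 1; the conditions
  -- on the two sides then coincide.
  rw [finrank_kerSpace hY0 (by omega) _ (fun b => by omega),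
    finrank_kerSpace hY0 (by omega) _ (fun b => by omega),
    finrank_kerSpace hY0 (by omega) _ (fun b => by omega),
    finrank_kerSpace hY0 (by omega) _ (fun b => by omega)]
  omega

theorem card_nonzero_mem {V : Type*} [AddCommGroup V] [Module (ZMod 2) V]
    [FiniteDimensional (ZMod 2) V] (S : Submodule (ZMod 2) V) :
    Nat.card {v : {v : V // v ≠ 0} // v.1 ∈ S} + 1 = 2 ^ Module.finrank (ZMod 2) S := by
  have : Finite V := Module.finite_of_finite (ZMod 2)
  have h1 : Nat.card S = 2 ^ Module.finrank (ZMod 2) S := by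
    rw [Module.natCard_eq_pow_finrank (K := ZMod 2), Nat.card_zmod]
  rw [← h1]
  have e : {v : {v : V // v ≠ 0} // v.1 ∈ S} ≃ {s : S // s ≠ 0} :=
    { toFun := fun v => ⟨⟨v.1.1, v.2⟩, fun h => v.1.2 (congrArg Subtype.val h)⟩
      invFun := fun s => ⟨⟨s.1.1, fun h => s.2 (Subtype.ext h)⟩, s.1.2⟩
      left_inv := fun _ => rfl
      right_inv := fun _ => rfl }
  classical
  have h2 := Nat.card_congr (Equiv.sumCompl (fun s : S => s = 0))
  rw [Nat.card_sum] at h2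
  rw [Nat.card_congr e, ← h2, add_comm]
  congr 1
  exact (Nat.card_unique (α := {s : S // s = 0})).symm

open Classical in
theorem double_count {A B : Type*} [Finite A] [Finite B] (p : A → Prop) (r : A → B → Prop) (c : ℕ)
    (h : ∀ a, p a → Nat.card {b // r a b} = c) :
    ∑ᶠ b, Nat.card {a // r a b ∧ p a} = Nat.card {a // p a} * c := by
  have := Fintype.ofFinite A
  have := Fintype.ofFinite B
  have key := Finset.sum_card_bipartiteAbove_eq_sum_card_bipartiteBelow (r := r)
    (s := Finset.univ.filter p) (t := Finset.univ)
  rw [finsum_eq_sum_of_fintype]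
  have h1 : ∀ b, Nat.card {a // r a b ∧ p a} =
      (Finset.bipartiteBelow r (Finset.univ.filter p) b).card := by
    intro b
    rw [Nat.card_eq_fintype_card, Fintype.card_subtype, Finset.bipartiteBelow,
      Finset.filter_filter]
    simp only [and_comm]
  simp_rw [h1]
  rw [← key, Finset.sum_congr rfl (g := fun _ => c), Finset.sum_const, smul_eq_mul,
    Nat.card_eq_fintype_card, Fintype.card_subtype]
  intro a ha
  rw [← h a (Finset.mem_filter.mp ha).2, Finset.bipartiteAbove, Nat.card_eq_fintype_card,
    Fintype.card_subtype]

/-- A pair of strings and a nonzero kernel vector is counted through the strings: a kernel of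
dimension e has 2^e - 1 nonzero vectors. On the left the vector lies in the kernel for `α b + 1`
rows, on the right in the one for `α b` rows; both have k + 1 columns. For each fixed vector
`card_fixed_vector` equates the two counts. -/
theorem jointCount_succ [Finite ι] (α : ι → ℕ) (k d n : ℕ) :
    jointCount α (k + 1) (d + 1) n * (2 ^ (d + 1) - 1) =
      jointCount α k d n * (2 ^ (d + n) - 1) := by
  have : Finite (degreeLT (ZMod 2) (k + 1)) := Module.finite_of_finite (ZMod 2)
  have h1 := double_count (A := Digits fun b => α b + (k + 1))
    (B := {Y : degreeLT (ZMod 2) (k + 1) // Y ≠ 0})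
    (fun x => Module.finrank (ZMod 2)
        (kerSpace (fun b => α b + (k + 1)) (fun b => α b + 1) (k + 1) x) = d + 1 ∧
      Module.finrank (ZMod 2)
        (kerSpace (fun b => α b + (k + 1)) α (k + 1 + 1) x) = d + 1 + n)
    (fun x Y => Y.1 ∈ kerSpace (fun b => α b + (k + 1)) (fun b => α b + 1) (k + 1) x)
    (2 ^ (d + 1) - 1) (fun x hx => by
      have := card_nonzero_mem
        (kerSpace (fun b => α b + (k + 1)) (fun b => α b + 1) (k + 1) x)
      rw [hx.1] at this
      omega)
  have h2 := double_count (A := Digits fun b => α b + k)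
    (B := {Y : degreeLT (ZMod 2) (k + 1) // Y ≠ 0})
    (fun x => Module.finrank (ZMod 2) (kerSpace (fun b => α b + k) (fun b => α b + 1) k x) = d ∧
      Module.finrank (ZMod 2) (kerSpace (fun b => α b + k) α (k + 1) x) = d + n)
    (fun x Y => Y.1 ∈ kerSpace (fun b => α b + k) α (k + 1) x)
    (2 ^ (d + n) - 1) (fun x hx => by
      have := card_nonzero_mem (kerSpace (fun b => α b + k) α (k + 1) x)
      rw [hx.2] at this
      omega)
  refine h1.symm.trans (Eq.trans ?_ h2)
  exact finsum_congr fun Y => card_fixed_vector α k d n Y.1 Y.2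

end Count

/-! ### The recursion in the number of rows -/

section Recursion

variable {ι : Type*}

open Classical in
theorem card_eq_sum_fiber {A : Type*} [Finite A] (p : A → Prop) (f : A → ℕ) (s : Finset ℕ)
    (h : ∀ a, p a → f a ∈ s) :
    Nat.card {a // p a} = ∑ n ∈ s, Nat.card {a // p a ∧ f a = n} := by
  have := Fintype.ofFinite A
  simp_rw [Nat.card_eq_fintype_card, Fintype.card_subtype]
  rw [Finset.card_eq_sum_card_fiberwise (s := Finset.univ.filter p) (t := s) (f := f)
    (fun a ha => h a (Finset.mem_filter.mp ha).2)]
  simp_rw [Finset.filter_filter]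

theorem kerCount_rows_succ [Fintype ι] (α : ι → ℕ) (k d : ℕ) :
    kerCount (fun b => α b + k) (fun b => α b + 1) k d =
      ∑ n ∈ Finset.range (Fintype.card ι + 2), jointCount α k d n := by
  rw [kerCount, card_eq_sum_fiber _ (fun x =>
    Module.finrank (ZMod 2) (kerSpace (fun b => α b + k) α (k + 1) x) -
    Module.finrank (ZMod 2) (kerSpace (fun b => α b + k) (fun b => α b + 1) k x))
    (Finset.range (Fintype.card ι + 2)) (fun x _ => Finset.mem_range.mpr (by
      have := finrank_kerSpace_le_add α k x
      omega))]
  refine Finset.sum_congr rfl fun n _ => Nat.card_congr (Equiv.subtypeEquivRight fun x => ?_)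
  have := finrank_kerSpace_mono α k x
  constructor <;> rintro ⟨h1, h2⟩ <;> refine ⟨h1, ?_⟩ <;> omega

theorem kerCount_cols_succ [Finite ι] (α : ι → ℕ) (k d : ℕ) :
    kerCount (fun b => α b + k) α (k + 1) d =
      ∑ n ∈ Finset.range (d + 1), jointCount α k (d - n) n := by
  rw [kerCount, card_eq_sum_fiber _ (fun x =>
    Module.finrank (ZMod 2) (kerSpace (fun b => α b + k) α (k + 1) x) -
    Module.finrank (ZMod 2) (kerSpace (fun b => α b + k) (fun b => α b + 1) k x))
    (Finset.range (d + 1)) (fun x hx => Finset.mem_range.mpr (by omega))]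
  refine Finset.sum_congr rfl fun n hn => Nat.card_congr (Equiv.subtypeEquivRight fun x => ?_)
  have := finrank_kerSpace_mono α k x
  have := Finset.mem_range.mp hn
  constructor <;> rintro ⟨h1, h2⟩ <;> constructor <;> omega

/-- The matrices with `α b + 1` rows and k + 1 columns belong to the column expansion of `α + 1` and
to the row expansion of `α`; this identification closes the recursion. -/
theorem kerCount_shift (α : ι → ℕ) (k d : ℕ) :
    kerCount (fun b => α b + 1 + k) (fun b => α b + 1) (k + 1) d =
      kerCount (fun b => α b + (k + 1)) (fun b => α b + 1) (k + 1) d := by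
  congr 1
  funext b
  omega

/-- The Gaussian binomial coefficient `[d + n - 1 choose d]` for `q = 2`. -/
def gaussCoeff (n : ℕ) : ℕ → ℚ
  | 0 => 1
  | d + 1 => gaussCoeff n d * (2 ^ (d + n) - 1) / (2 ^ (d + 1) - 1)

theorem two_pow_succ_sub_one_ne (d : ℕ) : (2 : ℚ) ^ (d + 1) - 1 ≠ 0 := by
  have : (1 : ℚ) < 2 ^ (d + 1) := one_lt_pow₀ (by norm_num) (by omega)
  linarith

theorem gaussCoeff_one (d : ℕ) : gaussCoeff 1 d = 1 := by
  induction d with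
  | zero => rfl
  | succ d ih => rw [gaussCoeff, ih, one_mul, div_self (two_pow_succ_sub_one_ne d)]

theorem gaussCoeff_two (d : ℕ) : gaussCoeff 2 d = 2 ^ (d + 1) - 1 := by
  induction d with
  | zero => norm_num [gaussCoeff]
  | succ d ih =>
    rw [gaussCoeff, ih, mul_comm, mul_div_assoc, div_self (two_pow_succ_sub_one_ne d), mul_one]

theorem gaussCoeff_three (d : ℕ) :
    gaussCoeff 3 d = (2 ^ (d + 1) - 1) * (2 ^ (d + 2) - 1) / 3 := by
  induction d with
  | zero => norm_num [gaussCoeff]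
  | succ d ih =>
    rw [gaussCoeff, ih, div_eq_iff (two_pow_succ_sub_one_ne d)]
    ring

theorem gaussCoeff_four (d : ℕ) :
    gaussCoeff 4 d = (2 ^ (d + 1) - 1) * (2 ^ (d + 2) - 1) * (2 ^ (d + 3) - 1) / 21 := by
  induction d with
  | zero => norm_num [gaussCoeff]
  | succ d ih =>
    rw [gaussCoeff, ih, div_eq_iff (two_pow_succ_sub_one_ne d)]
    ring

/-- The factor 2^0 - 1 at the first step kills everything after it: n = 0 contributes only for d =
0, which is why square matrices obey separate formulas. -/
theorem gaussCoeff_zero_succ (d : ℕ) : gaussCoeff 0 (d + 1) = 0 := by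
  induction d with
  | zero => norm_num [gaussCoeff]
  | succ d ih => rw [gaussCoeff, ih]; simp

/-- The number of digit strings with injective matrices on `i` columns such that shifting one row
of each block into a column creates a kernel of dimension `n`. -/
noncomputable def primCount (α : ι → ℕ) (n i : ℕ) : ℚ := jointCount α i 0 n

/-- Iterating `jointCount_succ` along the diagonal, with i = k - d fixed, multiplies the ratios into
a Gaussian binomial. -/
theorem jointCount_add [Finite ι] (α : ι → ℕ) (i d n : ℕ) :
    (jointCount α (i + d) d n : ℚ) = gaussCoeff n d * primCount α n i := by
  induction d with
  | zero => simp [gaussCoeff, primCount]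
  | succ d ih =>
    have h := congrArg (Nat.cast (R := ℚ)) (jointCount_succ α (i + d) d n)
    rw [Nat.cast_mul, Nat.cast_mul, Nat.cast_sub Nat.one_le_two_pow,
      Nat.cast_sub Nat.one_le_two_pow, ih] at h
    push_cast at h
    rw [gaussCoeff, ← add_assoc, div_mul_eq_mul_div, eq_div_iff (two_pow_succ_sub_one_ne d), h]
    ring

theorem jointCount_eq_zero_of_lt (α : ι → ℕ) {k d n : ℕ} (h : k < d) :
    jointCount α k d n = 0 := by
  rw [jointCount, Nat.card_eq_zero]
  refine Or.inl ⟨fun x => ?_⟩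
  have := finrank_kerSpace_le (r := fun b => α b + 1) (n := k) x.1
  have := x.2.1
  omega

theorem jointCount_zero_right [Finite ι] (α : ι → ℕ) (k d : ℕ) :
    jointCount α k (d + 1) 0 = 0 := by
  rcases lt_or_ge k (d + 1) with h | h
  · exact jointCount_eq_zero_of_lt α h
  · obtain ⟨i, rfl⟩ := Nat.exists_eq_add_of_le' h
    have := jointCount_add α i (d + 1) 0
    rw [gaussCoeff_zero_succ, zero_mul] at this
    exact_mod_cast this

theorem primCount_eq_zero_of_lt (α : ι → ℕ) {n i : ℕ} (h : i + 1 < n) : primCount α n i = 0 := by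
  rw [primCount, jointCount, Nat.cast_eq_zero, Nat.card_eq_zero]
  refine Or.inl ⟨fun x => ?_⟩
  have := finrank_kerSpace_le (r := α) (n := i + 1) x.1
  have := x.2.2
  omega

theorem primCount_eq_zero_of_card_lt [Fintype ι] (α : ι → ℕ) {n i : ℕ}
    (h : Fintype.card ι + 1 < n) : primCount α n i = 0 := by
  rw [primCount, jointCount, Nat.cast_eq_zero, Nat.card_eq_zero]
  refine Or.inl ⟨fun x => ?_⟩
  have := finrank_kerSpace_le_add α i x.1
  have := x.2.1
  have := x.2.2
  omega

/-- With at most three blocks, terms with n > 4 vanish. The same i enters every term: it is the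
rank. -/
theorem kerCount_eq_sum [Fintype ι] (hι : Fintype.card ι ≤ 3) (α : ι → ℕ) (i d : ℕ) :
    (kerCount (fun b => α b + (i + d)) (fun b => α b + 1) (i + d) d : ℚ) =
      ∑ n ∈ Finset.range 5, gaussCoeff n d * primCount α n i := by
  rw [kerCount_rows_succ, Nat.cast_sum]
  simp_rw [jointCount_add]
  refine Finset.sum_subset (Finset.range_mono (by omega)) fun n _ hn => ?_
  rw [primCount_eq_zero_of_card_lt α (by
    have := Finset.mem_range.not.mp hn
    omega), mul_zero]

theorem kerCount_cols_zero [Finite ι] (α : ι → ℕ) (i : ℕ) :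
    (kerCount (fun b => α b + i) α (i + 1) 0 : ℚ) = primCount α 0 i := by
  rw [kerCount_cols_succ]
  simp [primCount]

theorem kerCount_cols_one [Finite ι] (α : ι → ℕ) (i : ℕ) :
    (kerCount (fun b => α b + i) α (i + 1) 1 : ℚ) = primCount α 1 i := by
  rw [kerCount_cols_succ]
  simp [Finset.sum_range_succ, primCount, jointCount_zero_right]

/-- Here the larger kernel has the given dimension, so n varies together with d and the index i
moves along with n. -/
theorem kerCount_cols_two [Finite ι] (α : ι → ℕ) (i : ℕ) :
    (kerCount (fun b => α b + (i + 1)) α (i + 2) 2 : ℚ) =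
      primCount α 1 i + primCount α 2 (i + 1) := by
  have h1 := jointCount_add α i 1 1
  rw [gaussCoeff_one] at h1
  rw [kerCount_cols_succ]
  simp [Finset.sum_range_succ, h1, jointCount_zero_right, primCount]

theorem kerCount_cols_three [Finite ι] (α : ι → ℕ) (i : ℕ) :
    (kerCount (fun b => α b + (i + 2)) α (i + 3) 3 : ℚ) =
      primCount α 1 i + 3 * primCount α 2 (i + 1) + primCount α 3 (i + 2) := by
  have h1 := jointCount_add α i 2 1
  have h2 := jointCount_add α (i + 1) 1 2
  rw [gaussCoeff_one] at h1
  rw [gaussCoeff_two] at h2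
  rw [kerCount_cols_succ]
  simp only [Finset.sum_range_succ, Finset.sum_range_zero, Nat.cast_add, Nat.sub_zero, Nat.sub_self,
    Nat.reduceSub, jointCount_zero_right, h1, h2]
  norm_num [primCount]

theorem kerCount_cols_four [Finite ι] (α : ι → ℕ) (i : ℕ) :
    (kerCount (fun b => α b + (i + 3)) α (i + 4) 4 : ℚ) =
      primCount α 1 i + 7 * primCount α 2 (i + 1) + 7 * primCount α 3 (i + 2) +
        primCount α 4 (i + 3) := by
  have h1 := jointCount_add α i 3 1
  have h2 := jointCount_add α (i + 1) 2 2
  have h3 := jointCount_add α (i + 2) 1 3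
  rw [gaussCoeff_one] at h1
  rw [gaussCoeff_two] at h2
  rw [gaussCoeff_three] at h3
  rw [kerCount_cols_succ]
  simp only [Finset.sum_range_succ, Finset.sum_range_zero, Nat.cast_add, Nat.sub_zero, Nat.sub_self,
    Nat.reduceSub, jointCount_zero_right, h1, h2, h3]
  norm_num [primCount]

theorem primCount_succ_zero [Fintype ι] (hι : Fintype.card ι ≤ 3) (α : ι → ℕ) (i : ℕ) :
    primCount (fun b => α b + 1) 0 i =
    primCount α 0 (i + 1) + primCount α 1 (i + 1) + primCount α 2 (i + 1) + primCount α 3 (i + 1)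
      + primCount α 4 (i + 1) := by
  rw [← kerCount_cols_zero, kerCount_shift, kerCount_eq_sum hι α (i + 1) 0]
  simp [Finset.sum_range_succ, gaussCoeff]

theorem primCount_succ_one [Fintype ι] (hι : Fintype.card ι ≤ 3) (α : ι → ℕ) (i : ℕ) :
    primCount (fun b => α b + 1) 1 i =
    primCount α 1 i + 3 * primCount α 2 i + 7 * primCount α 3 i + 15 * primCount α 4 i := by
  rw [← kerCount_cols_one, kerCount_shift, kerCount_eq_sum hι α i 1]
  norm_num [Finset.sum_range_succ, gaussCoeff]

/-- The coefficients are Gaussian binomials for d = 2, namely 1, 7, 35, 155, minus the coefficients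
1, 3, 7, 15 of the n = 1 step. The n = 1 term cancels, so the system is triangular; the steps for n
= 3 and n = 4 arise in the same way. -/
theorem primCount_succ_two [Fintype ι] (hι : Fintype.card ι ≤ 3) (α : ι → ℕ) (i : ℕ) :
    primCount (fun b => α b + 1) 2 (i + 1) =
    4 * primCount α 2 i + 28 * primCount α 3 i + 140 * primCount α 4 i := by
  have h := kerCount_cols_two (fun b => α b + 1) i
  rw [kerCount_shift, kerCount_eq_sum hι α i 2, primCount_succ_one hι] at h
  norm_num [Finset.sum_range_succ, gaussCoeff] at h
  linarith

theorem primCount_succ_three [Fintype ι] (hι : Fintype.card ι ≤ 3) (α : ι → ℕ) (i : ℕ) :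
    primCount (fun b => α b + 1) 3 (i + 2) =
    64 * primCount α 3 i + 960 * primCount α 4 i := by
  have h := kerCount_cols_three (fun b => α b + 1) i
  rw [kerCount_shift, kerCount_eq_sum hι α i 3, primCount_succ_one hι, primCount_succ_two hι] at h
  norm_num [Finset.sum_range_succ, gaussCoeff] at h
  linarith

theorem primCount_succ_four [Fintype ι] (hι : Fintype.card ι ≤ 3) (α : ι → ℕ) (i : ℕ) :
    primCount (fun b => α b + 1) 4 (i + 3) =
    4096 * primCount α 4 i := by
  have h := kerCount_cols_four (fun b => α b + 1) i
  rw [kerCount_shift, kerCount_eq_sum hι α i 4, primCount_succ_one hι, primCount_succ_two hι,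
    primCount_succ_three hι] at h
  norm_num [Finset.sum_range_succ, gaussCoeff] at h
  linarith

end Recursion

/-! ### Blocks without rows: initial values of the recursion -/

section Base

theorem kerSpace_zero_rows {ι : Type*} (L : ι → ℕ) (n : ℕ) (x : Digits L) :
    kerSpace L (fun _ => 0) n x = ⊤ := by
  refine eq_top_iff.mpr fun Z _ => mem_kerSpace.mpr fun b Q hQ => ?_
  have : Q = 0 := by simpa [mem_degreeLT] using hQ
  simp [this]

theorem kerCount_zero_rows {ι : Type*} [Fintype ι] (L : ι → ℕ) (n d : ℕ) :
    kerCount L (fun _ => 0) n d = if d = n then 2 ^ ∑ b, L b else 0 := by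
  have h : ∀ x : Digits L,
      Module.finrank (ZMod 2) (kerSpace L (fun _ => 0) n x) = n := by
    intro x
    rw [kerSpace_zero_rows, finrank_top, finrank_degreeLT]
  rw [kerCount]
  simp_rw [h]
  split_ifs with hd
  · subst hd
    rw [Nat.card_congr (Equiv.subtypeUnivEquiv fun _ => rfl), Nat.card_pi]
    simp [Finset.prod_pow_eq_pow_sum]
  · rw [Nat.card_eq_zero]
    exact Or.inl ⟨fun x => hd x.2.symm⟩

/-- A block without rows imposes no condition, so its digits are free. -/
theorem kerCount_cons {N : ℕ} (L r : Fin (N + 1) → ℕ) (h0 : r 0 = 0) (n d : ℕ) :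
    kerCount L r n d =
      2 ^ L 0 * kerCount (fun b : Fin N => L b.succ) (fun b => r b.succ) n d := by
  have hk : ∀ x : Digits L, kerSpace L r n x =
      kerSpace (fun b : Fin N => L b.succ) (fun b => r b.succ) n fun b => x b.succ := by
    intro x
    ext Z
    rw [mem_kerSpace, mem_kerSpace, Fin.forall_fin_succ]
    refine and_iff_right fun Q hQ => ?_
    have : Q = 0 := by simpa [h0, mem_degreeLT] using hQ
    simp [this]
  have h2 : 2 ^ L 0 = Nat.card (Fin (L 0) → ZMod 2) := by simp
  rw [kerCount, kerCount, h2, ← Nat.card_prod]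
  refine Nat.card_congr
    { toFun := fun x => ⟨x.1 0, fun b => x.1 b.succ, by rw [← hk]; exact x.2⟩
      invFun := fun y => ⟨Fin.cons y.1 y.2.1, by rw [hk]; exact y.2.2⟩
      left_inv := fun x => Subtype.ext (Fin.cons_self_tail x.1)
      right_inv := fun y => rfl }

/-- The counts `primCount` for two blocks with `β + 1` rows. -/
noncomputable def doublePrim (β n i : ℕ) : ℚ := primCount (fun _ : Fin 2 => β) n i

/-- The numbers of rows, diminished by one, of three blocks with `σ + 1`, `σ + m + 1` and
`σ + m + 1` rows. -/
def tripleRows (σ m : ℕ) : Fin 3 → ℕ := Fin.cons σ fun _ => σ + m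

theorem tripleRows_succ (σ m : ℕ) :
    tripleRows (σ + 1) m = fun b => tripleRows σ m b + 1 := by
  funext b
  refine Fin.cases rfl (fun c => ?_) b
  change σ + 1 + m = σ + m + 1
  omega

/-- The counts `primCount` for three blocks with `σ + 1`, `σ + m + 1` and `σ + m + 1` rows. -/
noncomputable def triplePrim (σ m n i : ℕ) : ℚ := primCount (tripleRows σ m) n i

theorem kerCount_double_zero (i d : ℕ) :
    (kerCount (fun _ : Fin 2 => 0 + i) (fun _ => 0) (i + 1) d : ℚ) =
      if d = i + 1 then 4 ^ i else 0 := by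
  rw [kerCount_zero_rows]
  split_ifs
  · simp [pow_mul]
  · simp

/-- When both blocks are empty, every kernel is the whole space of dimension i + 1. The column
expansions for dimensions 0, 1, 2, 3 then determine `doublePrim 0 n` one n after another. -/
theorem doublePrim_zero_zero (i : ℕ) : doublePrim 0 0 i = 0 := by
  rw [doublePrim, ← kerCount_cols_zero, kerCount_double_zero]
  simp

theorem doublePrim_zero_one (i : ℕ) : doublePrim 0 1 i = if i = 0 then 1 else 0 := by
  rw [doublePrim, ← kerCount_cols_one, kerCount_double_zero]
  rcases i with _ | i <;> simp

theorem doublePrim_zero_two (i : ℕ) : doublePrim 0 2 i = if i = 1 then 3 else 0 := by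
  rcases i with _ | i
  · exact primCount_eq_zero_of_lt _ (by omega)
  · have h := kerCount_cols_two (fun _ : Fin 2 => 0) i
    rw [kerCount_double_zero] at h
    have h1 := doublePrim_zero_one i
    rw [doublePrim] at h1 ⊢
    rw [h1] at h
    rcases i with _ | i
    · norm_num at h ⊢
      linarith
    · norm_num at h ⊢
      linarith

theorem doublePrim_zero_three (i : ℕ) : doublePrim 0 3 i = if i = 2 then 6 else 0 := by
  rcases i with _ | _ | i
  · exact primCount_eq_zero_of_lt _ (by omega)
  · exact primCount_eq_zero_of_lt _ (by omega)
  · have h := kerCount_cols_three (fun _ : Fin 2 => 0) i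
    rw [kerCount_double_zero] at h
    have h1 := doublePrim_zero_one i
    have h2 := doublePrim_zero_two (i + 1)
    rw [doublePrim] at h1 h2 ⊢
    rw [h1, h2] at h
    rcases i with _ | i
    · norm_num at h ⊢
      linarith
    · rw [if_neg (by omega)]
      norm_num at h
      exact h.symm

theorem doublePrim_four (β i : ℕ) : doublePrim β 4 i = 0 :=
  primCount_eq_zero_of_card_lt _ (by simp)

theorem doublePrim_eq_zero_of_lt (β : ℕ) {n i : ℕ} (h : i + 1 < n) : doublePrim β n i = 0 :=
  primCount_eq_zero_of_lt _ h

theorem doublePrim_succ_zero (β i : ℕ) : doublePrim (β + 1) 0 i =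
    doublePrim β 0 (i + 1) + doublePrim β 1 (i + 1) + doublePrim β 2 (i + 1)
      + doublePrim β 3 (i + 1) := by
  have h := primCount_succ_zero (by simp) (fun _ : Fin 2 => β) i
  have h4 := doublePrim_four β (i + 1)
  rw [doublePrim] at h4
  rw [h4, add_zero] at h
  exact h

theorem doublePrim_succ_one (β i : ℕ) : doublePrim (β + 1) 1 i =
    doublePrim β 1 i + 3 * doublePrim β 2 i + 7 * doublePrim β 3 i := by
  have h := primCount_succ_one (by simp) (fun _ : Fin 2 => β) i
  have h4 := doublePrim_four β i
  rw [doublePrim] at h4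
  rw [h4, mul_zero, add_zero] at h
  exact h

theorem doublePrim_succ_two (β i : ℕ) : doublePrim (β + 1) 2 (i + 1) =
    4 * doublePrim β 2 i + 28 * doublePrim β 3 i := by
  have h := primCount_succ_two (by simp) (fun _ : Fin 2 => β) i
  have h4 := doublePrim_four β i
  rw [doublePrim] at h4
  rw [h4, mul_zero, add_zero] at h
  exact h

theorem doublePrim_succ_three (β i : ℕ) : doublePrim (β + 1) 3 (i + 2) =
    64 * doublePrim β 3 i := by
  have h := primCount_succ_three (by simp) (fun _ : Fin 2 => β) i
  have h4 := doublePrim_four β i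
  rw [doublePrim] at h4
  rw [h4, mul_zero, add_zero] at h
  exact h

theorem triplePrim_eq_zero_of_lt (σ m : ℕ) {n i : ℕ} (h : i + 1 < n) : triplePrim σ m n i = 0 :=
  primCount_eq_zero_of_lt _ h

theorem triplePrim_succ_zero (σ m i : ℕ) : triplePrim (σ + 1) m 0 i =
    triplePrim σ m 0 (i + 1) + triplePrim σ m 1 (i + 1) + triplePrim σ m 2 (i + 1)
      + triplePrim σ m 3 (i + 1) + triplePrim σ m 4 (i + 1) := by
  rw [triplePrim, tripleRows_succ]
  exact primCount_succ_zero (by simp) _ i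

theorem triplePrim_succ_one (σ m i : ℕ) : triplePrim (σ + 1) m 1 i =
    triplePrim σ m 1 i + 3 * triplePrim σ m 2 i + 7 * triplePrim σ m 3 i
      + 15 * triplePrim σ m 4 i := by
  rw [triplePrim, tripleRows_succ]
  exact primCount_succ_one (by simp) _ i

theorem triplePrim_succ_two (σ m i : ℕ) : triplePrim (σ + 1) m 2 (i + 1) =
    4 * triplePrim σ m 2 i + 28 * triplePrim σ m 3 i + 140 * triplePrim σ m 4 i := by
  rw [triplePrim, tripleRows_succ]
  exact primCount_succ_two (by simp) _ i

theorem triplePrim_succ_three (σ m i : ℕ) : triplePrim (σ + 1) m 3 (i + 2) =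
    64 * triplePrim σ m 3 i + 960 * triplePrim σ m 4 i := by
  rw [triplePrim, tripleRows_succ]
  exact primCount_succ_three (by simp) _ i

theorem triplePrim_succ_four (σ m i : ℕ) : triplePrim (σ + 1) m 4 (i + 3) =
    4096 * triplePrim σ m 4 i := by
  rw [triplePrim, tripleRows_succ]
  exact primCount_succ_four (by simp) _ i

/-- A first block of a single row contributes arbitrary digits. -/
theorem kerCount_triple_zero (m i d : ℕ) :
    (kerCount (fun b => tripleRows 0 m b + i) (tripleRows 0 m) (i + 1) d : ℚ) =
      2 ^ i * kerCount (fun _ : Fin 2 => m + i) (fun _ => m) (i + 1) d := by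
  rw [kerCount_cons _ _ rfl]
  have h : ∀ b : Fin 2, tripleRows 0 m b.succ = m := fun b => Nat.zero_add m
  simp only [h]
  have h0 : tripleRows 0 m 0 + i = i := Nat.zero_add i
  rw [h0]
  push_cast
  rfl

theorem triplePrim_zero_zero (m i : ℕ) : triplePrim 0 m 0 i = 2 ^ i * doublePrim m 0 i := by
  rw [triplePrim, ← kerCount_cols_zero, kerCount_triple_zero, doublePrim,
    ← kerCount_cols_zero]

theorem triplePrim_zero_one (m i : ℕ) : triplePrim 0 m 1 i = 2 ^ i * doublePrim m 1 i := by
  rw [triplePrim, ← kerCount_cols_one, kerCount_triple_zero, doublePrim,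
    ← kerCount_cols_one]

/-- The column expansions for three blocks and for two differ by the free factor 2 to the length of
the first string. This length grows with i, so the n = 1 terms do not cancel and the remainder feeds
n = 2; likewise for n = 3 and n = 4. -/
theorem triplePrim_zero_two (m i : ℕ) : triplePrim 0 m 2 (i + 1) =
    2 ^ (i + 1) * doublePrim m 2 (i + 1) + 2 ^ i * doublePrim m 1 i := by
  have h := kerCount_cols_two (tripleRows 0 m) i
  have h1 := triplePrim_zero_one m i
  rw [kerCount_triple_zero, kerCount_cols_two] at h
  rw [triplePrim] at h1
  rw [h1] at h
  simp only [triplePrim, doublePrim] at h ⊢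
  linear_combination -h

theorem triplePrim_zero_three (m i : ℕ) : triplePrim 0 m 3 (i + 2) =
    2 ^ (i + 2) * doublePrim m 3 (i + 2) + 3 * 2 ^ (i + 1) * doublePrim m 2 (i + 1) := by
  have h := kerCount_cols_three (tripleRows 0 m) i
  have h1 := triplePrim_zero_one m i
  have h2 := triplePrim_zero_two m i
  rw [kerCount_triple_zero, kerCount_cols_three] at h
  rw [triplePrim] at h1 h2
  rw [h1, h2] at h
  simp only [triplePrim, doublePrim] at h ⊢
  linear_combination -h

theorem triplePrim_zero_four (m i : ℕ) : triplePrim 0 m 4 (i + 3) =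
    7 * 2 ^ (i + 2) * doublePrim m 3 (i + 2) := by
  have h := kerCount_cols_four (tripleRows 0 m) i
  have h1 := triplePrim_zero_one m i
  have h2 := triplePrim_zero_two m i
  have h3 := triplePrim_zero_three m i
  have h4 := doublePrim_four m (i + 3)
  rw [kerCount_triple_zero, kerCount_cols_four] at h
  rw [triplePrim] at h1 h2 h3
  rw [h1, h2, h3] at h
  simp only [triplePrim, doublePrim] at h h4 ⊢
  rw [h4] at h
  linear_combination -h

end Base

/-! ### Closed forms for two blocks of equal size -/

section Double

/-- The `n`-th powers of powers of two as powers of two. -/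
theorem pow_eq_two_pow : (∀ n : ℕ, (4 : ℚ) ^ n = 2 ^ (2 * n)) ∧
    (∀ n : ℕ, (8 : ℚ) ^ n = 2 ^ (3 * n)) ∧ (∀ n : ℕ, (16 : ℚ) ^ n = 2 ^ (4 * n)) ∧
    ∀ n : ℕ, (64 : ℚ) ^ n = 2 ^ (6 * n) := by
  refine ⟨fun n => ?_, fun n => ?_, fun n => ?_, fun n => ?_⟩ <;> rw [pow_mul] <;> norm_num

/-- The jump n = 3 is the largest possible and occurs only when the rank equals the number 2β + 2 of
rows; each step adds two rows and moves the index by two. -/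
theorem doublePrim_three_of_eq {β i : ℕ} (hi : i = 2 * β + 2) :
    doublePrim β 3 i = 6 * 64 ^ β := by
  induction β generalizing i with
  | zero => simp [doublePrim_zero_three, hi]
  | succ β ih =>
    subst hi
    rw [show 2 * (β + 1) + 2 = 2 * β + 2 + 2 by ring, doublePrim_succ_three, ih rfl]
    ring

theorem doublePrim_three_of_ne {β i : ℕ} (hi : i ≠ 2 * β + 2) : doublePrim β 3 i = 0 := by
  induction β generalizing i with
  | zero => rw [doublePrim_zero_three, if_neg hi]
  | succ β ih =>
    rcases i with _ | _ | i
    · exact doublePrim_eq_zero_of_lt _ (by omega)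
    · exact doublePrim_eq_zero_of_lt _ (by omega)
    · rw [doublePrim_succ_three, ih (by omega), mul_zero]

theorem doublePrim_two_of_gt {β i : ℕ} (hi : 2 * β + 1 < i) : doublePrim β 2 i = 0 := by
  induction β generalizing i with
  | zero => rw [doublePrim_zero_two, if_neg (by omega)]
  | succ β ih =>
    obtain ⟨i, rfl⟩ := Nat.exists_eq_succ_of_ne_zero (show i ≠ 0 by omega)
    rw [doublePrim_succ_two, ih (by omega), doublePrim_three_of_ne (by omega)]
    ring

theorem doublePrim_two_of_lt {β i : ℕ} (hi : i < β + 1) : doublePrim β 2 i = 0 := by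
  induction β generalizing i with
  | zero => rw [doublePrim_zero_two, if_neg (by omega)]
  | succ β ih =>
    rcases i with _ | i
    · exact doublePrim_eq_zero_of_lt _ (by omega)
    · rw [doublePrim_succ_two, ih (by omega), doublePrim_three_of_ne (by omega)]
      ring

theorem doublePrim_two_of_eq {β i : ℕ} (hi : i = β + 1) : doublePrim β 2 i = 3 * 4 ^ β := by
  subst hi
  induction β with
  | zero => simp [doublePrim_zero_two]
  | succ β ih =>
    rw [doublePrim_succ_two, ih, doublePrim_three_of_ne (by omega)]
    ring

/-- The last value of the range, at j + 1 = β, arises from the n = 3 term; then it is propagated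
with j fixed and a factor 4 for each step in β. -/
theorem doublePrim_two_mid {β i j : ℕ} (hi : i = β + 2 + j) (hj : j + 1 ≤ β) :
    doublePrim β 2 i = 42 * 4 ^ β * 16 ^ j := by
  induction β generalizing i j with
  | zero => omega
  | succ β ih =>
    obtain ⟨i, rfl⟩ := Nat.exists_eq_succ_of_ne_zero (show i ≠ 0 by omega)
    rw [doublePrim_succ_two]
    rcases Nat.lt_or_ge j β with h | h
    · rw [ih (j := j) (by omega) (by omega), doublePrim_three_of_ne (by omega)]
      ring
    · obtain rfl : j = β := by omega
      rw [doublePrim_two_of_gt (by omega), doublePrim_three_of_eq (by omega)]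
      simp only [pow_eq_two_pow]
      ring

theorem doublePrim_one_of_gt {β i : ℕ} (hi : 2 * β + 1 ≤ i) : doublePrim β 1 i = 0 := by
  induction β generalizing i with
  | zero => rw [doublePrim_zero_one, if_neg (by omega)]
  | succ β ih =>
    rw [doublePrim_succ_one, ih (by omega), doublePrim_two_of_gt (by omega),
      doublePrim_three_of_ne (by omega)]
    ring

/-- The formula is stated up to j = β, where it gives 0 and meets `doublePrim_one_of_gt`. -/
theorem doublePrim_one_mid {β i j : ℕ} (hi : i = β + 1 + j) (hj : j ≤ β) :
    doublePrim β 1 i = 21 / 2 * (8 ^ β * 8 ^ j - 4 ^ β * 16 ^ j) := by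
  induction β generalizing i j with
  | zero =>
    obtain rfl : j = 0 := by omega
    rw [doublePrim_zero_one, if_neg (by omega)]
    norm_num
  | succ β ih =>
    rw [doublePrim_succ_one]
    rcases Nat.lt_trichotomy j β with h | rfl | h
    · rw [ih (j := j + 1) (by omega) (by omega), doublePrim_three_of_ne (by omega),
      doublePrim_two_mid (j := j) (by omega) (by omega)]
      ring
    · rw [doublePrim_one_of_gt (by omega), doublePrim_two_of_gt (by omega),
      doublePrim_three_of_eq (by omega)]
      simp only [pow_eq_two_pow]
      ring
    · obtain rfl : j = β + 1 := by omega
      rw [doublePrim_one_of_gt (by omega), doublePrim_two_of_gt (by omega),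
        doublePrim_three_of_ne (by omega)]
      simp only [pow_eq_two_pow]
      ring

theorem doublePrim_one_zero (β : ℕ) : doublePrim β 1 0 = 1 := by
  induction β with
  | zero => simp [doublePrim_zero_one]
  | succ β ih =>
    rw [doublePrim_succ_one, ih, doublePrim_two_of_lt (by omega), doublePrim_three_of_ne (by omega)]
    ring

theorem doublePrim_one_low {β i : ℕ} (hi : 1 ≤ i) (hβ : i ≤ β) :
    doublePrim β 1 i = 21 / 16 * 8 ^ i - 3 / 8 * 4 ^ i := by
  induction β with
  | zero => omega
  | succ β ih =>
    rw [doublePrim_succ_one, doublePrim_three_of_ne (by omega)]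
    rcases Nat.lt_or_ge β i with h | h
    · obtain rfl : i = β + 1 := by omega
      rw [doublePrim_one_mid (j := 0) (by omega) (by omega), doublePrim_two_of_eq rfl]
      ring
    · rw [ih h, doublePrim_two_of_lt (by omega)]
      ring

/-- The number of injective pairs of persymmetric blocks with `β + 1` rows and `i` columns. -/
noncomputable def doubleTotal (β i : ℕ) : ℚ :=
  doublePrim β 0 i + doublePrim β 1 i + doublePrim β 2 i + doublePrim β 3 i

theorem doubleTotal_succ (β i : ℕ) : doubleTotal (β + 1) i = doubleTotal β (i + 1)
    + doublePrim (β + 1) 1 i + doublePrim (β + 1) 2 i + doublePrim (β + 1) 3 i := by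
  rw [doubleTotal, doublePrim_succ_zero, doubleTotal]

theorem doubleTotal_zero (i : ℕ) : doubleTotal 0 i =
    (if i = 0 then 1 else 0) + (if i = 1 then 3 else 0) + (if i = 2 then 6 else 0) := by
  rw [doubleTotal, doublePrim_zero_zero, doublePrim_zero_one, doublePrim_zero_two,
    doublePrim_zero_three, zero_add]

theorem doubleTotal_of_gt {β i : ℕ} (hi : 2 * β + 3 ≤ i) : doubleTotal β i = 0 := by
  induction β generalizing i with
  | zero =>
    rw [doubleTotal_zero, if_neg (by omega), if_neg (by omega), if_neg (by omega)]
    norm_num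
  | succ β ih =>
    rw [doubleTotal_succ, ih (by omega), doublePrim_one_of_gt (by omega),
      doublePrim_two_of_gt (by omega), doublePrim_three_of_ne (by omega)]
    norm_num

/-- For j = β + 1 and j = β + 2 there are more columns than rows, and the closed form indeed
vanishes there. Including these zeros allows the step, which shifts j by two, to run to the end of
the range. -/
theorem doubleTotal_mid {β i j : ℕ} (hi : i = β + 2 + j) (hj : j ≤ β + 2) :
    doubleTotal β i = 16 * 16 ^ β * 4 ^ j - 12 * 8 ^ β * 8 ^ j + 2 * 4 ^ β * 16 ^ j := by
  induction β generalizing i j with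
  | zero =>
    subst hi
    rw [doubleTotal_zero]
    interval_cases j <;> norm_num
  | succ β ih =>
    rw [doubleTotal_succ]
    rcases Nat.lt_trichotomy j (β + 1) with h | rfl | h
    · rw [ih (j := j + 2) (by omega) (by omega),
      doublePrim_one_mid (j := j + 1) (by omega) (by omega),
      doublePrim_two_mid (j := j) (by omega) (by omega), doublePrim_three_of_ne (by omega)]
      ring
    · rw [doubleTotal_of_gt (by omega), doublePrim_one_of_gt (by omega),
      doublePrim_two_of_gt (by omega), doublePrim_three_of_eq (by omega)]
      simp only [pow_eq_two_pow]
      ring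
    · rw [doubleTotal_of_gt (by omega), doublePrim_one_of_gt (by omega),
      doublePrim_two_of_gt (by omega), doublePrim_three_of_ne (by omega)]
      obtain ⟨e, rfl⟩ : ∃ e, j = β + 1 + 1 + e := ⟨j - (β + 2), by omega⟩
      -- Only the two zeros of the closed form remain.
      have he : e ≤ 1 := by omega
      simp only [pow_eq_two_pow]
      interval_cases e <;> ring

theorem doubleTotal_low {β i : ℕ} (hi : 1 ≤ i) (hβ : i ≤ β + 2) :
    doubleTotal β i = 4 ^ β * 4 ^ i - 3 / 16 * 8 ^ i + 1 / 8 * 4 ^ i := by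
  induction β generalizing i with
  | zero =>
    rw [doubleTotal_zero]
    interval_cases i <;> norm_num
  | succ β ih =>
    rw [doubleTotal_succ, doublePrim_three_of_ne (by omega)]
    rcases Nat.lt_trichotomy i (β + 2) with h | rfl | h
    · rw [ih (by omega) (by omega), doublePrim_one_low (by omega) (by omega),
      doublePrim_two_of_lt (by omega)]
      ring
    · rw [doubleTotal_mid (j := 1) (by omega) (by omega),
      doublePrim_one_mid (j := 0) (by omega) (by omega), doublePrim_two_of_eq (by omega)]
      simp only [pow_eq_two_pow]
      ring
    · obtain rfl : i = β + 3 := by omega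
      rw [doubleTotal_mid (j := 2) (by omega) (by omega),
        doublePrim_one_mid (j := 1) (by omega) (by omega),
        doublePrim_two_mid (j := 0) (by omega) (by omega)]
      simp only [pow_eq_two_pow]
      ring

end Double

/-! ### Closed forms for three blocks -/

section Triple

/-- The jump n = 4 needs full row rank; each step adds three rows, moves the index by three and
multiplies by 4096. In the names below, with s = σ + 1, the corners are the ranks s, s + m, 2s + m,
2s + 2m, and each gap lies strictly between its corner and the next one, the fourth ending before 3s
+ 2m. In a step on σ the offset j in the third and fourth gaps grows by 3 - n, and in the first and
second gaps by 2 - n when n is 1 or 2. An offset may thus spill into the next region, so values of n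
are treated in decreasing order and, for each n, regions from right to left. -/
theorem triplePrim_four_top {σ m i : ℕ} (hi : i = 3 * σ + 3 + 2 * m) :
    triplePrim σ m 4 i = 168 * 2 ^ (12 * σ + 8 * m) := by
  induction σ generalizing i with
  | zero =>
    obtain ⟨e, rfl⟩ : ∃ e, i = e + 3 := ⟨i - 3, by omega⟩
    obtain rfl : e = 2 * m := by omega
    rw [triplePrim_zero_four, doublePrim_three_of_eq (by omega)]
    simp only [pow_eq_two_pow]
    ring
  | succ σ ih =>
    obtain ⟨e, rfl⟩ : ∃ e, i = e + 3 := ⟨i - 3, by omega⟩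
    rw [triplePrim_succ_four, ih (by omega)]
    ring

theorem triplePrim_four_of_ne {σ m i : ℕ} (hi : i ≠ 3 * σ + 3 + 2 * m) :
    triplePrim σ m 4 i = 0 := by
  induction σ generalizing i with
  | zero =>
    rcases Nat.lt_or_ge i 3 with h | h
    · exact triplePrim_eq_zero_of_lt _ _ (by omega)
    obtain ⟨e, rfl⟩ : ∃ e, i = e + 3 := ⟨i - 3, by omega⟩
    rw [triplePrim_zero_four, doublePrim_three_of_ne (by omega), mul_zero]
  | succ σ ih =>
    rcases Nat.lt_or_ge i 3 with h | h
    · exact triplePrim_eq_zero_of_lt _ _ (by omega)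
    obtain ⟨e, rfl⟩ : ∃ e, i = e + 3 := ⟨i - 3, by omega⟩
    rw [triplePrim_succ_four, ih (by omega), mul_zero]

theorem triplePrim_three_of_ge {σ m i : ℕ}
    (hi : 3 * σ + 3 + 2 * m ≤ i) : triplePrim σ m 3 i = 0 := by
  induction σ generalizing i with
  | zero =>
    obtain ⟨e, rfl⟩ : ∃ e, i = e + 2 := ⟨i - 2, by omega⟩
    rw [triplePrim_zero_three, doublePrim_three_of_ne (by omega), doublePrim_two_of_gt (by omega)]
    ring
  | succ σ ih =>
    obtain ⟨e, rfl⟩ : ∃ e, i = e + 2 := ⟨i - 2, by omega⟩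
    rw [triplePrim_succ_three, ih (by omega), triplePrim_four_of_ne (by omega)]
    ring

/-- The jump n = 3 starts at rank 2s + m: at σ = 0 it inherits the support of `doublePrim` for n =
2, and each step moves the index by two. -/
theorem triplePrim_three_of_lt {σ m i : ℕ} (hi : i < 2 * σ + 2 + m) : triplePrim σ m 3 i = 0 := by
  induction σ generalizing i with
  | zero =>
    rcases Nat.lt_or_ge i 2 with h | h
    · exact triplePrim_eq_zero_of_lt _ _ (by omega)
    obtain ⟨e, rfl⟩ : ∃ e, i = e + 2 := ⟨i - 2, by omega⟩
    rw [triplePrim_zero_three, doublePrim_three_of_ne (by omega), doublePrim_two_of_lt (by omega)]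
    ring
  | succ σ ih =>
    rcases Nat.lt_or_ge i 2 with h | h
    · exact triplePrim_eq_zero_of_lt _ _ (by omega)
    obtain ⟨e, rfl⟩ : ∃ e, i = e + 2 := ⟨i - 2, by omega⟩
    rw [triplePrim_succ_three, ih (by omega), triplePrim_four_of_ne (by omega)]
    ring

theorem triplePrim_two_of_ge {σ m i : ℕ} (hi : 3 * σ + 2 + 2 * m ≤ i) : triplePrim σ m 2 i = 0 := by
  induction σ generalizing i with
  | zero =>
    obtain ⟨e, rfl⟩ : ∃ e, i = e + 1 := ⟨i - 1, by omega⟩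
    rw [triplePrim_zero_two, doublePrim_two_of_gt (by omega), doublePrim_one_of_gt (by omega)]
    ring
  | succ σ ih =>
    obtain ⟨e, rfl⟩ : ∃ e, i = e + 1 := ⟨i - 1, by omega⟩
    rw [triplePrim_succ_two, ih (by omega), triplePrim_three_of_ge (by omega),
      triplePrim_four_of_ne (by omega)]
    ring

theorem triplePrim_two_of_lt {σ m i : ℕ} (hi : i < σ + 1) : triplePrim σ m 2 i = 0 := by
  induction σ generalizing i with
  | zero => exact triplePrim_eq_zero_of_lt _ _ (by omega)
  | succ σ ih =>
    rcases i with _ | i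
    · exact triplePrim_eq_zero_of_lt _ _ (by omega)
    rw [triplePrim_succ_two, ih (by omega), triplePrim_three_of_lt (by omega),
      triplePrim_four_of_ne (by omega)]
    ring

theorem triplePrim_one_of_ge {σ m i : ℕ} (hi : 3 * σ + 1 + 2 * m ≤ i) : triplePrim σ m 1 i = 0 := by
  induction σ generalizing i with
  | zero =>
    rw [triplePrim_zero_one, doublePrim_one_of_gt (by omega)]
    ring
  | succ σ ih =>
    rw [triplePrim_succ_one, ih (by omega), triplePrim_two_of_ge (by omega),
      triplePrim_three_of_ge (by omega), triplePrim_four_of_ne (by omega)]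
    ring

theorem triplePrim_three_fourthGap {σ m i j : ℕ} (hi : i = 2 * σ + 3 + 2 * m + j)
    (hjs : j + 1 ≤ σ) :
    triplePrim σ m 3 i =
      2520 * 2 ^ (6 * σ + 8 * m + 6 * j) := by
  induction σ generalizing i j with
  | zero => omega
  | succ σ ih =>
    obtain ⟨e, rfl⟩ : ∃ e, i = e + 2 := ⟨i - 2, by omega⟩
    rw [triplePrim_succ_three]
    by_cases h2 : j + 1 ≤ σ
    · rw [ih (j := j) (by omega) (by omega), triplePrim_four_of_ne (by omega)]
      ring
    · obtain rfl : j = σ := by omega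
      rw [triplePrim_three_of_ge (by omega), triplePrim_four_top (by omega)]
      ring

/-- At σ = 0 both the n = 3 and the n = 2 counts of the two-block problem contribute, which gives
the exceptional constant; afterwards the value is only multiplied by 64. -/
theorem triplePrim_three_fourthCorner {σ m i : ℕ} (hi : i = 2 * σ + 2 + 2 * m) (hm : 1 ≤ m) :
    triplePrim σ m 3 i =
      159 / 4 * 2 ^ (6 * σ + 8 * m) := by
  induction σ generalizing i with
  | zero =>
    obtain ⟨e, rfl⟩ : ∃ e, i = e + 2 := ⟨i - 2, by omega⟩
    obtain ⟨m, rfl⟩ : ∃ a, m = a + 1 := ⟨m - 1, by omega⟩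
    obtain rfl : e = 2 * m + 2 := by omega
    rw [triplePrim_zero_three, doublePrim_three_of_eq (by omega),
      doublePrim_two_mid (j := m) (by omega) (by omega)]
    simp only [pow_eq_two_pow]
    ring
  | succ σ ih =>
    obtain ⟨e, rfl⟩ : ∃ e, i = e + 2 := ⟨i - 2, by omega⟩
    rw [triplePrim_succ_three, ih (by omega), triplePrim_four_of_ne (by omega)]
    ring

theorem triplePrim_three_thirdGap {σ m i j : ℕ} (hi : i = 2 * σ + 3 + m + j) (hjm : j + 2 ≤ m) :
    triplePrim σ m 3 i =
      504 * 2 ^ (6 * σ + 3 * m + 5 * j) := by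
  induction σ generalizing i j with
  | zero =>
    obtain ⟨e, rfl⟩ : ∃ e, i = e + 2 := ⟨i - 2, by omega⟩
    obtain rfl : e = m + 1 + j := by omega
    rw [triplePrim_zero_three, doublePrim_three_of_ne (by omega),
      doublePrim_two_mid (j := j) (by omega) (by omega)]
    simp only [pow_eq_two_pow]
    ring
  | succ σ ih =>
    obtain ⟨e, rfl⟩ : ∃ e, i = e + 2 := ⟨i - 2, by omega⟩
    rw [triplePrim_succ_three, ih (j := j) (by omega) (by omega), triplePrim_four_of_ne (by omega)]
    ring

theorem triplePrim_three_thirdCorner {σ m i : ℕ} (hi : i = 2 * σ + 2 + m) (hm : 2 ≤ m) :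
    triplePrim σ m 3 i =
      18 * 2 ^ (6 * σ + 3 * m) := by
  induction σ generalizing i with
  | zero =>
    obtain ⟨e, rfl⟩ : ∃ e, i = e + 2 := ⟨i - 2, by omega⟩
    obtain rfl : e = m := by omega
    rw [triplePrim_zero_three, doublePrim_three_of_ne (by omega), doublePrim_two_of_eq (by omega)]
    simp only [pow_eq_two_pow]
    ring
  | succ σ ih =>
    obtain ⟨e, rfl⟩ : ∃ e, i = e + 2 := ⟨i - 2, by omega⟩
    rw [triplePrim_succ_three, ih (by omega), triplePrim_four_of_ne (by omega)]
    ring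

/-- The step moves j to j + 1. The last two offsets of the new range are therefore boundary cases:
one is fed by the full-rank n = 4 term alone, and at the other everything vanishes. -/
theorem triplePrim_two_fourthGap {σ m i j : ℕ} (hi : i = 2 * σ + 3 + 2 * m + j) (hjs : j + 1 ≤ σ) :
    triplePrim σ m 2 i =
      11760 * 2 ^ (7 * σ + 8 * m + 5 * j) - 23520 * 2 ^ (6 * σ + 8 * m + 6 * j) := by
  induction σ generalizing i j with
  | zero => omega
  | succ σ ih =>
    obtain ⟨e, rfl⟩ : ∃ e, i = e + 1 := ⟨i - 1, by omega⟩
    rw [triplePrim_succ_two]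
    by_cases h3 : j + 2 ≤ σ
    · rw [ih (j := j + 1) (by omega) (by omega),
      triplePrim_three_fourthGap (j := j + 1) (by omega) (by omega),
      triplePrim_four_of_ne (by omega)]
      ring
    · by_cases h2 : j + 1 = σ
      · subst h2
        rw [triplePrim_two_of_ge (by omega), triplePrim_three_of_ge (by omega),
          triplePrim_four_top (by omega)]
        ring
      · obtain rfl : j = σ := by omega
        rw [triplePrim_two_of_ge (by omega), triplePrim_three_of_ge (by omega),
          triplePrim_four_of_ne (by omega)]
        ring

theorem triplePrim_two_fourthCorner {σ m i : ℕ} (hi : i = 2 * σ + 2 + 2 * m) (hm : 1 ≤ m) :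
    triplePrim σ m 2 i =
      735 / 2 * 2 ^ (7 * σ + 8 * m) - 735 / 2 * 2 ^ (6 * σ + 8 * m) := by
  induction σ generalizing i with
  | zero =>
    obtain ⟨e, rfl⟩ : ∃ e, i = e + 1 := ⟨i - 1, by omega⟩
    obtain rfl : e = 2 * m + 1 := by omega
    rw [triplePrim_zero_two, doublePrim_two_of_gt (by omega), doublePrim_one_of_gt (by omega)]
    ring
  | succ σ ih =>
    obtain ⟨e, rfl⟩ : ∃ e, i = e + 1 := ⟨i - 1, by omega⟩
    rw [triplePrim_succ_two]
    by_cases h2 : 1 ≤ σ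
    · rw [triplePrim_two_fourthGap (j := 0) (by omega) (by omega),
      triplePrim_three_fourthGap (j := 0) (by omega) (by omega), triplePrim_four_of_ne (by omega)]
      ring
    · obtain rfl : σ = 0 := by omega
      rw [triplePrim_two_of_ge (by omega), triplePrim_three_of_ge (by omega),
        triplePrim_four_top (by omega)]
      ring

theorem triplePrim_two_thirdGap {σ m i j : ℕ} (hi : i = 2 * σ + 3 + m + j) (hjm : j + 2 ≤ m) :
    triplePrim σ m 2 i =
      11760 * 2 ^ (7 * σ + 3 * m + 5 * j) + 336 * 2 ^ (6 * σ + 4 * m + 4 * j) - 7056 * 2 ^ (6 * σ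
        + 3 * m + 5 * j) := by
  induction σ generalizing i j with
  | zero =>
    obtain ⟨e, rfl⟩ : ∃ e, i = e + 1 := ⟨i - 1, by omega⟩
    obtain rfl : e = m + 2 + j := by omega
    rw [triplePrim_zero_two, doublePrim_two_mid (j := j + 1) (by omega) (by omega),
      doublePrim_one_mid (j := j + 1) (by omega) (by omega)]
    simp only [pow_eq_two_pow]
    ring
  | succ σ ih =>
    obtain ⟨e, rfl⟩ : ∃ e, i = e + 1 := ⟨i - 1, by omega⟩
    rw [triplePrim_succ_two]
    by_cases h2 : j + 3 ≤ m
    · rw [ih (j := j + 1) (by omega) (by omega),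
      triplePrim_three_thirdGap (j := j + 1) (by omega) (by omega),
      triplePrim_four_of_ne (by omega)]
      ring
    · obtain rfl : m = j + 2 := by omega
      rw [triplePrim_two_fourthCorner (by omega) (by omega),
        triplePrim_three_fourthCorner (by omega) (by omega), triplePrim_four_of_ne (by omega)]
      ring

theorem triplePrim_two_thirdCorner {σ m i : ℕ} (hi : i = 2 * σ + 2 + m) (hm : 2 ≤ m) :
    triplePrim σ m 2 i =
      735 / 2 * 2 ^ (7 * σ + 3 * m) + 21 * 2 ^ (6 * σ + 4 * m) - 441 / 2 * 2 ^ (6 * σ + 3 * m) := by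
  induction σ generalizing i with
  | zero =>
    obtain ⟨e, rfl⟩ : ∃ e, i = e + 1 := ⟨i - 1, by omega⟩
    obtain rfl : e = m + 1 := by omega
    rw [triplePrim_zero_two, doublePrim_two_mid (j := 0) (by omega) (by omega),
      doublePrim_one_mid (j := 0) (by omega) (by omega)]
    simp only [pow_eq_two_pow]
    ring
  | succ σ ih =>
    obtain ⟨e, rfl⟩ : ∃ e, i = e + 1 := ⟨i - 1, by omega⟩
    rw [triplePrim_succ_two]
    rw [triplePrim_two_thirdGap (j := 0) (by omega) (by omega),
      triplePrim_three_thirdGap (j := 0) (by omega) (by omega), triplePrim_four_of_ne (by omega)]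
    ring

theorem triplePrim_two_secondGap {σ m i j : ℕ} (hi : i = σ + 1 + m + j) (hm : 2 ≤ m) (hj : 1 ≤ j)
    (hjs : j ≤ σ) :
    triplePrim σ m 2 i =
      21 / 16 * 2 ^ (2 * σ + 4 * m + 4 * j) + 735 / 64 * 2 ^ (2 * σ + 3 * m + 5 * j)
        - 189 / 32 * 2 ^ (2 * σ + 3 * m + 4 * j) := by
  induction σ generalizing i j with
  | zero => omega
  | succ σ ih =>
    obtain ⟨e, rfl⟩ : ∃ e, i = e + 1 := ⟨i - 1, by omega⟩
    rw [triplePrim_succ_two]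
    by_cases h2 : j ≤ σ
    · rw [ih (j := j) (by omega) (by omega) (by omega), triplePrim_three_of_lt (by omega),
      triplePrim_four_of_ne (by omega)]
      ring
    · obtain rfl : j = σ + 1 := by omega
      rw [triplePrim_two_thirdCorner (by omega) (by omega),
        triplePrim_three_thirdCorner (by omega) (by omega), triplePrim_four_of_ne (by omega)]
      ring

theorem triplePrim_two_secondCorner {σ m i : ℕ} (hi : i = σ + 1 + m) (hm : 2 ≤ m) :
    triplePrim σ m 2 i =
      21 / 16 * 2 ^ (2 * σ + 4 * m) + 45 / 8 * 2 ^ (2 * σ + 3 * m) := by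
  induction σ generalizing i with
  | zero =>
    obtain ⟨e, rfl⟩ : ∃ e, i = e + 1 := ⟨i - 1, by omega⟩
    obtain rfl : e = m := by omega
    rw [triplePrim_zero_two, doublePrim_two_of_eq (by omega),
      doublePrim_one_low (by omega) (by omega)]
    simp only [pow_eq_two_pow]
    ring
  | succ σ ih =>
    obtain ⟨e, rfl⟩ : ∃ e, i = e + 1 := ⟨i - 1, by omega⟩
    rw [triplePrim_succ_two, ih (by omega), triplePrim_three_of_lt (by omega),
      triplePrim_four_of_ne (by omega)]
    ring

theorem triplePrim_two_firstGap {σ m i j : ℕ} (hi : i = σ + 1 + j) (hj : 1 ≤ j) (hjm : j + 1 ≤ m) :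
    triplePrim σ m 2 i =
      21 / 16 * 2 ^ (2 * σ + 4 * j) - 3 / 8 * 2 ^ (2 * σ + 3 * j) := by
  induction σ generalizing i j with
  | zero =>
    obtain ⟨e, rfl⟩ : ∃ e, i = e + 1 := ⟨i - 1, by omega⟩
    obtain rfl : e = j := by omega
    rw [triplePrim_zero_two, doublePrim_two_of_lt (by omega),
      doublePrim_one_low (by omega) (by omega)]
    simp only [pow_eq_two_pow]
    ring
  | succ σ ih =>
    obtain ⟨e, rfl⟩ : ∃ e, i = e + 1 := ⟨i - 1, by omega⟩
    rw [triplePrim_succ_two, ih (j := j) (by omega) (by omega) (by omega),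
      triplePrim_three_of_lt (by omega), triplePrim_four_of_ne (by omega)]
    ring

theorem triplePrim_two_firstCorner {σ m i : ℕ} (hi : i = σ + 1) (hm : 2 ≤ m) :
    triplePrim σ m 2 i =
      2 ^ (2 * σ) := by
  induction σ generalizing i with
  | zero =>
    obtain ⟨e, rfl⟩ : ∃ e, i = e + 1 := ⟨i - 1, by omega⟩
    obtain rfl : e = 0 := by omega
    rw [triplePrim_zero_two, doublePrim_two_of_lt (by omega), doublePrim_one_zero]
    ring
  | succ σ ih =>
    obtain ⟨e, rfl⟩ : ∃ e, i = e + 1 := ⟨i - 1, by omega⟩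
    rw [triplePrim_succ_two, ih (by omega), triplePrim_three_of_lt (by omega),
      triplePrim_four_of_ne (by omega)]
    ring

theorem triplePrim_one_fourthGap {σ m i j : ℕ} (hi : i = 2 * σ + 3 + 2 * m + j) (hjs : j + 1 ≤ σ) :
    triplePrim σ m 1 i =
      6720 * 2 ^ (8 * σ + 8 * m + 4 * j) + 53760 * 2 ^ (6 * σ + 8 * m + 6 * j)
        - 40320 * 2 ^ (7 * σ + 8 * m + 5 * j) := by
  induction σ generalizing i j with
  | zero => omega
  | succ σ ih =>
    rw [triplePrim_succ_one]
    by_cases h4 : j + 3 ≤ σ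
    · rw [ih (j := j + 2) (by omega) (by omega),
      triplePrim_two_fourthGap (j := j + 2) (by omega) (by omega),
      triplePrim_three_fourthGap (j := j + 2) (by omega) (by omega),
      triplePrim_four_of_ne (by omega)]
      ring
    · by_cases h3 : j + 2 = σ
      · subst h3
        rw [triplePrim_one_of_ge (by omega), triplePrim_two_of_ge (by omega),
          triplePrim_three_of_ge (by omega), triplePrim_four_top (by omega)]
        ring
      · by_cases h2 : j + 1 = σ
        · subst h2
          rw [triplePrim_one_of_ge (by omega), triplePrim_two_of_ge (by omega),
            triplePrim_three_of_ge (by omega), triplePrim_four_of_ne (by omega)]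
          ring
        · obtain rfl : j = σ := by omega
          rw [triplePrim_one_of_ge (by omega), triplePrim_two_of_ge (by omega),
            triplePrim_three_of_ge (by omega), triplePrim_four_of_ne (by omega)]
          ring

theorem triplePrim_one_fourthCorner {σ m i : ℕ} (hi : i = 2 * σ + 2 + 2 * m) :
    triplePrim σ m 1 i =
      420 * 2 ^ (8 * σ + 8 * m) + 840 * 2 ^ (6 * σ + 8 * m) - 1260 * 2 ^ (7 * σ + 8 * m) := by
  induction σ generalizing i with
  | zero =>
    subst hi
    rw [triplePrim_zero_one, doublePrim_one_of_gt (by omega)]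
    ring
  | succ σ ih =>
    rw [triplePrim_succ_one]
    by_cases h3 : 2 ≤ σ
    · rw [triplePrim_one_fourthGap (j := 1) (by omega) (by omega),
      triplePrim_two_fourthGap (j := 1) (by omega) (by omega),
      triplePrim_three_fourthGap (j := 1) (by omega) (by omega), triplePrim_four_of_ne (by omega)]
      ring
    · by_cases h2 : σ = 1
      · subst h2
        rw [triplePrim_one_of_ge (by omega), triplePrim_two_of_ge (by omega),
          triplePrim_three_of_ge (by omega), triplePrim_four_top (by omega)]
        ring
      · obtain rfl : σ = 0 := by omega
        rw [triplePrim_one_of_ge (by omega), triplePrim_two_of_ge (by omega),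
          triplePrim_three_of_ge (by omega), triplePrim_four_of_ne (by omega)]
        ring

/-- The step moves j to j + 2, which may land on the fourth corner, in the fourth gap or, at σ = 0,
on full rank. -/
theorem triplePrim_one_thirdGap {σ m i j : ℕ} (hi : i = 2 * σ + 3 + m + j) (hjm : j + 2 ≤ m) :
    triplePrim σ m 1 i =
      6720 * 2 ^ (8 * σ + 4 * m + 4 * j) + 18816 * 2 ^ (6 * σ + 3 * m + 5 * j)
        - 40320 * 2 ^ (7 * σ + 3 * m + 5 * j) - 1344 * 2 ^ (6 * σ + 4 * m + 4 * j) := by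
  induction σ generalizing i j with
  | zero =>
    subst hi
    rw [triplePrim_zero_one, doublePrim_one_mid (j := j + 2) (by omega) (by omega)]
    simp only [pow_eq_two_pow]
    ring
  | succ σ ih =>
    rw [triplePrim_succ_one]
    by_cases h4 : j + 4 ≤ m
    · rw [ih (j := j + 2) (by omega) (by omega),
      triplePrim_two_thirdGap (j := j + 2) (by omega) (by omega),
      triplePrim_three_thirdGap (j := j + 2) (by omega) (by omega),
      triplePrim_four_of_ne (by omega)]
      ring
    · by_cases h3 : m = j + 3
      · subst h3
        rw [triplePrim_one_fourthCorner (by omega),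
          triplePrim_two_fourthCorner (by omega) (by omega),
          triplePrim_three_fourthCorner (by omega) (by omega), triplePrim_four_of_ne (by omega)]
        ring
      · by_cases h2 : 1 ≤ σ
        · obtain rfl : m = j + 2 := by omega
          rw [triplePrim_one_fourthGap (j := 0) (by omega) (by omega),
            triplePrim_two_fourthGap (j := 0) (by omega) (by omega),
            triplePrim_three_fourthGap (j := 0) (by omega) (by omega),
            triplePrim_four_of_ne (by omega)]
          ring
        · obtain rfl : m = j + 2 := by omega
          obtain rfl : σ = 0 := by omega
          rw [triplePrim_one_of_ge (by omega), triplePrim_two_of_ge (by omega),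
            triplePrim_three_of_ge (by omega), triplePrim_four_top (by omega)]
          ring

theorem triplePrim_one_thirdCorner {σ m i : ℕ} (hi : i = 2 * σ + 2 + m) (hm : 2 ≤ m) :
    triplePrim σ m 1 i =
      420 * 2 ^ (8 * σ + 4 * m) + 588 * 2 ^ (6 * σ + 3 * m) - 1260 * 2 ^ (7 * σ + 3 * m)
        - 84 * 2 ^ (6 * σ + 4 * m) := by
  induction σ generalizing i with
  | zero =>
    subst hi
    rw [triplePrim_zero_one, doublePrim_one_mid (j := 1) (by omega) (by omega)]
    simp only [pow_eq_two_pow]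
    ring
  | succ σ ih =>
    rw [triplePrim_succ_one]
    by_cases h2 : 3 ≤ m
    · rw [triplePrim_one_thirdGap (j := 1) (by omega) (by omega),
      triplePrim_two_thirdGap (j := 1) (by omega) (by omega),
      triplePrim_three_thirdGap (j := 1) (by omega) (by omega), triplePrim_four_of_ne (by omega)]
      ring
    · obtain rfl : m = 2 := by omega
      rw [triplePrim_one_fourthCorner (by omega),
        triplePrim_two_fourthCorner (by omega) (by omega),
        triplePrim_three_fourthCorner (by omega) (by omega), triplePrim_four_of_ne (by omega)]
      ring

theorem triplePrim_one_secondGap {σ m i j : ℕ} (hi : i = σ + 1 + m + j) (hm : 2 ≤ m) (hj : 1 ≤ j)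
    (hjs : j ≤ σ) :
    triplePrim σ m 1 i =
      105 / 4 * 2 ^ (4 * σ + 4 * m + 4 * j) + 189 / 8 * 2 ^ (2 * σ + 3 * m + 4 * j)
        - 21 / 4 * 2 ^ (3 * σ + 3 * m + 3 * j) - 21 / 4 * 2 ^ (2 * σ + 4 * m + 4 * j)
        - 315 / 8 * 2 ^ (2 * σ + 3 * m + 5 * j) := by
  induction σ generalizing i j with
  | zero => omega
  | succ σ ih =>
    rw [triplePrim_succ_one]
    by_cases h3 : j + 1 ≤ σ
    · rw [ih (j := j + 1) (by omega) (by omega) (by omega),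
      triplePrim_two_secondGap (j := j + 1) (by omega) (by omega) (by omega) (by omega),
      triplePrim_three_of_lt (by omega), triplePrim_four_of_ne (by omega)]
      ring
    · by_cases h2 : j = σ
      · subst h2
        rw [triplePrim_one_thirdCorner (by omega) (by omega),
          triplePrim_two_thirdCorner (by omega) (by omega),
          triplePrim_three_thirdCorner (by omega) (by omega), triplePrim_four_of_ne (by omega)]
        ring
      · obtain rfl : j = σ + 1 := by omega
        rw [triplePrim_one_thirdGap (j := 0) (by omega) (by omega),
          triplePrim_two_thirdGap (j := 0) (by omega) (by omega),
          triplePrim_three_thirdGap (j := 0) (by omega) (by omega),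
          triplePrim_four_of_ne (by omega)]
        ring

theorem triplePrim_one_secondCorner {σ m i : ℕ} (hi : i = σ + 1 + m) (hm : 2 ≤ m) :
    triplePrim σ m 1 i =
      105 / 4 * 2 ^ (4 * σ + 4 * m) - 21 / 4 * 2 ^ (3 * σ + 3 * m) - 21 / 4 * 2 ^ (2 * σ + 4 * m)
        - 63 / 4 * 2 ^ (2 * σ + 3 * m) := by
  induction σ generalizing i with
  | zero =>
    subst hi
    rw [triplePrim_zero_one, doublePrim_one_mid (j := 0) (by omega) (by omega)]
    simp only [pow_eq_two_pow]
    ring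
  | succ σ ih =>
    rw [triplePrim_succ_one]
    by_cases h2 : 1 ≤ σ
    · rw [triplePrim_one_secondGap (j := 1) (by omega) (by omega) (by omega) (by omega),
      triplePrim_two_secondGap (j := 1) (by omega) (by omega) (by omega) (by omega),
      triplePrim_three_of_lt (by omega), triplePrim_four_of_ne (by omega)]
      ring
    · obtain rfl : σ = 0 := by omega
      rw [triplePrim_one_thirdCorner (by omega) (by omega),
        triplePrim_two_thirdCorner (by omega) (by omega),
        triplePrim_three_thirdCorner (by omega) (by omega), triplePrim_four_of_ne (by omega)]
      ring

theorem triplePrim_one_firstGap {σ m i j : ℕ} (hi : i = σ + 1 + j) (hj : 1 ≤ j) (hjm : j + 1 ≤ m) :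
    triplePrim σ m 1 i =
      105 / 4 * 2 ^ (4 * σ + 4 * j) + 9 / 4 * 2 ^ (2 * σ + 3 * j) - 21 / 4 * 2 ^ (3 * σ + 3 * j)
        - 21 / 4 * 2 ^ (2 * σ + 4 * j) := by
  induction σ generalizing i j with
  | zero =>
    obtain rfl : i = j + 1 := by omega
    rw [triplePrim_zero_one, doublePrim_one_low (by omega) (by omega)]
    simp only [pow_eq_two_pow]
    ring
  | succ σ ih =>
    rw [triplePrim_succ_one]
    by_cases h2 : j + 2 ≤ m
    · rw [ih (j := j + 1) (by omega) (by omega) (by omega),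
      triplePrim_two_firstGap (j := j + 1) (by omega) (by omega) (by omega),
      triplePrim_three_of_lt (by omega), triplePrim_four_of_ne (by omega)]
      ring
    · obtain rfl : m = j + 1 := by omega
      rw [triplePrim_one_secondCorner (by omega) (by omega),
        triplePrim_two_secondCorner (by omega) (by omega), triplePrim_three_of_lt (by omega),
        triplePrim_four_of_ne (by omega)]
      ring

theorem triplePrim_one_firstCorner {σ m i : ℕ} (hi : i = σ + 1) (hm : 2 ≤ m) :
    triplePrim σ m 1 i =
      105 / 4 * 2 ^ (4 * σ) - 21 / 4 * 2 ^ (3 * σ) - 3 * 2 ^ (2 * σ) := by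
  induction σ generalizing i with
  | zero =>
    obtain rfl : i = 1 := by omega
    rw [triplePrim_zero_one, doublePrim_one_low (by omega) (by omega)]
    simp only [pow_eq_two_pow]
    ring
  | succ σ ih =>
    rw [triplePrim_succ_one]
    rw [triplePrim_one_firstGap (j := 1) (by omega) (by omega) (by omega),
      triplePrim_two_firstGap (j := 1) (by omega) (by omega) (by omega),
      triplePrim_three_of_lt (by omega), triplePrim_four_of_ne (by omega)]
    ring

/-- Below rank s the jumps n ≥ 2 vanish and the step copies the value, so it no longer depends on σ;
it is fixed when i = s was the first corner. -/
theorem triplePrim_one_low {σ m i : ℕ} (hm : 2 ≤ m) (hi : 1 ≤ i) (hσ : i ≤ σ) :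
    triplePrim σ m 1 i = 105 / 64 * 2 ^ (4 * i) - 21 / 32 * 2 ^ (3 * i) := by
  induction σ with
  | zero => omega
  | succ σ ih =>
    rw [triplePrim_succ_one]
    by_cases h : i ≤ σ
    · rw [ih h, triplePrim_two_of_lt (by omega), triplePrim_three_of_lt (by omega),
      triplePrim_four_of_ne (by omega)]
      ring
    · obtain rfl : i = σ + 1 := by omega
      rw [triplePrim_one_firstCorner rfl hm, triplePrim_two_firstCorner rfl hm,
        triplePrim_three_of_lt (by omega), triplePrim_four_of_ne (by omega)]
      ring

theorem triplePrim_one_zero (σ m : ℕ) : triplePrim σ m 1 0 = 1 := by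
  induction σ with
  | zero => rw [triplePrim_zero_one, doublePrim_one_zero, pow_zero, one_mul]
  | succ σ ih =>
    rw [triplePrim_succ_one, ih, triplePrim_two_of_lt (by omega),
      triplePrim_three_of_lt (by omega), triplePrim_four_of_ne (by omega)]
    ring

end Triple

/-! ### Closed forms for injective triples, the square case -/

section TripleTotal

/-- The number of injective triples of persymmetric blocks with `σ + 1`, `σ + m + 1` and
`σ + m + 1` rows and `i` columns. -/
noncomputable def tripleTotal (σ m i : ℕ) : ℚ :=
  triplePrim σ m 0 i + triplePrim σ m 1 i + triplePrim σ m 2 i + triplePrim σ m 3 i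
    + triplePrim σ m 4 i

theorem tripleTotal_succ (σ m i : ℕ) : tripleTotal (σ + 1) m i = tripleTotal σ m (i + 1)
    + triplePrim (σ + 1) m 1 i + triplePrim (σ + 1) m 2 i + triplePrim (σ + 1) m 3 i
    + triplePrim (σ + 1) m 4 i := by
  rw [tripleTotal, triplePrim_succ_zero, tripleTotal]

theorem tripleTotal_zero (m e : ℕ) : tripleTotal 0 m (e + 1) = 2 ^ (e + 1) * doubleTotal m (e + 1)
    + 2 ^ e * (doublePrim m 1 e + 3 * doublePrim m 2 e + 7 * doublePrim m 3 e) := by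
  -- The base formulas start at shifted indices; for smaller e both sides vanish.
  have h3 : triplePrim 0 m 3 (e + 1) =
      2 ^ (e + 1) * doublePrim m 3 (e + 1) + 3 * 2 ^ e * doublePrim m 2 e := by
    rcases e with _ | e
    · rw [triplePrim_eq_zero_of_lt _ _ (by omega), doublePrim_three_of_ne (by omega),
      doublePrim_two_of_lt (by omega)]
      ring
    · exact triplePrim_zero_three m e
  have h4 : triplePrim 0 m 4 (e + 1) = 7 * 2 ^ e * doublePrim m 3 e := by
    rcases e with _ | _ | e
    · rw [triplePrim_eq_zero_of_lt _ _ (by omega), doublePrim_three_of_ne (by omega), mul_zero]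
    · rw [triplePrim_eq_zero_of_lt _ _ (by omega), doublePrim_three_of_ne (by omega), mul_zero]
    · exact triplePrim_zero_four m e
  rw [tripleTotal, triplePrim_zero_zero, triplePrim_zero_one, triplePrim_zero_two, h3, h4,
    doubleTotal]
  ring

theorem tripleTotal_of_ge {σ m i : ℕ} (hi : 3 * σ + 4 + 2 * m ≤ i) : tripleTotal σ m i = 0 := by
  induction σ generalizing i with
  | zero =>
    obtain ⟨e, rfl⟩ : ∃ e, i = e + 1 := ⟨i - 1, by omega⟩
    rw [tripleTotal_zero, doubleTotal_of_gt (by omega), doublePrim_one_of_gt (by omega),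
      doublePrim_two_of_gt (by omega), doublePrim_three_of_ne (by omega)]
    ring
  | succ σ ih =>
    rw [tripleTotal_succ, ih (by omega), triplePrim_one_of_ge (by omega),
      triplePrim_two_of_ge (by omega), triplePrim_three_of_ge (by omega),
      triplePrim_four_of_ne (by omega)]
    ring

/-- Offset j = σ is full rank. For j = σ + 1 and j = σ + 2 there are more columns than rows and the
closed form vanishes; these zeros are kept because a step here moves j by three and the third gap
also spills into them. -/
theorem tripleTotal_fourthGap {σ m i j : ℕ} (hi : i = 2 * σ + 3 + 2 * m + j) (hjs : j ≤ σ + 2) :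
    tripleTotal σ m i =
      512 * 2 ^ (9 * σ + 8 * m + 3 * j) + 112 * 2 ^ (7 * σ + 8 * m + 5 * j) - 448 * 2 ^ (8 * σ
        + 8 * m + 4 * j) - 8 * 2 ^ (6 * σ + 8 * m + 6 * j) := by
  induction σ generalizing i j with
  | zero =>
    obtain ⟨e, rfl⟩ : ∃ e, i = e + 1 := ⟨i - 1, by omega⟩
    rw [tripleTotal_zero]
    by_cases h3 : j = 0
    · subst h3
      obtain rfl : e = 2 * m + 2 := by omega
      rw [doubleTotal_of_gt (by omega), doublePrim_one_of_gt (by omega),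
        doublePrim_two_of_gt (by omega), doublePrim_three_of_eq (by omega)]
      simp only [pow_eq_two_pow]
      ring
    · by_cases h2 : j = 1
      · subst h2
        rw [doubleTotal_of_gt (by omega), doublePrim_one_of_gt (by omega),
          doublePrim_two_of_gt (by omega), doublePrim_three_of_ne (by omega)]
        ring
      · obtain rfl : j = 2 := by omega
        rw [doubleTotal_of_gt (by omega), doublePrim_one_of_gt (by omega),
          doublePrim_two_of_gt (by omega), doublePrim_three_of_ne (by omega)]
        ring
  | succ σ ih =>
    rw [tripleTotal_succ]
    by_cases h5 : j + 1 ≤ σ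
    · rw [ih (j := j + 3) (by omega) (by omega),
      triplePrim_one_fourthGap (j := j) (by omega) (by omega),
      triplePrim_two_fourthGap (j := j) (by omega) (by omega),
      triplePrim_three_fourthGap (j := j) (by omega) (by omega), triplePrim_four_of_ne (by omega)]
      ring
    · by_cases h4 : j = σ
      · subst h4
        rw [tripleTotal_of_ge (by omega),
          triplePrim_one_fourthGap (j := j) (by omega) (by omega),
          triplePrim_two_fourthGap (j := j) (by omega) (by omega),
          triplePrim_three_fourthGap (j := j) (by omega) (by omega),
          triplePrim_four_of_ne (by omega)]
        ring
      · by_cases h3 : j = σ + 1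
        · subst h3
          rw [tripleTotal_of_ge (by omega), triplePrim_one_of_ge (by omega),
            triplePrim_two_of_ge (by omega), triplePrim_three_of_ge (by omega),
            triplePrim_four_top (by omega)]
          ring
        · by_cases h2 : j = σ + 2
          · subst h2
            rw [tripleTotal_of_ge (by omega), triplePrim_one_of_ge (by omega),
              triplePrim_two_of_ge (by omega), triplePrim_three_of_ge (by omega),
              triplePrim_four_of_ne (by omega)]
            ring
          · obtain rfl : j = σ + 3 := by omega
            rw [tripleTotal_of_ge (by omega), triplePrim_one_of_ge (by omega),
              triplePrim_two_of_ge (by omega), triplePrim_three_of_ge (by omega),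
              triplePrim_four_of_ne (by omega)]
            ring

/-- The separate n-terms change form at a corner, but their total does not: j = m - 1 is the corner
2s + 2m itself. The totals of the other regions likewise run through their right-hand corner. -/
theorem tripleTotal_thirdGap {σ m i j : ℕ} (hm : 2 ≤ m) (hi : i = 2 * σ + 3 + m + j)
    (hjm : j + 1 ≤ m) :
    tripleTotal σ m i =
      512 * 2 ^ (9 * σ + 5 * m + 3 * j) + 112 * 2 ^ (7 * σ + 3 * m + 5 * j) + 16 * 2 ^ (6 * σ
        + 4 * m + 4 * j) - 448 * 2 ^ (8 * σ + 4 * m + 4 * j) - 24 * 2 ^ (6 * σ + 3 * m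
        + 5 * j) := by
  induction σ generalizing i j with
  | zero =>
    obtain ⟨e, rfl⟩ : ∃ e, i = e + 1 := ⟨i - 1, by omega⟩
    rw [tripleTotal_zero]
    obtain rfl : e = m + 2 + j := by omega
    rw [doubleTotal_mid (j := j + 1) (by omega) (by omega),
      doublePrim_one_mid (j := j + 1) (by omega) (by omega),
      doublePrim_two_mid (j := j) (by omega) (by omega), doublePrim_three_of_ne (by omega)]
    simp only [pow_eq_two_pow]
    ring
  | succ σ ih =>
    rw [tripleTotal_succ]
    by_cases h4 : j + 4 ≤ m
    · rw [ih (j := j + 3) (by omega) (by omega),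
      triplePrim_one_thirdGap (j := j) (by omega) (by omega),
      triplePrim_two_thirdGap (j := j) (by omega) (by omega),
      triplePrim_three_thirdGap (j := j) (by omega) (by omega), triplePrim_four_of_ne (by omega)]
      ring
    · by_cases h3 : m = j + 3
      · subst h3
        rw [tripleTotal_fourthGap (j := 0) (by omega) (by omega),
          triplePrim_one_thirdGap (j := j) (by omega) (by omega),
          triplePrim_two_thirdGap (j := j) (by omega) (by omega),
          triplePrim_three_thirdGap (j := j) (by omega) (by omega),
          triplePrim_four_of_ne (by omega)]
        ring
      · by_cases h2 : m = j + 2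
        · subst h2
          rw [tripleTotal_fourthGap (j := 1) (by omega) (by omega),
            triplePrim_one_thirdGap (j := j) (by omega) (by omega),
            triplePrim_two_thirdGap (j := j) (by omega) (by omega),
            triplePrim_three_thirdGap (j := j) (by omega) (by omega),
            triplePrim_four_of_ne (by omega)]
          ring
        · obtain rfl : m = j + 1 := by omega
          rw [tripleTotal_fourthGap (j := 2) (by omega) (by omega),
            triplePrim_one_fourthCorner (by omega),
            triplePrim_two_fourthCorner (by omega) (by omega),
            triplePrim_three_fourthCorner (by omega) (by omega), triplePrim_four_of_ne (by omega)]
          ring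

theorem tripleTotal_secondGap {σ m i j : ℕ} (hm : 2 ≤ m) (hi : i = σ + 1 + m + j) (hj : 1 ≤ j)
    (hjs : j ≤ σ + 1) :
    tripleTotal σ m i =
      8 * 2 ^ (6 * σ + 5 * m + 3 * j) + 3 / 4 * 2 ^ (3 * σ + 3 * m + 3 * j) + 1 / 16 * 2 ^ (2 * σ
        + 4 * m + 4 * j) + 7 / 64 * 2 ^ (2 * σ + 3 * m + 5 * j) - 7 / 4 * 2 ^ (4 * σ + 4 * m
        + 4 * j) - 9 / 32 * 2 ^ (2 * σ + 3 * m + 4 * j) := by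
  induction σ generalizing i j with
  | zero =>
    obtain ⟨e, rfl⟩ : ∃ e, i = e + 1 := ⟨i - 1, by omega⟩
    rw [tripleTotal_zero]
    obtain rfl : j = 1 := by omega
    obtain rfl : e = m + 1 := by omega
    rw [doubleTotal_mid (j := 0) (by omega) (by omega),
      doublePrim_one_mid (j := 0) (by omega) (by omega), doublePrim_two_of_eq (by omega),
      doublePrim_three_of_ne (by omega)]
    simp only [pow_eq_two_pow]
    ring
  | succ σ ih =>
    rw [tripleTotal_succ]
    by_cases h5 : j + 1 ≤ σ
    · rw [ih (j := j + 2) (by omega) (by omega) (by omega),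
      triplePrim_one_secondGap (j := j) (by omega) (by omega) (by omega) (by omega),
      triplePrim_two_secondGap (j := j) (by omega) (by omega) (by omega) (by omega),
      triplePrim_three_of_lt (by omega), triplePrim_four_of_ne (by omega)]
      ring
    · by_cases h4 : j = σ
      · subst h4
        rw [tripleTotal_thirdGap (j := 0) (by omega) (by omega) (by omega),
          triplePrim_one_secondGap (j := j) (by omega) (by omega) (by omega) (by omega),
          triplePrim_two_secondGap (j := j) (by omega) (by omega) (by omega) (by omega),
          triplePrim_three_of_lt (by omega), triplePrim_four_of_ne (by omega)]
        ring
      · by_cases h3 : j = σ + 1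
        · subst h3
          rw [tripleTotal_thirdGap (j := 1) (by omega) (by omega) (by omega),
            triplePrim_one_secondGap (j := σ + 1) (by omega) (by omega) (by omega) (by omega),
            triplePrim_two_secondGap (j := σ + 1) (by omega) (by omega) (by omega) (by omega),
            triplePrim_three_of_lt (by omega), triplePrim_four_of_ne (by omega)]
          ring
        · by_cases h2 : 3 ≤ m
          · obtain rfl : j = σ + 2 := by omega
            rw [tripleTotal_thirdGap (j := 2) (by omega) (by omega) (by omega),
              triplePrim_one_thirdCorner (by omega) (by omega),
              triplePrim_two_thirdCorner (by omega) (by omega),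
              triplePrim_three_thirdCorner (by omega) (by omega), triplePrim_four_of_ne (by omega)]
            ring
          · obtain rfl : j = σ + 2 := by omega
            obtain rfl : m = 2 := by omega
            rw [tripleTotal_fourthGap (j := 0) (by omega) (by omega),
              triplePrim_one_thirdCorner (by omega) (by omega),
              triplePrim_two_thirdCorner (by omega) (by omega),
              triplePrim_three_thirdCorner (by omega) (by omega), triplePrim_four_of_ne (by omega)]
            ring

theorem tripleTotal_firstGap {σ m i j : ℕ} (hm : 2 ≤ m) (hi : i = σ + 1 + j) (hj : 1 ≤ j)
    (hjm : j ≤ m) :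
    tripleTotal σ m i =
      8 * 2 ^ (6 * σ + 2 * m + 3 * j) + 3 / 4 * 2 ^ (3 * σ + 3 * j) + 1 / 16 * 2 ^ (2 * σ
        + 4 * j) - 7 / 4 * 2 ^ (4 * σ + 4 * j) - 1 / 8 * 2 ^ (2 * σ + 3 * j) := by
  induction σ generalizing i j with
  | zero =>
    obtain ⟨e, rfl⟩ : ∃ e, i = e + 1 := ⟨i - 1, by omega⟩
    rw [tripleTotal_zero]
    obtain rfl : e = j := by omega
    rw [doubleTotal_low (by omega) (by omega), doublePrim_one_low (by omega) (by omega),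
      doublePrim_two_of_lt (by omega), doublePrim_three_of_ne (by omega)]
    simp only [pow_eq_two_pow]
    ring
  | succ σ ih =>
    rw [tripleTotal_succ]
    by_cases h4 : j + 2 ≤ m
    · rw [ih (j := j + 2) (by omega) (by omega) (by omega),
      triplePrim_one_firstGap (j := j) (by omega) (by omega) (by omega),
      triplePrim_two_firstGap (j := j) (by omega) (by omega) (by omega),
      triplePrim_three_of_lt (by omega), triplePrim_four_of_ne (by omega)]
      ring
    · by_cases h3 : m = j + 1
      · subst h3
        rw [tripleTotal_secondGap (j := 1) (by omega) (by omega) (by omega) (by omega),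
          triplePrim_one_firstGap (j := j) (by omega) (by omega) (by omega),
          triplePrim_two_firstGap (j := j) (by omega) (by omega) (by omega),
          triplePrim_three_of_lt (by omega), triplePrim_four_of_ne (by omega)]
        ring
      · by_cases h2 : 1 ≤ σ
        · obtain rfl : m = j := by omega
          rw [tripleTotal_secondGap (j := 2) (by omega) (by omega) (by omega) (by omega),
            triplePrim_one_secondCorner (by omega) (by omega),
            triplePrim_two_secondCorner (by omega) (by omega), triplePrim_three_of_lt (by omega),
            triplePrim_four_of_ne (by omega)]
          ring
        · obtain rfl : m = j := by omega
          obtain rfl : σ = 0 := by omega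
          rw [tripleTotal_thirdGap (j := 0) (by omega) (by omega) (by omega),
            triplePrim_one_secondCorner (by omega) (by omega),
            triplePrim_two_secondCorner (by omega) (by omega), triplePrim_three_of_lt (by omega),
            triplePrim_four_of_ne (by omega)]
          ring

theorem tripleTotal_low {σ m i : ℕ} (hm : 2 ≤ m) (hi : 1 ≤ i) (hσ : i ≤ σ + 1) :
    tripleTotal σ m i =
      2 ^ (3 * σ + 2 * m + 3 * i) + 3 / 32 * 2 ^ (3 * i) - 7 / 64 * 2 ^ (4 * i) := by
  induction σ generalizing i with
  | zero =>
    obtain ⟨e, rfl⟩ : ∃ e, i = e + 1 := ⟨i - 1, by omega⟩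
    rw [tripleTotal_zero]
    obtain rfl : e = 0 := by omega
    rw [doubleTotal_low (by omega) (by omega), doublePrim_one_zero,
      doublePrim_two_of_lt (by omega), doublePrim_three_of_ne (by omega)]
    simp only [pow_eq_two_pow]
    ring
  | succ σ ih =>
    rw [tripleTotal_succ]
    by_cases h3 : i ≤ σ
    · rw [ih (by omega) (by omega), triplePrim_one_low (by omega) (by omega) (by omega),
      triplePrim_two_of_lt (by omega), triplePrim_three_of_lt (by omega),
      triplePrim_four_of_ne (by omega)]
      ring
    · by_cases h2 : i = σ + 1
      · subst h2
        rw [tripleTotal_firstGap (j := 1) (by omega) (by omega) (by omega) (by omega),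
          triplePrim_one_low (by omega) (by omega) (by omega), triplePrim_two_of_lt (by omega),
          triplePrim_three_of_lt (by omega), triplePrim_four_of_ne (by omega)]
        ring
      · obtain rfl : i = σ + 2 := by omega
        rw [tripleTotal_firstGap (j := 2) (by omega) (by omega) (by omega) (by omega),
          triplePrim_one_firstCorner (by omega) (by omega),
          triplePrim_two_firstCorner (by omega) (by omega), triplePrim_three_of_lt (by omega),
          triplePrim_four_of_ne (by omega)]
        ring

end TripleTotal

/-! ### From digit strings to persymmetric matrices -/

section Matrices

open TriplePersymmetric

/-- The persymmetric matrix of a sequence. -/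
def hankel {F : Type*} (a k : ℕ) (c : ℕ → F) : Matrix (Fin a) (Fin k) F :=
  Matrix.of fun i j => c (i + j)

/-- A digit string, continued by zeros. -/
def extend {F : Type*} [Zero F] {l : ℕ} (x : Fin l → F) (n : ℕ) : F :=
  if h : n < l then x ⟨n, h⟩ else 0

theorem extend_coe {F : Type*} [Zero F] {l : ℕ} (x : Fin l → F) (n : Fin l) :
    extend x n = x n := by
  simp [extend]

section Field

variable {F : Type*} [Field F]

theorem pair_X_pow_eq_extend {l : ℕ} (x : Fin l → F) (n : ℕ) : pair x (X ^ n) = extend x n := by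
  rw [extend]
  split_ifs with h
  · exact pair_X_pow x ⟨n, h⟩
  · rw [pair_apply]
    refine Finset.sum_eq_zero fun i _ => ?_
    rw [coeff_X_pow, if_neg (by omega), mul_zero]

theorem pair_X_pow_mul {l k : ℕ} (x : Fin l → F) (n : ℕ) {Z : F[X]} (hZ : Z ∈ degreeLT F k) :
    pair x (X ^ n * Z) = ∑ j : Fin k, extend x (n + j) * Z.coeff j := by
  have h : Z = ∑ j : Fin k, Z.coeff j • (X : F[X]) ^ (j : ℕ) := by
    ext e
    simp only [finsetSum_coeff, coeff_smul, coeff_X_pow, smul_eq_mul, mul_ite, mul_one, mul_zero]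
    by_cases he : e < k
    · rw [Finset.sum_eq_single ⟨e, he⟩] <;> simp +contextual [Fin.ext_iff, eq_comm]
    · rw [coeff_eq_zero_of_mem_degreeLT hZ (not_lt.mp he)]
      exact (Finset.sum_eq_zero fun j _ => if_neg (by omega)).symm
  conv_lhs => rw [h]
  simp only [Finset.mul_sum, map_sum, mul_smul_comm, map_smul, ← pow_add, pair_X_pow_eq_extend,
    smul_eq_mul]
  exact Finset.sum_congr rfl fun j _ => mul_comm _ _

theorem mem_kerSpace_iff {ι : Type*} {L r : ι → ℕ} {k : ℕ} {x : ∀ b, Fin (L b) → F}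
    {Z : degreeLT F k} :
    Z ∈ kerSpace L r k x ↔
      ∀ b, ∀ i < r b, ∑ j : Fin k, extend (x b) (i + j) * degreeLTEquiv F k Z j = 0 := by
  rw [mem_kerSpace]
  refine forall_congr' fun b => ⟨fun h i hi => ?_, fun h Q hQ => ?_⟩
  · have := h (X ^ (i : ℕ)) (by rw [mem_degreeLT, degree_X_pow]; exact_mod_cast hi)
    rw [pair_X_pow_mul _ _ Z.2] at this
    exact this
  · have h0 := eq_on_degreeLT (f := pair (x b) ∘ₗ LinearMap.mulRight F Z.1) (g := 0)
      (l := r b) (fun i => by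
        have := h i i.2
        rw [LinearMap.comp_apply, LinearMap.mulRight_apply, pair_X_pow_mul _ _ Z.2]
        exact this) hQ
    exact h0

theorem hankel_mulVec_eq_zero {a k : ℕ} {c : ℕ → F} {v : Fin k → F} :
    (hankel a k c).mulVec v = 0 ↔ ∀ i < a, ∑ j : Fin k, c (i + j) * v j = 0 :=
  ⟨fun h i hi => congrFun h ⟨i, hi⟩, fun h => funext fun i => h i i.2⟩

end Field

/-- Three persymmetric blocks with `s`, `s + m` and `s + m` rows, given by three sequences. -/
def tripleMatrix (s m k : ℕ) (c : Fin 3 → ℕ → ZMod 2) :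
    Matrix (Fin s ⊕ Fin (s + m) ⊕ Fin (s + m)) (Fin k) (ZMod 2) :=
  stack (hankel s k (c 0)) (hankel (s + m) k (c 1)) (hankel (s + m) k (c 2))

theorem stack_mulVec_eq_zero {a b c k : ℕ} {A : Matrix (Fin a) (Fin k) (ZMod 2)}
    {B : Matrix (Fin b) (Fin k) (ZMod 2)} {C : Matrix (Fin c) (Fin k) (ZMod 2)}
    {v : Fin k → ZMod 2} :
    (stack A B C).mulVec v = 0 ↔ A.mulVec v = 0 ∧ B.mulVec v = 0 ∧ C.mulVec v = 0 := by
  rw [stack, Matrix.fromRows_mulVec, Matrix.fromRows_mulVec]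
  constructor
  · intro h
    exact ⟨funext fun i => congrFun h (Sum.inl i), funext fun i => congrFun h (Sum.inr (Sum.inl i)),
      funext fun i => congrFun h (Sum.inr (Sum.inr i))⟩
  · rintro ⟨h1, h2, h3⟩
    rw [h1, h2, h3]
    funext i
    rcases i with i | i | i <;> rfl

theorem rank_add_finrank_ker {R' C' : Type*} [Fintype C'] [DecidableEq C']
    (M : Matrix R' C' (ZMod 2)) :
    M.rank + Module.finrank (ZMod 2) (LinearMap.ker M.mulVecLin) = Fintype.card C' := by
  rw [Matrix.rank, LinearMap.finrank_range_add_finrank_ker, Module.finrank_fintype_fun_eq_card]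

/-- Coefficients identify `kerSpace` with the null space of the stacked matrix; rank and nullity add
up to the number of columns. -/
theorem rank_tripleMatrix (σ m k : ℕ) (x : Digits fun b => tripleRows σ m b + k) :
    (tripleMatrix (σ + 1) m k fun b => extend (x b)).rank +
      Module.finrank (ZMod 2) (kerSpace (fun b => tripleRows σ m b + k)
        (fun b => tripleRows σ m b + 1) k x) = k := by
  have h := rank_add_finrank_ker (tripleMatrix (σ + 1) m k fun b => extend (x b))
  rw [Fintype.card_fin] at h
  rw [← LinearEquiv.finrank_map_eq (degreeLTEquiv (ZMod 2) k)]
  have hk : (kerSpace (fun b => tripleRows σ m b + k) (fun b => tripleRows σ m b + 1) k x).map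
      (degreeLTEquiv (ZMod 2) k).toLinearMap =
      LinearMap.ker (tripleMatrix (σ + 1) m k fun b => extend (x b)).mulVecLin := by
    ext v
    have hb : σ + 1 + m = σ + m + 1 := by omega
    rw [Submodule.mem_map_equiv, mem_kerSpace_iff, LinearEquiv.apply_symm_apply, LinearMap.mem_ker,
      Matrix.mulVecLin_apply, tripleMatrix, stack_mulVec_eq_zero, hankel_mulVec_eq_zero,
      hankel_mulVec_eq_zero, hankel_mulVec_eq_zero, hb, Fin.forall_fin_succ, Fin.forall_fin_two]
    rfl
  rw [hk]
  exact h

theorem extend_injective {F : Type*} [Zero F] {a k l : ℕ} (ha : 1 ≤ a) (hk : 1 ≤ k)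
    (hl : l + 1 = a + k) {x y : Fin l → F}
    (h : hankel a k (extend x) = hankel a k (extend y)) : x = y := by
  funext n
  have hn := n.2
  -- Digit n is read down the first column and then along the last row.
  have := congrFun (congrFun h ⟨min (n : ℕ) (a - 1), by omega⟩)
    ⟨(n : ℕ) - min (n : ℕ) (a - 1), by omega⟩
  simp only [hankel, Matrix.of_apply,
    show min (n : ℕ) (a - 1) + ((n : ℕ) - min (n : ℕ) (a - 1)) = n by omega, extend_coe] at this
  exact this

theorem isPersymmetric_hankel (a k : ℕ) (c : ℕ → ZMod 2) : IsPersymmetric (hankel a k c) := by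
  intro i r j s h
  simp only [hankel, Matrix.of_apply, h]

theorem exists_extend {a k l : ℕ} (ha : 1 ≤ a) (hk : 1 ≤ k) (hl : l + 1 = a + k)
    {A : Matrix (Fin a) (Fin k) (ZMod 2)} (hA : IsPersymmetric A) :
    ∃ x : Fin l → ZMod 2, A = hankel a k (extend x) := by
  refine ⟨fun n => A ⟨min (n : ℕ) (a - 1), by omega⟩
    ⟨(n : ℕ) - min (n : ℕ) (a - 1), by omega⟩, ?_⟩
  ext i j
  have hi := i.2
  have hj := j.2
  rw [hankel, Matrix.of_apply, extend, dif_pos (by omega)]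
  refine hA _ _ _ _ ?_
  simp only
  omega

/-- With at least one row and one column every digit is an entry, so strings and matrices
correspond. Without columns the digits would be lost. -/
theorem numRank_eq_card (σ m k i : ℕ) (hk : 1 ≤ k) :
    Γ (σ + 1) m k i = Nat.card {x : Digits fun b => tripleRows σ m b + k //
      (tripleMatrix (σ + 1) m k fun b => extend (x b)).rank = i} := by
  have h0 : tripleRows σ m 0 + k + 1 = σ + 1 + k := by
    change σ + k + 1 = _
    omega
  have h1 : tripleRows σ m 1 + k + 1 = σ + 1 + m + k := by
    change σ + m + k + 1 = _
    omega
  have h2 : tripleRows σ m 2 + k + 1 = σ + 1 + m + k := by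
    change σ + m + k + 1 = _
    omega
  rw [Γ, numRank, ← Nat.card_coe_set_eq]
  symm
  refine Nat.card_eq_of_bijective (fun x => ⟨tripleMatrix (σ + 1) m k fun b => extend (x.1 b),
    ⟨_, _, _, isPersymmetric_hankel _ _ _, isPersymmetric_hankel _ _ _,
      isPersymmetric_hankel _ _ _, rfl⟩, x.2⟩) ⟨?_, ?_⟩
  · rintro ⟨x, hx⟩ ⟨y, hy⟩ h
    have hm := congrArg Subtype.val h
    simp only [tripleMatrix, stack, Matrix.fromRows_ext_iff] at hm
    refine Subtype.ext (funext fun b => ?_)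
    fin_cases b
    · exact extend_injective (by omega) hk h0 hm.1
    · exact extend_injective (by omega) hk h1 hm.2.1
    · exact extend_injective (by omega) hk h2 hm.2.2
  · rintro ⟨_, ⟨A, B, C, hA, hB, hC, rfl⟩, hi⟩
    obtain ⟨x, rfl⟩ := exists_extend (by omega) hk h0 hA
    obtain ⟨y, rfl⟩ := exists_extend (by omega) hk h1 hB
    obtain ⟨z, rfl⟩ := exists_extend (by omega) hk h2 hC
    exact ⟨⟨Fin.cons x (Fin.cons y (Fin.cons z fun b => b.elim0)), hi⟩, rfl⟩

theorem rank_count_eq_sum (σ m i d : ℕ) (hk : 1 ≤ i + d) :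
    (Γ (σ + 1) m (i + d) i : ℚ) =
      ∑ n ∈ Finset.range 5, gaussCoeff n d * triplePrim σ m n i := by
  rw [numRank_eq_card _ _ _ _ hk]
  refine Eq.trans ?_ (kerCount_eq_sum (ι := Fin 3) (by simp) (tripleRows σ m) i d)
  rw [kerCount]
  congr 1
  refine Nat.card_congr (Equiv.subtypeEquivRight fun x => ?_)
  have := rank_tripleMatrix σ m (i + d) x
  omega

theorem rank_count_square (σ m i : ℕ) (hi : 1 ≤ i) :
    (Γ (σ + 1) m i i : ℚ) = tripleTotal σ m i := by
  have h := rank_count_eq_sum σ m i 0 (by omega)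
  rw [add_zero] at h
  have h0 : gaussCoeff 0 0 = 1 := rfl
  rw [h, tripleTotal]
  simp only [Finset.sum_range_succ, Finset.sum_range_zero, gaussCoeff_one, gaussCoeff_two,
    gaussCoeff_three, gaussCoeff_four, h0]
  ring

/-- For d ≥ 1 the n = 0 term is gone, and the Gaussian binomials are polynomials in 2^d; every
formula for k > i is this identity with the closed forms inserted. -/
theorem rank_count_of_lt (σ m i d : ℕ) (hd : 1 ≤ d) :
    (Γ (σ + 1) m (i + d) i : ℚ) = triplePrim σ m 1 i + (2 * 2 ^ d - 1) * triplePrim σ m 2 i +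
      (2 * 2 ^ d - 1) * (4 * 2 ^ d - 1) / 3 * triplePrim σ m 3 i +
      (2 * 2 ^ d - 1) * (4 * 2 ^ d - 1) * (8 * 2 ^ d - 1) / 21 * triplePrim σ m 4 i := by
  obtain ⟨e, rfl⟩ := Nat.exists_eq_add_of_le' hd
  rw [rank_count_eq_sum _ _ _ _ (by omega)]
  simp only [Finset.sum_range_succ, Finset.sum_range_zero, gaussCoeff_one, gaussCoeff_two,
    gaussCoeff_three, gaussCoeff_four, gaussCoeff_zero_succ]
  ring

end Matrices

/-! ### The rank formulas and the reduction formulas -/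

section Formulas

open TriplePersymmetric

/-- Rules that split a power of two with an integral exponent into a product of powers. -/
theorem exponent_rules :
    (∀ a b : ℤ, (2 : ℚ) ^ (a + b) = 2 ^ a * 2 ^ b) ∧ (∀ a b : ℤ, (2 : ℚ) ^ (a
      - b) = 2 ^ a / 2 ^ b) ∧
    (∀ a b : ℤ, (2 : ℚ) ^ (a * b) = (2 ^ b) ^ a) ∧
    (∀ a b c : ℤ, a * (b + c) = a * b + a * c) ∧ (∀ a b : ℕ, ((a + b : ℕ) : ℤ) = a + b) ∧
    (∀ a b : ℕ, ((a * b : ℕ) : ℤ) = a * b) ∧ ((1 : ℕ) : ℤ) = 1 ∧ ∀ a : ℤ, a * 1 = a :=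
  ⟨zpow_add₀ two_ne_zero, zpow_sub₀ two_ne_zero, fun a b => zpow_mul' 2 a b, mul_add, Nat.cast_add,
    Nat.cast_mul,
    Nat.cast_one, mul_one⟩

theorem rank_count_zero (s m : ℕ) (hs : 1 ≤ s) :
    ∀ k : ℕ, 1 ≤ k → (Γ s m k 0 : ℚ) = 1 := by
  obtain ⟨σ, rfl⟩ := Nat.exists_eq_add_of_le' hs
  intro k hk
  have h := rank_count_of_lt σ m 0 k hk
  rw [zero_add] at h
  rw [h, triplePrim_one_zero, triplePrim_two_of_lt (by omega), triplePrim_three_of_lt (by omega),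
    triplePrim_four_of_ne (by omega)]
  ring

theorem rank_count_low (s m : ℕ) (hs : 1 ≤ s) (hm : 2 ≤ m) :
    ∀ k i : ℕ, 1 ≤ i → i + 1 ≤ s → i + 1 ≤ k →
      (Γ s m k i : ℚ) =
        105 * 2 ^ (4 * i - 6 : ℤ) - 21 * 2 ^ (3 * i - 5 : ℤ) := by
  obtain ⟨σ, rfl⟩ := Nat.exists_eq_add_of_le' hs
  intro k i hi hs hk
  obtain ⟨d, rfl⟩ := Nat.exists_eq_add_of_le hk
  rw [show i + 1 + d = i + (1 + d) by omega, rank_count_of_lt _ _ _ _ (by omega),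
    triplePrim_one_low (by omega) (by omega) (by omega), triplePrim_two_of_lt (by omega),
    triplePrim_three_of_lt (by omega), triplePrim_four_of_ne (by omega)]
  simp only [exponent_rules, Nat.cast_ofNat, zpow_natCast, zpow_ofNat, pow_add, pow_mul']
  ring

theorem rank_count_firstCorner (s m : ℕ) (hs : 1 ≤ s) (hm : 2 ≤ m) :
    ∀ k : ℕ, s + 1 ≤ k →
      (Γ s m k s : ℚ) =
        2 ^ (k + s - 1 : ℤ) - 2 ^ (2 * s : ℤ)
          + 21 * (5 * 2 ^ (4 * s - 6 : ℤ) - 2 ^ (3 * s - 5 : ℤ)) := by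
  obtain ⟨σ, rfl⟩ := Nat.exists_eq_add_of_le' hs
  intro k hk
  obtain ⟨d, rfl⟩ := Nat.exists_eq_add_of_le hk
  rw [show σ + 1 + 1 + d = σ + 1 + (1 + d) by omega, rank_count_of_lt _ _ _ _ (by omega),
    triplePrim_one_firstCorner (by omega) (by omega),
    triplePrim_two_firstCorner (by omega) (by omega), triplePrim_three_of_lt (by omega),
    triplePrim_four_of_ne (by omega)]
  simp only [exponent_rules, Nat.cast_ofNat, zpow_natCast, zpow_ofNat, pow_add, pow_mul']
  ring

theorem rank_count_firstGap (s m : ℕ) (hs : 1 ≤ s) (hm : 2 ≤ m) :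
    ∀ k j : ℕ, 1 ≤ j → j + 1 ≤ m → s + j + 1 ≤ k →
      (Γ s m k (s + j) : ℚ) =
        (21 * 2 ^ (j - 1 : ℤ) - 3) * 2 ^ (k + s + 2 * j - 4 : ℤ)
          + 21 * (5 * 2 ^ (4 * s + 4 * j - 6 : ℤ) - 2 ^ (3 * s + 3 * j - 5 : ℤ)
            - 5 * 2 ^ (2 * s + 4 * j - 6 : ℤ) + 2 ^ (2 * s + 3 * j - 5 : ℤ)) := by
  obtain ⟨σ, rfl⟩ := Nat.exists_eq_add_of_le' hs
  intro k j hj hjm hk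
  obtain ⟨d, rfl⟩ := Nat.exists_eq_add_of_le hk
  rw [show σ + 1 + j + 1 + d = σ + 1 + j + (1 + d) by omega, rank_count_of_lt _ _ _ _ (by omega),
    triplePrim_one_firstGap (j := j) (by omega) (by omega) (by omega),
    triplePrim_two_firstGap (j := j) (by omega) (by omega) (by omega),
    triplePrim_three_of_lt (by omega), triplePrim_four_of_ne (by omega)]
  simp only [exponent_rules, Nat.cast_ofNat, zpow_natCast, zpow_ofNat, pow_add, pow_mul']
  ring

theorem rank_count_secondCorner (s m : ℕ) (hs : 1 ≤ s) (hm : 2 ≤ m) :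
    ∀ k : ℕ, s + m + 1 ≤ k →
      (Γ s m k (s + m) : ℚ) =
        (21 * 2 ^ (s + 3 * m - 5 : ℤ) + 45 * 2 ^ (s + 2 * m - 4 : ℤ))
            * (2 ^ (k : ℤ) - 2 ^ (s + m + 1 : ℤ))
          + 105 * 2 ^ (4 * s + 4 * m - 6 : ℤ) - 21 * 2 ^ (3 * s + 3 * m - 5 : ℤ)
          - 21 * 2 ^ (2 * s + 4 * m - 6 : ℤ) + 9 * 2 ^ (2 * s + 3 * m - 5 : ℤ) := by
  obtain ⟨σ, rfl⟩ := Nat.exists_eq_add_of_le' hs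
  intro k hk
  obtain ⟨d, rfl⟩ := Nat.exists_eq_add_of_le hk
  rw [show σ + 1 + m + 1 + d = σ + 1 + m + (1 + d) by omega, rank_count_of_lt _ _ _ _ (by omega),
    triplePrim_one_secondCorner (by omega) (by omega),
    triplePrim_two_secondCorner (by omega) (by omega), triplePrim_three_of_lt (by omega),
    triplePrim_four_of_ne (by omega)]
  simp only [exponent_rules, Nat.cast_ofNat, zpow_natCast, zpow_ofNat, pow_add, pow_mul']
  ring

theorem rank_count_secondGap (s m : ℕ) (hs : 1 ≤ s) (hm : 2 ≤ m) :
    ∀ k j : ℕ, 1 ≤ j → j + 1 ≤ s → s + m + j + 1 ≤ k →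
      (Γ s m k (s + m + j) : ℚ) =
        21 * (2 ^ (k + s + 3 * m + 3 * j - 5 : ℤ) + 35 * 2 ^ (k + s + 2 * m + 4 * j - 7 : ℤ)
          - 9 * 2 ^ (k + s + 2 * m + 3 * j - 6 : ℤ)
          + 5 * 2 ^ (4 * s + 4 * m + 4 * j - 6 : ℤ) - 2 ^ (3 * s + 3 * m + 3 * j - 5 : ℤ)
          - 5 * 2 ^ (2 * s + 4 * m + 4 * j - 6 : ℤ)
          - 155 * 2 ^ (2 * s + 3 * m + 5 * j - 8 : ℤ)
          + 45 * 2 ^ (2 * s + 3 * m + 4 * j - 7 : ℤ)) := by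
  obtain ⟨σ, rfl⟩ := Nat.exists_eq_add_of_le' hs
  intro k j hj hjs hk
  obtain ⟨d, rfl⟩ := Nat.exists_eq_add_of_le hk
  rw [show σ + 1 + m + j + 1 + d = σ + 1 + m + j + (1 + d) by omega,
    rank_count_of_lt _ _ _ _ (by omega),
    triplePrim_one_secondGap (j := j) (by omega) (by omega) (by omega) (by omega),
    triplePrim_two_secondGap (j := j) (by omega) (by omega) (by omega) (by omega),
    triplePrim_three_of_lt (by omega), triplePrim_four_of_ne (by omega)]
  simp only [exponent_rules, Nat.cast_ofNat, zpow_natCast, zpow_ofNat, pow_add, pow_mul']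
  ring

theorem rank_count_thirdCorner (s m : ℕ) (hs : 1 ≤ s) (hm : 2 ≤ m) :
    ∀ k : ℕ, 2 * s + m + 1 ≤ k →
      (Γ s m k (2 * s + m) : ℚ) =
        3 * 2 ^ (2 * k + 2 * s + m - 2 : ℤ) + 21 * 2 ^ (k + 4 * s + 3 * m - 5 : ℤ)
          + 735 * 2 ^ (k + 5 * s + 2 * m - 7 : ℤ) - 477 * 2 ^ (k + 4 * s + 2 * m - 6 : ℤ)
          + 105 * 2 ^ (8 * s + 4 * m - 6 : ℤ) - 105 * 2 ^ (6 * s + 4 * m - 6 : ℤ)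
          - 3255 * 2 ^ (7 * s + 3 * m - 8 : ℤ) + 1629 * 2 ^ (6 * s + 3 * m - 7 : ℤ) := by
  obtain ⟨σ, rfl⟩ := Nat.exists_eq_add_of_le' hs
  intro k hk
  obtain ⟨d, rfl⟩ := Nat.exists_eq_add_of_le hk
  rw [show 2 * (σ + 1) + m + 1 + d = 2 * (σ + 1) + m + (1 + d) by omega,
    rank_count_of_lt _ _ _ _ (by omega), triplePrim_one_thirdCorner (by omega) (by omega),
    triplePrim_two_thirdCorner (by omega) (by omega),
    triplePrim_three_thirdCorner (by omega) (by omega), triplePrim_four_of_ne (by omega)]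
  simp only [exponent_rules, Nat.cast_ofNat, zpow_natCast, zpow_ofNat, pow_add, pow_mul']
  ring

theorem rank_count_thirdGap (s m : ℕ) (hs : 1 ≤ s) :
    ∀ k j : ℕ, j + 2 ≤ m → 2 * s + m + 2 + j ≤ k →
      (Γ s m k (2 * s + m + 1 + j) : ℚ) =
        21 * 2 ^ (2 * k + 2 * s + m + 3 * j - 2 : ℤ) + 21 * 2 ^ (k + 4 * s + 3 * m + 3 * j - 2 : ℤ)
          + 735 * 2 ^ (k + 5 * s + 2 * m + 4 * j - 3 : ℤ)
          - 945 * 2 ^ (k + 4 * s + 2 * m + 4 * j - 3 : ℤ)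
          + 105 * 2 ^ (8 * s + 4 * m + 4 * j - 2 : ℤ) - 105 * 2 ^ (6 * s + 4 * m + 4 * j - 2 : ℤ)
          - 3255 * 2 ^ (7 * s + 3 * m + 5 * j - 3 : ℤ)
          + 3255 * 2 ^ (6 * s + 3 * m + 5 * j - 3 : ℤ) := by
  obtain ⟨σ, rfl⟩ := Nat.exists_eq_add_of_le' hs
  intro k j hjm hk
  obtain ⟨d, rfl⟩ := Nat.exists_eq_add_of_le hk
  rw [show 2 * (σ + 1) + m + 2 + j + d = 2 * (σ + 1) + m + 1 + j + (1 + d) by omega,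
    rank_count_of_lt _ _ _ _ (by omega), triplePrim_one_thirdGap (j := j) (by omega) (by omega),
    triplePrim_two_thirdGap (j := j) (by omega) (by omega),
    triplePrim_three_thirdGap (j := j) (by omega) (by omega), triplePrim_four_of_ne (by omega)]
  simp only [exponent_rules, Nat.cast_ofNat, zpow_natCast, zpow_ofNat, pow_add, pow_mul']
  ring

theorem rank_count_fourthCorner (s m : ℕ) (hs : 1 ≤ s) (hm : 1 ≤ m) :
    ∀ k : ℕ, 2 * s + 2 * m + 1 ≤ k →
      (Γ s m k (2 * s + 2 * m) : ℚ) =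
        53 * 2 ^ (2 * s - 1 : ℤ) * (2 ^ (2 * k + 4 * m - 4 : ℤ) - 2 ^ (4 * s + 8 * m - 2 : ℤ))
          + (735 * 2 ^ (5 * s - 1 : ℤ) - 1629 * 2 ^ (4 * s - 1 : ℤ))
            * (2 ^ (k + 6 * m - 6 : ℤ) - 2 ^ (2 * s + 8 * m - 5 : ℤ))
          + 21 * (5 * 2 ^ (8 * s + 8 * m - 6 : ℤ) + 3 * 2 ^ (6 * s + 8 * m - 8 : ℤ)
            - 15 * 2 ^ (7 * s + 8 * m - 8 : ℤ)) := by
  obtain ⟨σ, rfl⟩ := Nat.exists_eq_add_of_le' hs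
  intro k hk
  obtain ⟨d, rfl⟩ := Nat.exists_eq_add_of_le hk
  rw [show 2 * (σ + 1) + 2 * m + 1 + d = 2 * (σ + 1) + 2 * m + (1 + d) by omega,
    rank_count_of_lt _ _ _ _ (by omega), triplePrim_one_fourthCorner (by omega),
    triplePrim_two_fourthCorner (by omega) (by omega),
    triplePrim_three_fourthCorner (by omega) (by omega), triplePrim_four_of_ne (by omega)]
  simp only [exponent_rules, Nat.cast_ofNat, zpow_natCast, zpow_ofNat, pow_add, pow_mul']
  ring

/-- Here m is arbitrary because the reduction formula compares with m = 0. -/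
theorem rank_count_fourthGap (s m : ℕ) (hs : 1 ≤ s) :
    ∀ k j : ℕ, j + 2 ≤ s → 2 * s + 2 * m + 2 + j ≤ k →
      (Γ s m k (2 * s + 2 * m + 1 + j) : ℚ) =
        105 * (2 ^ (2 * k + 2 * s + 4 * m + 4 * j - 2 : ℤ)
            + 7 * 2 ^ (k + 5 * s + 6 * m + 4 * j - 3 : ℤ)
            - 31 * 2 ^ (k + 4 * s + 6 * m + 5 * j - 3 : ℤ))
          + 105 * (2 ^ (8 * s + 8 * m + 4 * j - 2 : ℤ)
            - 31 * 2 ^ (7 * s + 8 * m + 5 * j - 3 : ℤ)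
            + 93 * 2 ^ (6 * s + 8 * m + 6 * j - 3 : ℤ)) := by
  obtain ⟨σ, rfl⟩ := Nat.exists_eq_add_of_le' hs
  intro k j hjs hk
  obtain ⟨d, rfl⟩ := Nat.exists_eq_add_of_le hk
  rw [show 2 * (σ + 1) + 2 * m + 2 + j + d = 2 * (σ + 1) + 2 * m + 1 + j + (1 + d) by omega,
    rank_count_of_lt _ _ _ _ (by omega), triplePrim_one_fourthGap (j := j) (by omega) (by omega),
    triplePrim_two_fourthGap (j := j) (by omega) (by omega),
    triplePrim_three_fourthGap (j := j) (by omega) (by omega), triplePrim_four_of_ne (by omega)]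
  simp only [exponent_rules, Nat.cast_ofNat, zpow_natCast, zpow_ofNat, pow_add, pow_mul']
  ring

theorem rank_count_top (s m : ℕ) (hs : 1 ≤ s) :
    ∀ k : ℕ, 3 * s + 2 * m ≤ k →
      (Γ s m k (3 * s + 2 * m) : ℚ) =
        2 ^ (3 * k + 2 * m + 3 * s - 3 : ℤ) - 7 * 2 ^ (2 * k + 4 * m + 6 * s - 6 : ℤ)
          + 7 * 2 ^ (k + 6 * m + 9 * s - 8 : ℤ) - 2 ^ (8 * m + 12 * s - 9 : ℤ) := by
  obtain ⟨σ, rfl⟩ := Nat.exists_eq_add_of_le' hs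
  intro k hk
  obtain ⟨d, rfl⟩ := Nat.exists_eq_add_of_le hk
  -- Full rank is the one case in which k = i obeys the general formula. It is checked separately
  -- because the n = 0 term is present at d = 0.
  rcases d with _ | d
  · rw [add_zero, rank_count_square _ _ _ (by omega),
    tripleTotal_fourthGap (j := σ) (by omega) (by omega)]
    simp only [exponent_rules, Nat.cast_ofNat, zpow_natCast, zpow_ofNat, pow_add, pow_mul']
    ring
  · rw [rank_count_of_lt _ _ _ _ (by omega), triplePrim_one_of_ge (by omega),
    triplePrim_two_of_ge (by omega), triplePrim_three_of_ge (by omega),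
    triplePrim_four_top (by omega)]
    simp only [exponent_rules, Nat.cast_ofNat, zpow_natCast, zpow_ofNat, pow_add, pow_mul']
    ring

theorem rank_count_square_low (s m : ℕ) (hs : 1 ≤ s) (hm : 2 ≤ m) :
    ∀ i : ℕ, 1 ≤ i → i ≤ s + 1 →
      (Γ s m i i : ℚ) =
        2 ^ (3 * s + 2 * m + 3 * i - 3 : ℤ) - 7 * 2 ^ (4 * i - 6 : ℤ)
          + 3 * 2 ^ (3 * i - 5 : ℤ) := by
  obtain ⟨σ, rfl⟩ := Nat.exists_eq_add_of_le' hs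
  intro i hi his
  rw [rank_count_square _ _ _ hi]
  rcases his.eq_or_lt with rfl | his
  · rw [tripleTotal_firstGap (j := 1) hm (by omega) (by omega) (by omega)]
    simp only [exponent_rules, Nat.cast_ofNat, zpow_natCast, zpow_ofNat, pow_add, pow_mul']
    ring
  · rw [tripleTotal_low hm hi (by omega)]
    simp only [exponent_rules, Nat.cast_ofNat, zpow_natCast, zpow_ofNat, pow_add, pow_mul']
    ring

theorem rank_count_square_firstGap (s m : ℕ) (hs : 1 ≤ s) (hm : 2 ≤ m) :
    ∀ j : ℕ, 1 ≤ j → j ≤ m + 1 →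
      (Γ s m (s + j) (s + j) : ℚ) =
        2 ^ (6 * s + 2 * m + 3 * j - 3 : ℤ) - 7 * 2 ^ (4 * s + 4 * j - 6 : ℤ)
          + 3 * 2 ^ (3 * s + 3 * j - 5 : ℤ)
          + (2 ^ (j - 1 : ℤ) - 1) * 2 ^ (2 * s + 3 * j - 5 : ℤ) := by
  obtain ⟨σ, rfl⟩ := Nat.exists_eq_add_of_le' hs
  intro j hj hjm
  rw [rank_count_square _ _ _ (by omega)]
  rcases hjm.eq_or_lt with rfl | hjm
  -- The formula reaches one rank beyond s + m, where it agrees with the second gap at j = 1.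
  · rw [tripleTotal_secondGap (j := 1) hm (by omega) (by omega) (by omega)]
    simp only [exponent_rules, Nat.cast_ofNat, zpow_natCast, zpow_ofNat, pow_add, pow_mul']
    ring
  · rw [tripleTotal_firstGap (j := j) hm (by omega) hj (by omega)]
    simp only [exponent_rules, Nat.cast_ofNat, zpow_natCast, zpow_ofNat, pow_add, pow_mul']
    ring

theorem rank_count_square_secondGap (s m : ℕ) (hs : 1 ≤ s) (hm : 2 ≤ m) :
    ∀ j : ℕ, 1 ≤ j → j + 1 ≤ s →
      (Γ s m (s + m + j) (s + m + j) : ℚ) =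
        2 ^ (6 * s + 5 * m + 3 * j - 3 : ℤ) - 7 * 2 ^ (4 * s + 4 * m + 4 * j - 6 : ℤ)
          + 3 * 2 ^ (3 * s + 3 * m + 3 * j - 5 : ℤ) + 2 ^ (2 * s + 4 * m + 4 * j - 6 : ℤ)
          + 7 * 2 ^ (2 * s + 3 * m + 5 * j - 8 : ℤ)
          - 9 * 2 ^ (2 * s + 3 * m + 4 * j - 7 : ℤ) := by
  obtain ⟨σ, rfl⟩ := Nat.exists_eq_add_of_le' hs
  intro j hj hjs
  rw [rank_count_square _ _ _ (by omega),
    tripleTotal_secondGap (j := j) hm (by omega) hj (by omega)]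
  simp only [exponent_rules, Nat.cast_ofNat, zpow_natCast, zpow_ofNat, pow_add, pow_mul']
  ring

theorem rank_count_square_thirdCorner (s m : ℕ) (hs : 1 ≤ s) (hm : 2 ≤ m) :
    (Γ s m (2 * s + m) (2 * s + m) : ℚ) =
        2 ^ (9 * s + 5 * m - 3 : ℤ) - 7 * 2 ^ (8 * s + 4 * m - 6 : ℤ)
          + 7 * 2 ^ (7 * s + 3 * m - 8 : ℤ) + 3 * 2 ^ (6 * s + 3 * m - 7 : ℤ)
          + 2 ^ (6 * s + 4 * m - 6 : ℤ) := by
  obtain ⟨σ, rfl⟩ := Nat.exists_eq_add_of_le' hs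
  rw [rank_count_square _ _ _ (by omega),
    tripleTotal_secondGap (j := σ + 1) hm (by omega) (by omega) (by omega)]
  simp only [exponent_rules, Nat.cast_ofNat, zpow_natCast, zpow_ofNat, pow_add, pow_mul']
  ring

theorem rank_count_square_thirdGap (s m : ℕ) (hs : 1 ≤ s) (hm : 2 ≤ m) :
    ∀ j : ℕ, j + 2 ≤ m →
      (Γ s m (2 * s + m + 1 + j) (2 * s + m + 1 + j) : ℚ) =
        2 ^ (9 * s + 5 * m + 3 * j : ℤ) - 7 * 2 ^ (8 * s + 4 * m + 4 * j - 2 : ℤ)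
          + 7 * 2 ^ (7 * s + 3 * m + 5 * j - 3 : ℤ) - 3 * 2 ^ (6 * s + 3 * m + 5 * j - 3 : ℤ)
          + 2 ^ (6 * s + 4 * m + 4 * j - 2 : ℤ) := by
  obtain ⟨σ, rfl⟩ := Nat.exists_eq_add_of_le' hs
  intro j hjm
  rw [rank_count_square _ _ _ (by omega), tripleTotal_thirdGap (j := j) hm (by omega) (by omega)]
  simp only [exponent_rules, Nat.cast_ofNat, zpow_natCast, zpow_ofNat, pow_add, pow_mul']
  ring

theorem rank_count_square_fourthCorner (s m : ℕ) (hs : 1 ≤ s) (hm : 2 ≤ m) :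
    (Γ s m (2 * s + 2 * m) (2 * s + 2 * m) : ℚ) =
        2 ^ (9 * s + 8 * m - 3 : ℤ) - 7 * 2 ^ (8 * s + 8 * m - 6 : ℤ)
          + 7 * 2 ^ (7 * s + 8 * m - 8 : ℤ) + 2 ^ (6 * s + 8 * m - 8 : ℤ) := by
  obtain ⟨n, rfl⟩ := Nat.exists_eq_add_of_le' hm
  obtain ⟨σ, rfl⟩ := Nat.exists_eq_add_of_le' hs
  rw [rank_count_square _ _ _ (by omega),
    tripleTotal_thirdGap (j := n + 1) hm (by omega) (by omega)]
  simp only [exponent_rules, Nat.cast_ofNat, zpow_natCast, zpow_ofNat, pow_add, pow_mul']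
  ring

theorem rank_count_square_fourthGap (s m : ℕ) (hs : 1 ≤ s) :
    ∀ j : ℕ, j + 2 ≤ s →
      (Γ s m (2 * s + 2 * m + 1 + j) (2 * s + 2 * m + 1 + j) : ℚ) =
        2 ^ (9 * s + 8 * m + 3 * j : ℤ) - 7 * 2 ^ (8 * s + 8 * m + 4 * j - 2 : ℤ)
          + 7 * 2 ^ (7 * s + 8 * m + 5 * j - 3 : ℤ)
          - 2 ^ (6 * s + 8 * m + 6 * j - 3 : ℤ) := by
  obtain ⟨σ, rfl⟩ := Nat.exists_eq_add_of_le' hs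
  intro j hjs
  rw [rank_count_square _ _ _ (by omega), tripleTotal_fourthGap (j := j) (by omega) (by omega)]
  simp only [exponent_rules, Nat.cast_ofNat, zpow_natCast, zpow_ofNat, pow_add, pow_mul']
  ring

theorem rank_count_square_top (s m : ℕ) (hs : 1 ≤ s) :
    (Γ s m (3 * s + 2 * m) (3 * s + 2 * m) : ℚ) =
        21 * 2 ^ (8 * m + 12 * s - 9 : ℤ) := by
  obtain ⟨σ, rfl⟩ := Nat.exists_eq_add_of_le' hs
  rw [rank_count_square _ _ _ (by omega), tripleTotal_fourthGap (j := σ) (by omega) (by omega)]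
  simp only [exponent_rules, Nat.cast_ofNat, zpow_natCast, zpow_ofNat, pow_add, pow_mul']
  ring

/-- Every term of the closed form scales by 2^(8j) when m, k and the offset are shifted, so it
suffices to compare two instances of the formula, the second at offset 0. -/
theorem rank_count_reduction_thirdGap (s m : ℕ) (hs : 1 ≤ s) :
    ∀ k j : ℕ, j + 2 ≤ m → 2 * s + m + 2 + j ≤ k →
      Γ s m k (2 * s + m + 1 + j) =
        16 ^ (2 * j) * Γ s (m - j) (k - 2 * j) (2 * s + 1 + (m - j)) := by
  intro k j hjm hk
  obtain ⟨n, rfl⟩ := Nat.exists_eq_add_of_le' hjm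
  obtain ⟨d, rfl⟩ := Nat.exists_eq_add_of_le hk
  have h := rank_count_thirdGap s (n + (j + 2)) hs _ j hjm hk
  have h' := rank_count_thirdGap s (n + 2) hs (2 * s + (n + 2) + 2 + 0 + d) 0 (by omega) (by omega)
  rw [show n + (j + 2) - j = n + 2 by omega,
    show 2 * s + (n + (j + 2)) + 2 + j + d - 2 * j = 2 * s + (n + 2) + 2 + 0 + d by omega,
    show 2 * s + 1 + (n + 2) = 2 * s + (n + 2) + 1 + 0 by omega]
  suffices h0 : (Γ s (n + (j + 2)) (2 * s + (n + (j + 2)) + 2 + j + d) (2 * s + (n + (j + 2)) + 1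
    + j) : ℚ) =
      16 ^ (2 * j) * Γ s (n + 2) (2 * s + (n + 2) + 2 + 0 + d) (2 * s + (n + 2) + 1 + 0) by
    exact_mod_cast h0
  rw [h, h', pow_eq_two_pow.2.2.1]
  simp only [exponent_rules, Nat.cast_ofNat, zpow_natCast, zpow_ofNat, pow_add, pow_mul']
  ring

theorem rank_count_reduction_fourthCorner (s m : ℕ) (hs : 1 ≤ s) (hm : 1 ≤ m) :
    ∀ k : ℕ, 2 * s + 2 * m + 1 ≤ k →
      Γ s m k (2 * s + 2 * m) =
        16 ^ (2 * m - 2) * Γ s 1 (k - 2 * (m - 1)) (2 * s + 2) := by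
  intro k hk
  obtain ⟨n, rfl⟩ := Nat.exists_eq_add_of_le' hm
  obtain ⟨d, rfl⟩ := Nat.exists_eq_add_of_le hk
  have h := rank_count_fourthCorner s (n + 1) hs hm _ hk
  have h' := rank_count_fourthCorner s 1 hs le_rfl (2 * s + 2 + 1 + d) (by omega)
  rw [show 2 * (n + 1) - 2 = 2 * n by omega,
    show 2 * s + 2 * (n + 1) + 1 + d - 2 * (n + 1 - 1) = 2 * s + 2 + 1 + d by omega]
  suffices h0 : (Γ s (n + 1) (2 * s + 2 * (n + 1) + 1 + d) (2 * s + 2 * (n + 1)) : ℚ) =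
      16 ^ (2 * n) * Γ s 1 (2 * s + 2 + 1 + d) (2 * s + 2 * 1) by
    exact_mod_cast h0
  rw [h, h', pow_eq_two_pow.2.2.1]
  simp only [exponent_rules, Nat.cast_ofNat, zpow_natCast, zpow_ofNat, pow_add, pow_mul']
  ring

theorem rank_count_reduction_fourthGap (s m : ℕ) (hs : 1 ≤ s) :
    ∀ k j : ℕ, j + 2 ≤ s → 2 * s + 2 * m + 2 + j ≤ k →
      Γ s m k (2 * s + 2 * m + 1 + j) =
        16 ^ (2 * m + 3 * j) *
          Γ (s - j) 0 (k - 2 * m - 3 * j) (2 * (s - j) + 1) := by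
  intro k j hjs hk
  obtain ⟨n, rfl⟩ := Nat.exists_eq_add_of_le' hjs
  obtain ⟨d, rfl⟩ := Nat.exists_eq_add_of_le hk
  have h := rank_count_fourthGap (n + (j + 2)) m hs _ j hjs hk
  have h' := rank_count_fourthGap (n + 2) 0 (by omega) (2 * (n + 2) + 2 * 0 + 2 + 0 + d) 0
    (by omega) (by omega)
  rw [show n + (j + 2) - j = n + 2 by omega,
    show 2 * (n + (j + 2)) + 2 * m + 2 + j + d - 2 * m - 3 * j = 2 * (n + 2) + 2 * 0 + 2 + 0
    + d by omega, show 2 * (n + 2) + 1 = 2 * (n + 2) + 2 * 0 + 1 + 0 by omega]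
  suffices h0 : (Γ (n + (j + 2)) m (2 * (n + (j + 2)) + 2 * m + 2 + j + d) (2 * (n + (j + 2))
    + 2 * m + 1 + j) : ℚ) =
      16 ^ (2 * m + 3 * j) * Γ (n + 2) 0 (2 * (n + 2) + 2 * 0 + 2 + 0 + d) (2 * (n + 2) + 2 * 0
        + 1 + 0) by
    exact_mod_cast h0
  rw [h, h', pow_eq_two_pow.2.2.1]
  simp only [exponent_rules, Nat.cast_ofNat, zpow_natCast, zpow_ofNat, pow_add, pow_mul']
  ring

theorem rank_count_reduction_top (s m : ℕ) (hs : 1 ≤ s) :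
    ∀ k : ℕ, 3 * s + 2 * m ≤ k →
      Γ s m k (3 * s + 2 * m) =
        16 ^ (2 * m + 3 * s - 3) * Γ 1 0 (k - 2 * m - (3 * s - 3)) 3 := by
  intro k hk
  obtain ⟨n, rfl⟩ := Nat.exists_eq_add_of_le' hs
  obtain ⟨d, rfl⟩ := Nat.exists_eq_add_of_le hk
  have h := rank_count_top (n + 1) m hs _ hk
  have h' := rank_count_top 1 0 le_rfl (3 + d) (by omega)
  rw [show 2 * m + 3 * (n + 1) - 3 = 2 * m + 3 * n by omega,
    show 3 * (n + 1) + 2 * m + d - 2 * m - (3 * (n + 1) - 3) = 3 + d by omega]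
  suffices h0 : (Γ (n + 1) m (3 * (n + 1) + 2 * m + d) (3 * (n + 1) + 2 * m) : ℚ) =
      16 ^ (2 * m + 3 * n) * Γ 1 0 (3 + d) (3 * 1 + 2 * 0) by
    exact_mod_cast h0
  rw [h, h', pow_eq_two_pow.2.2.1]
  simp only [exponent_rules, Nat.cast_ofNat, zpow_natCast, zpow_ofNat, pow_add, pow_mul']
  ring

end Formulas

/-! ### Orthogonality of characters on polynomials and on strings -/

section CharacterSums

open TriplePersymmetric

/-- The nontrivial additive character of `𝔽₂`. -/
def sign (a : ZMod 2) : ℤ := if a = 0 then 1 else -1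

theorem sign_zero : sign 0 = 1 := rfl

theorem sign_of_ne_zero {a : ZMod 2} (h : a ≠ 0) : sign a = -1 := if_neg h

theorem sign_add (a b : ZMod 2) : sign (a + b) = sign a * sign b := by
  revert a b
  decide

theorem sign_sum {A : Type*} (s : Finset A) (f : A → ZMod 2) :
    sign (∑ i ∈ s, f i) = ∏ i ∈ s, sign (f i) := by
  classical
  induction s using Finset.induction_on with
  | empty => simp [sign_zero]
  | insert a s ha ih => rw [Finset.sum_insert ha, Finset.prod_insert ha, sign_add, ih]

/-- Translation by `z` permutes `S` and changes the sign of every term. -/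
theorem sum_sign_eq_zero {M : Type*} [AddCommGroup M] (S : Finset M) (f : M →+ ZMod 2) {z : M}
    (hz : ∀ y, y ∈ S ↔ y + z ∈ S) (hf : f z ≠ 0) : ∑ y ∈ S, sign (f y) = 0 := by
  have h : ∑ y ∈ S, sign (f (y + z)) = ∑ y ∈ S, sign (f y) :=
    Finset.sum_equiv (Equiv.addRight z) hz fun y _ => rfl
  simp only [map_add, sign_add, sign_of_ne_zero hf, mul_neg, mul_one, Finset.sum_neg_distrib] at h
  linarith

theorem mem_polys {n : ℕ} {p : (ZMod 2)[X]} : p ∈ polys n ↔ p ∈ degreeLT (ZMod 2) n := by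
  rw [polys, Set.Finite.mem_toFinset, mem_degreeLT]
  rfl

theorem card_submodule {V : Type*} [AddCommGroup V] [Module (ZMod 2) V]
    [FiniteDimensional (ZMod 2) V] : Nat.card V = 2 ^ Module.finrank (ZMod 2) V := by
  rw [Module.natCard_eq_pow_finrank (K := ZMod 2), Nat.card_zmod]

theorem card_polys (n : ℕ) : (polys n).card = 2 ^ n := by
  have h : Nat.card (degreeLT (ZMod 2) n) = 2 ^ n := by rw [card_submodule, finrank_degreeLT]
  rw [← h, ← SetLike.coe_sort_coe, Nat.card_coe_set_eq, ← Set.ncard_coe_finset]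
  congr 1
  ext Y
  exact mem_polys

theorem sum_polys_sign (n : ℕ) (f : (ZMod 2)[X] →ₗ[ZMod 2] ZMod 2)
    [Decidable (∀ Z ∈ degreeLT (ZMod 2) n, f Z = 0)] :
    ∑ Z ∈ polys n, sign (f Z) = if ∀ Z ∈ degreeLT (ZMod 2) n, f Z = 0 then 2 ^ n else 0 := by
  split_ifs with h
  · rw [Finset.sum_congr rfl fun Z hZ => by rw [h Z (mem_polys.mp hZ), sign_zero],
      Finset.sum_const, card_polys]
    simp
  · push Not at h
    obtain ⟨z, hz, hf⟩ := h
    refine sum_sign_eq_zero (polys n) f.toAddMonoidHom (z := z) (fun y => ?_) hf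
    rw [mem_polys, mem_polys, Submodule.add_mem_iff_left _ hz]

theorem sum_digits_sign {L : ℕ} {A : (ZMod 2)[X]} (hA : A ∈ degreeLT (ZMod 2) L)
    [Decidable (A = 0)] :
    ∑ x : Fin L → ZMod 2, sign (pair x A) = if A = 0 then 2 ^ L else 0 := by
  let f : (Fin L → ZMod 2) →+ ZMod 2 :=
    { toFun := fun x => pair x A
      map_zero' := by simp [pair_apply]
      map_add' := fun x y => by simp [pair_apply, add_mul, Finset.sum_add_distrib] }
  split_ifs with h
  · simp [h, sign_zero]
  · obtain ⟨n, hn⟩ : ∃ n, A.coeff n ≠ 0 := by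
      by_contra! h0
      exact h (Polynomial.ext h0)
    have hnL : n < L := by
      by_contra hle
      exact hn (coeff_eq_zero_of_mem_degreeLT hA (not_lt.mp hle))
    refine sum_sign_eq_zero Finset.univ f (z := Pi.single ⟨n, hnL⟩ 1) (fun y => by simp) ?_
    change pair _ A ≠ 0
    rw [pair_apply, Finset.sum_eq_single ⟨n, hnL⟩]
    · simpa using hn
    · intro j _ hj
      rw [Pi.single_eq_of_ne hj, zero_mul]
    · simp

variable {ι : Type*} [Fintype ι]

/-- The exponential sum attached to digit strings. -/
noncomputable def digitSum (L r : ι → ℕ) (k : ℕ) (x : Digits L) : ℤ :=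
  ∑ Y ∈ polys k, ∏ b, ∑ Z ∈ polys (r b), sign (pair (x b) (Y * Z))

/-- For each Y the inner sums vanish unless Y is orthogonal to all rows. So a kernel vector
contributes 2 to the number of rows, and any other Y contributes 0. -/
theorem digitSum_eq (L r : ι → ℕ) (k : ℕ) (x : Digits L) :
    digitSum L r k x = 2 ^ (∑ b, r b + Module.finrank (ZMod 2) (kerSpace L r k x)) := by
  classical
  have h1 : ∀ Y, ∏ b, ∑ Z ∈ polys (r b), sign (pair (x b) (Y * Z)) =
      if ∀ b, ∀ Q ∈ degreeLT (ZMod 2) (r b), pair (x b) (Q * Y) = 0 then 2 ^ (∑ b, r b) else 0 := by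
    intro Y
    have h2 : ∀ b, ∑ Z ∈ polys (r b), sign (pair (x b) (Y * Z)) =
        if ∀ Q ∈ degreeLT (ZMod 2) (r b), pair (x b) (Q * Y) = 0 then 2 ^ r b else 0 := by
      intro b
      simp only [mul_comm Y]
      exact sum_polys_sign (r b) (pair (x b) ∘ₗ LinearMap.mulRight (ZMod 2) Y)
    simp only [h2]
    rw [Finset.prod_ite_zero, Finset.prod_pow_eq_pow_sum]
    simp
  rw [digitSum, Finset.sum_congr rfl fun Y _ => h1 Y, ← Finset.sum_filter, Finset.sum_const,
    pow_add, nsmul_eq_mul, mul_comm]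
  congr 1
  have h3 := card_submodule (V := polyKer L r k x)
  rw [finrank_polyKer] at h3
  rw [show (2 : ℤ) ^ Module.finrank (ZMod 2) (kerSpace L r k x) =
    ((2 ^ Module.finrank (ZMod 2) (kerSpace L r k x) : ℕ) : ℤ) by push_cast; rfl, ← h3]
  congr 1
  rw [← SetLike.coe_sort_coe, Nat.card_coe_set_eq, ← Set.ncard_coe_finset]
  congr 1
  ext Y
  rw [Finset.coe_filter, Set.mem_ofPred_eq, mem_polys, SetLike.mem_coe, mem_polyKer]

/-- The number of solutions of `∑ Yᵢ Zᵢ = 0` in each block. -/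
noncomputable def solutionCount (r : ι → ℕ) (k q : ℕ) : ℕ :=
  Nat.card {p : Fin q → (ZMod 2)[X] × (ι → (ZMod 2)[X]) //
    (∀ i, (p i).1 ∈ polys k ∧ ∀ b, (p i).2 b ∈ polys (r b)) ∧ ∀ b, ∑ i, (p i).1 * (p i).2 b = 0}

/-- Expanding the power and summing over the strings first, orthogonality tests whether the sums of
products vanish. The relation `h` keeps these sums within degree `L b`, so the digits detect every
coefficient. -/
theorem sum_digitSum_pow [DecidableEq ι] (L r : ι → ℕ) (k q : ℕ) (h : ∀ b, r b + k = L b + 1) :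
    ∑ x : Digits L, digitSum L r k x ^ q = 2 ^ (∑ b, L b) * (solutionCount r k q : ℤ) := by
  classical
  have h1 : ∀ x : Digits L, digitSum L r k x ^ q =
      ∑ p ∈ Fintype.piFinset fun _ : Fin q => polys k ×ˢ Fintype.piFinset fun b => polys (r b),
        ∏ b, sign (pair (x b) (∑ i, (p i).1 * (p i).2 b)) := by
    intro x
    rw [digitSum]
    simp only [Finset.prod_univ_sum, ← Finset.sum_product']
    rw [← Fin.prod_const, Finset.prod_univ_sum]
    refine Finset.sum_congr rfl fun p _ => ?_
    rw [Finset.prod_comm]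
    refine Finset.prod_congr rfl fun b _ => ?_
    rw [map_sum, sign_sum]
  simp only [h1]
  rw [Finset.sum_comm]
  have h2 : ∀ p ∈ Fintype.piFinset
      fun _ : Fin q => polys k ×ˢ Fintype.piFinset fun b => polys (r b),
      ∑ x : Digits L, ∏ b, sign (pair (x b) (∑ i, (p i).1 * (p i).2 b)) =
        if ∀ b, ∑ i, (p i).1 * (p i).2 b = 0 then 2 ^ (∑ b, L b) else 0 := by
    intro p hp
    rw [← Fintype.piFinset_univ,
      ← Finset.prod_univ_sum (fun _ => Finset.univ) fun b (y : Fin (L b) → ZMod 2) =>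
        sign (pair y (∑ i, (p i).1 * (p i).2 b))]
    have h3 : ∀ b, ∑ i, (p i).1 * (p i).2 b ∈ degreeLT (ZMod 2) (L b) := by
      intro b
      refine Submodule.sum_mem _ fun i _ => ?_
      have hi := Fintype.mem_piFinset.mp hp i
      rw [Finset.mem_product, Fintype.mem_piFinset] at hi
      exact mul_mem_degreeLT (by have := h b; omega) (mem_polys.mp hi.1) (mem_polys.mp (hi.2 b))
    simp only [sum_digits_sign (h3 _)]
    rw [Finset.prod_ite_zero, Finset.prod_pow_eq_pow_sum]
    simp
  rw [Finset.sum_congr rfl h2, ← Finset.sum_filter, Finset.sum_const, nsmul_eq_mul, mul_comm]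
  congr 2
  rw [solutionCount, ← Set.ncard_coe_finset, ← Nat.card_coe_set_eq]
  refine Nat.card_congr (Equiv.subtypeEquivRight fun p => ?_)
  simp [Fintype.mem_piFinset, Finset.mem_product]

end CharacterSums

/-! ### Uniform distribution of the leading digits under Haar measure -/

section Integrals

open TriplePersymmetric

/-- The first digits of a series, at `T⁻¹, …, T⁻ˡ`. -/
def leadingDigits (l : ℕ) (t : K) : Fin l → ZMod 2 := fun i => t.coeff ((i : ℤ) + 1)

theorem measurable_coeff (n : ℤ) : Measurable fun t : K => t.coeff n := by
  refine measurable_to_countable' fun a => IsOpen.measurableSet ?_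
  let _ : UniformSpace (ZMod 2) := ⊥
  exact (isOpen_discrete ({a} : Set (ZMod 2))).preimage
    (LaurentSeries.uniformContinuous_coeff n).continuous

theorem measurable_leadingDigits (l : ℕ) : Measurable (leadingDigits l) :=
  measurable_pi_lambda _ fun _ => measurable_coeff _

instance isAddLeftInvariant_haarK : haarK.IsAddLeftInvariant := by
  unfold haarK
  infer_instance

/-- Translation by the series with digits `c` maps the unit interval to itself and the cylinder of 0
to that of `c`; the 2^l cylinders thus share the total mass 1 equally. -/
theorem haarP_cylinder_eq (l : ℕ) (c : Fin l → ZMod 2) :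
    haarP (leadingDigits l ⁻¹' {c}) = haarP (leadingDigits l ⁻¹' {0}) := by
  have hm : ∀ d, MeasurableSet (leadingDigits l ⁻¹' {d}) := fun d =>
    measurable_leadingDigits l (measurableSet_singleton d)
  rw [haarP, Measure.restrict_apply (hm c), Measure.restrict_apply (hm 0),
    ← measure_preimage_add haarK (ofDigits (extend c))
      (leadingDigits l ⁻¹' {c} ∩ TriplePersymmetric.unitInterval)]
  congr 1
  ext t
  have hd : leadingDigits l (ofDigits (extend c) + t) = c + leadingDigits l t := by
    funext i
    simp only [leadingDigits, HahnSeries.coeff_add, coeff_ofDigits, Pi.add_apply]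
    rw [if_pos (by omega), show ((i : ℤ) + 1 - 1).toNat = i by omega, extend_coe]
  have hu : ofDigits (extend c) + t ∈ TriplePersymmetric.unitInterval ↔
      t ∈ TriplePersymmetric.unitInterval := by
    refine forall₂_congr fun n hn => ?_
    rw [HahnSeries.coeff_add, coeff_ofDigits, if_neg (by omega), zero_add]
  simp only [Set.mem_inter_iff, Set.mem_preimage, Set.mem_singleton_iff, hd, hu, add_eq_left]

theorem haarP_cylinder (l : ℕ) (c : Fin l → ZMod 2) :
    haarP.real (leadingDigits l ⁻¹' {c}) = (2 ^ l)⁻¹ := by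
  have hp : IsProbabilityMeasure (haarP.map (leadingDigits l)) :=
    Measure.isProbabilityMeasure_map (measurable_leadingDigits l).aemeasurable
  have h := sum_measureReal_singleton (μ := haarP.map (leadingDigits l)) Finset.univ
  have h1 : ∀ d, (haarP.map (leadingDigits l)).real {d} =
      haarP.real (leadingDigits l ⁻¹' {c}) := by
    intro d
    rw [map_measureReal_apply (measurable_leadingDigits l) (measurableSet_singleton d),
      measureReal_def, measureReal_def, haarP_cylinder_eq, haarP_cylinder_eq l c]
  rw [Finset.sum_congr rfl fun d _ => h1 d, Finset.sum_const, Finset.coe_univ,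
    probReal_univ, nsmul_eq_mul] at h
  rw [eq_inv_of_mul_eq_one_right h]
  simp

/-- The leading digits of a triple of series. -/
def tripleDigits (L : Fin 3 → ℕ) (x : K × K × K) : Digits L :=
  fun b => leadingDigits (L b) (![x.1, x.2.1, x.2.2] b)

theorem measurable_tripleDigits (L : Fin 3 → ℕ) : Measurable (tripleDigits L) := by
  refine measurable_pi_lambda _ fun b => ?_
  fin_cases b
  · exact (measurable_leadingDigits _).comp measurable_fst
  · exact (measurable_leadingDigits _).comp (measurable_fst.comp measurable_snd)
  · exact (measurable_leadingDigits _).comp (measurable_snd.comp measurable_snd)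

theorem integral_tripleDigits (L : Fin 3 → ℕ) (f : Digits L → ℝ) :
    ∫ x, f (tripleDigits L x) ∂(haarP.prod (haarP.prod haarP)) =
      (2 ^ (∑ b, L b))⁻¹ * ∑ c, f c := by
  rw [← integral_map (measurable_tripleDigits L).aemeasurable
    (measurable_of_finite f).aestronglyMeasurable, integral_fintype (Integrable.of_finite),
    Finset.mul_sum]
  refine Finset.sum_congr rfl fun c _ => ?_
  have h : tripleDigits L ⁻¹' {c} = (leadingDigits (L 0) ⁻¹' {c 0}) ×ˢ
      ((leadingDigits (L 1) ⁻¹' {c 1}) ×ˢ (leadingDigits (L 2) ⁻¹' {c 2})) := by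
    ext x
    rw [Set.mem_preimage, Set.mem_singleton_iff, funext_iff, Fin.forall_fin_succ,
      Fin.forall_fin_two]
    rfl
  rw [map_measureReal_apply (measurable_tripleDigits L) (measurableSet_singleton c), h,
    measureReal_prod_prod, measureReal_prod_prod, haarP_cylinder, haarP_cylinder, haarP_cylinder,
    smul_eq_mul, Fin.sum_univ_three, pow_add, pow_add, mul_inv, mul_inv]
  ring

end Integrals

/-! ### The exponential sum, its moments and the number of solutions -/

section Moments

open TriplePersymmetric

theorem coeff_mul_ofPoly_X_pow (t : K) (n : ℕ) :
    (t * ofPoly (X ^ n)).coeff 1 = t.coeff ((n : ℤ) + 1) := by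
  have h : ofPoly (X ^ n) = HahnSeries.single (-(n : ℤ)) (1 : ZMod 2) := by
    rw [map_pow, ofPoly, coe_eval₂RingHom, eval₂_X, HahnSeries.single_pow, one_pow]
    simp
  have h1 := HahnSeries.coeff_mul_single_add (x := t) (r := (1 : ZMod 2)) (a := (n : ℤ) + 1)
    (b := -(n : ℤ))
  rw [mul_one, show (n : ℤ) + 1 + -(n : ℤ) = 1 by ring] at h1
  rw [h, h1]

theorem coeff_mul_ofPoly {l : ℕ} (t : K) {A : (ZMod 2)[X]} (hA : A ∈ degreeLT (ZMod 2) l) :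
    (t * ofPoly A).coeff 1 = pair (leadingDigits l t) A := by
  let f : (ZMod 2)[X] →+ ZMod 2 :=
    { toFun := fun A => (t * ofPoly A).coeff 1
      map_zero' := by simp
      map_add' := fun A B => by simp [mul_add] }
  refine eq_on_degreeLT (f := f.toZModLinearMap 2) (fun i => ?_) hA
  rw [pair_X_pow]
  exact coeff_mul_ofPoly_X_pow t i

theorem character_eq_sign {r k l : ℕ} (h : r + k = l + 1) (t : K) {Y Z : (ZMod 2)[X]}
    (hY : Y ∈ polys k) (hZ : Z ∈ polys r) :
    E (t * ofPoly Y * ofPoly Z) = sign (pair (leadingDigits l t) (Y * Z)) := by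
  rw [mul_assoc, ← map_mul, ← coeff_mul_ofPoly t (mul_mem_degreeLT (by omega) (mem_polys.mp hY)
    (mem_polys.mp hZ))]
  rfl

/-- The numbers of digits entering the three blocks. -/
def digitLengths (σ m k : ℕ) : Fin 3 → ℕ := fun b => tripleRows σ m b + k

/-- The numbers of rows of the three blocks. -/
def rowNumbers (σ m : ℕ) : Fin 3 → ℕ := fun b => tripleRows σ m b + 1

theorem rowNumbers_add (σ m k : ℕ) (b : Fin 3) :
    rowNumbers σ m b + k = digitLengths σ m k b + 1 := by
  rw [rowNumbers, digitLengths]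
  omega

theorem sum_rowNumbers (σ m : ℕ) : ∑ b, rowNumbers σ m b = 3 * (σ + 1) + 2 * m := by
  rw [Fin.sum_univ_three]
  change σ + 1 + (σ + m + 1) + (σ + m + 1) = _
  ring

theorem sum_digitLengths (σ m k : ℕ) :
    ∑ b, digitLengths σ m k b = 3 * k + 3 * σ + 2 * m := by
  rw [Fin.sum_univ_three]
  change σ + k + (σ + m + k) + (σ + m + k) = _
  ring

/-- The products YZ, YU, YV have bounded degree, so the coefficient of T⁻¹ involves only the leading
digits of each series. -/
theorem g_eq_digitSum (σ m k : ℕ) (t η ξ : K) :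
    g k (σ + 1) m t η ξ = digitSum (digitLengths σ m k) (rowNumbers σ m) k
      (tripleDigits (digitLengths σ m k) (t, η, ξ)) := by
  rw [g, digitSum]
  refine Finset.sum_congr rfl fun Y hY => ?_
  rw [Fin.prod_univ_three]
  have h : σ + 1 + m = σ + m + 1 := by omega
  rw [h]
  congr 1
  · congr 1
    · exact Finset.sum_congr rfl fun Z hZ => character_eq_sign (rowNumbers_add σ m k _) t hY hZ
    · exact Finset.sum_congr rfl fun Z hZ => character_eq_sign (rowNumbers_add σ m k _) η hY hZ
  · exact Finset.sum_congr rfl fun Z hZ => character_eq_sign (rowNumbers_add σ m k _) ξ hY hZ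

theorem persym_eq_hankel {a k l : ℕ} (h : a + k = l + 1) (t : K) :
    persym a k t = hankel a k (extend (leadingDigits l t)) := by
  ext i j
  have hi := i.2
  have hj := j.2
  rw [hankel, Matrix.of_apply, extend, dif_pos (by omega)]
  simp [persym, leadingDigits]

theorem D_eq_tripleMatrix (σ m k : ℕ) (t η ξ : K) :
    D (σ + 1) m k t η ξ = tripleMatrix (σ + 1) m k fun b =>
      extend (tripleDigits (digitLengths σ m k) (t, η, ξ) b) := by
  rw [D, tripleMatrix, persym_eq_hankel (l := σ + k) (by omega),
    persym_eq_hankel (l := σ + m + k) (by omega), persym_eq_hankel (l := σ + m + k) (by omega)]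
  rfl

theorem digitSum_eq_two_pow (σ m k : ℕ) (x : Digits (digitLengths σ m k)) :
    digitSum (digitLengths σ m k) (rowNumbers σ m) k x =
      2 ^ (3 * (σ + 1) + 2 * m + k - (tripleMatrix (σ + 1) m k fun b => extend (x b)).rank) := by
  have h : (tripleMatrix (σ + 1) m k fun b => extend (x b)).rank +
      Module.finrank (ZMod 2) (kerSpace (digitLengths σ m k) (rowNumbers σ m) k x) = k :=
    rank_tripleMatrix σ m k x
  rw [digitSum_eq, sum_rowNumbers]
  congr 1
  omega

theorem g_eq_two_pow (s m k : ℕ) (hs : 1 ≤ s) (t η ξ : K) :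
    g k s m t η ξ = 2 ^ (3 * s + 2 * m + k - (D s m k t η ξ).rank) := by
  obtain ⟨σ, rfl⟩ := Nat.exists_eq_add_of_le' hs
  rw [g_eq_digitSum, digitSum_eq_two_pow, D_eq_tripleMatrix]

theorem integral_g_pow (σ m k q : ℕ) :
    ∫ x, (g k (σ + 1) m x.1 x.2.1 x.2.2 : ℝ) ^ q ∂(haarP.prod (haarP.prod haarP)) =
      (2 ^ (3 * k + 3 * σ + 2 * m))⁻¹ * ∑ c : Digits (digitLengths σ m k),
        (digitSum (digitLengths σ m k) (rowNumbers σ m) k c : ℝ) ^ q := by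
  simp only [g_eq_digitSum]
  rw [← sum_digitLengths, ← integral_tripleDigits]

theorem sum_digitSum_pow_eq (σ m k q : ℕ) (hk : 1 ≤ k) :
    ∑ c : Digits (digitLengths σ m k),
        (digitSum (digitLengths σ m k) (rowNumbers σ m) k c : ℝ) ^ q =
      ∑ i ∈ Finset.range (min k (3 * (σ + 1) + 2 * m) + 1),
        (Γ (σ + 1) m k i : ℝ) * 2 ^ ((3 * (σ + 1) + 2 * m + k - i) * q) := by
  have hr : ∀ c ∈ (Finset.univ : Finset (Digits (digitLengths σ m k))),
      (tripleMatrix (σ + 1) m k fun b => extend (c b)).rank ∈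
        Finset.range (min k (3 * (σ + 1) + 2 * m) + 1) := by
    intro c _
    have h1 := Matrix.rank_le_card_width (tripleMatrix (σ + 1) m k fun b => extend (c b))
    have h2 := Matrix.rank_le_card_height (tripleMatrix (σ + 1) m k fun b => extend (c b))
    simp only [Fintype.card_sum, Fintype.card_fin] at h1 h2
    rw [Finset.mem_range]
    omega
  rw [← Finset.sum_fiberwise_of_maps_to hr]
  refine Finset.sum_congr rfl fun i _ => ?_
  rw [Finset.sum_congr rfl (g := fun _ => (2 : ℝ) ^ ((3 * (σ + 1) + 2 * m + k - i) * q)),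
    Finset.sum_const, nsmul_eq_mul, numRank_eq_card _ _ _ _ hk, Nat.card_eq_fintype_card,
    Fintype.card_subtype]
  · rfl
  · intro c hc
    rw [Finset.mem_filter] at hc
    rw [digitSum_eq_two_pow, hc.2, pow_mul]
    push_cast
    rfl

/-- The integral averages over 2^(3k + 3s + 2m - 3) strings, and sorting them by rank produces the
`Γ s m k i`. -/
theorem moment_eq (s m k q : ℕ) (hs : 1 ≤ s) (hk : 1 ≤ k) :
    ∫ x, (g k s m x.1 x.2.1 x.2.2 : ℝ) ^ q ∂(haarP.prod (haarP.prod haarP)) =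
      2 ^ (((k : ℤ) + 3 * s + 2 * m) * q - (3 * k + 3 * s + 2 * m - 3)) *
        ∑ i ∈ Finset.range (min k (3 * s + 2 * m) + 1),
          (Γ s m k i : ℝ) * 2 ^ (-((i : ℤ) * q)) := by
  obtain ⟨σ, rfl⟩ := Nat.exists_eq_add_of_le' hs
  rw [integral_g_pow, sum_digitSum_pow_eq _ _ _ _ hk, Finset.mul_sum, Finset.mul_sum]
  refine Finset.sum_congr rfl fun i hi => ?_
  rw [Finset.mem_range] at hi
  have h2 : (2 : ℝ) ≠ 0 := two_ne_zero
  rw [mul_left_comm, mul_left_comm ((2 : ℝ) ^ (_ : ℤ)), ← zpow_natCast, ← zpow_natCast,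
    ← zpow_neg, ← zpow_add₀ h2, ← zpow_add₀ h2]
  congr 2
  push_cast [Nat.cast_sub (show i ≤ 3 * (σ + 1) + 2 * m + k by omega)]
  ring

theorem R_eq_solutionCount (σ m k q : ℕ) :
    R q k (σ + 1) m = solutionCount (rowNumbers σ m) k q := by
  have h : σ + 1 + m = σ + m + 1 := by omega
  rw [R, solutionCount, ← Nat.card_coe_set_eq, h]
  let e : ((Fin q → (ZMod 2)[X]) × (Fin q → (ZMod 2)[X]) × (Fin q → (ZMod 2)[X]) ×
      (Fin q → (ZMod 2)[X])) ≃ (Fin q → (ZMod 2)[X] × (Fin 3 → (ZMod 2)[X])) :=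
    { toFun := fun x i => (x.1 i, ![x.2.1 i, x.2.2.1 i, x.2.2.2 i])
      invFun := fun p => (fun i => (p i).1, fun i => (p i).2 0, fun i => (p i).2 1,
        fun i => (p i).2 2)
      left_inv := fun _ => rfl
      right_inv := fun p => by
        funext i
        refine Prod.ext rfl (funext fun b => ?_)
        fin_cases b <;> rfl }
  refine Nat.card_congr (e.subtypeEquiv fun x => ?_)
  simp only [mem_polys, mem_degreeLT, Fin.forall_fin_succ (n := 2), Fin.forall_fin_two]
  rfl

theorem R_eq_integral (s m k q : ℕ) (hs : 1 ≤ s) :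
    (R q k s m : ℝ) =
      ∫ x, (g k s m x.1 x.2.1 x.2.2 : ℝ) ^ q ∂(haarP.prod (haarP.prod haarP)) := by
  obtain ⟨σ, rfl⟩ := Nat.exists_eq_add_of_le' hs
  have h := sum_digitSum_pow (digitLengths σ m k) (rowNumbers σ m) k q
    (rowNumbers_add σ m k)
  rw [sum_digitLengths, ← R_eq_solutionCount] at h
  rw [integral_g_pow, eq_inv_mul_iff_mul_eq₀ (by positivity)]
  exact_mod_cast h.symm

end Moments

end PersymmetricRank

theorem theorem3p6 (s m : ℕ) (hs : 1 ≤ s) (hm : 2 ≤ m) :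
    -- the formulas for `k > i` (and for `k ≥ i` in the case of the maximal rank `3s+2m`)
    (∀ k : ℕ, 1 ≤ k → (TriplePersymmetric.Γ s m k 0 : ℚ) = 1) ∧
    (∀ k i : ℕ, 1 ≤ i → i + 1 ≤ s → i + 1 ≤ k →
      (TriplePersymmetric.Γ s m k i : ℚ) =
        105 * 2 ^ (4 * i - 6 : ℤ) - 21 * 2 ^ (3 * i - 5 : ℤ)) ∧
    (∀ k : ℕ, s + 1 ≤ k →
      (TriplePersymmetric.Γ s m k s : ℚ) =
        2 ^ (k + s - 1 : ℤ) - 2 ^ (2 * s : ℤ)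
          + 21 * (5 * 2 ^ (4 * s - 6 : ℤ) - 2 ^ (3 * s - 5 : ℤ))) ∧
    (∀ k j : ℕ, 1 ≤ j → j + 1 ≤ m → s + j + 1 ≤ k →
      (TriplePersymmetric.Γ s m k (s + j) : ℚ) =
        (21 * 2 ^ (j - 1 : ℤ) - 3) * 2 ^ (k + s + 2 * j - 4 : ℤ)
          + 21 * (5 * 2 ^ (4 * s + 4 * j - 6 : ℤ) - 2 ^ (3 * s + 3 * j - 5 : ℤ)
            - 5 * 2 ^ (2 * s + 4 * j - 6 : ℤ) + 2 ^ (2 * s + 3 * j - 5 : ℤ))) ∧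
    (∀ k : ℕ, s + m + 1 ≤ k →
      (TriplePersymmetric.Γ s m k (s + m) : ℚ) =
        (21 * 2 ^ (s + 3 * m - 5 : ℤ) + 45 * 2 ^ (s + 2 * m - 4 : ℤ))
            * (2 ^ (k : ℤ) - 2 ^ (s + m + 1 : ℤ))
          + 105 * 2 ^ (4 * s + 4 * m - 6 : ℤ) - 21 * 2 ^ (3 * s + 3 * m - 5 : ℤ)
          - 21 * 2 ^ (2 * s + 4 * m - 6 : ℤ) + 9 * 2 ^ (2 * s + 3 * m - 5 : ℤ)) ∧
    (∀ k j : ℕ, 1 ≤ j → j + 1 ≤ s → s + m + j + 1 ≤ k →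
      (TriplePersymmetric.Γ s m k (s + m + j) : ℚ) =
        21 * (2 ^ (k + s + 3 * m + 3 * j - 5 : ℤ) + 35 * 2 ^ (k + s + 2 * m + 4 * j - 7 : ℤ)
          - 9 * 2 ^ (k + s + 2 * m + 3 * j - 6 : ℤ)
          + 5 * 2 ^ (4 * s + 4 * m + 4 * j - 6 : ℤ) - 2 ^ (3 * s + 3 * m + 3 * j - 5 : ℤ)
          - 5 * 2 ^ (2 * s + 4 * m + 4 * j - 6 : ℤ)
          - 155 * 2 ^ (2 * s + 3 * m + 5 * j - 8 : ℤ)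
          + 45 * 2 ^ (2 * s + 3 * m + 4 * j - 7 : ℤ))) ∧
    (∀ k : ℕ, 2 * s + m + 1 ≤ k →
      (TriplePersymmetric.Γ s m k (2 * s + m) : ℚ) =
        3 * 2 ^ (2 * k + 2 * s + m - 2 : ℤ) + 21 * 2 ^ (k + 4 * s + 3 * m - 5 : ℤ)
          + 735 * 2 ^ (k + 5 * s + 2 * m - 7 : ℤ) - 477 * 2 ^ (k + 4 * s + 2 * m - 6 : ℤ)
          + 105 * 2 ^ (8 * s + 4 * m - 6 : ℤ) - 105 * 2 ^ (6 * s + 4 * m - 6 : ℤ)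
          - 3255 * 2 ^ (7 * s + 3 * m - 8 : ℤ) + 1629 * 2 ^ (6 * s + 3 * m - 7 : ℤ)) ∧
    (∀ k j : ℕ, j + 2 ≤ m → 2 * s + m + 2 + j ≤ k →
      (TriplePersymmetric.Γ s m k (2 * s + m + 1 + j) : ℚ) =
        21 * 2 ^ (2 * k + 2 * s + m + 3 * j - 2 : ℤ) + 21 * 2 ^ (k + 4 * s + 3 * m + 3 * j - 2 : ℤ)
          + 735 * 2 ^ (k + 5 * s + 2 * m + 4 * j - 3 : ℤ)
          - 945 * 2 ^ (k + 4 * s + 2 * m + 4 * j - 3 : ℤ)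
          + 105 * 2 ^ (8 * s + 4 * m + 4 * j - 2 : ℤ) - 105 * 2 ^ (6 * s + 4 * m + 4 * j - 2 : ℤ)
          - 3255 * 2 ^ (7 * s + 3 * m + 5 * j - 3 : ℤ)
          + 3255 * 2 ^ (6 * s + 3 * m + 5 * j - 3 : ℤ)) ∧
    (∀ k : ℕ, 2 * s + 2 * m + 1 ≤ k →
      (TriplePersymmetric.Γ s m k (2 * s + 2 * m) : ℚ) =
        53 * 2 ^ (2 * s - 1 : ℤ) * (2 ^ (2 * k + 4 * m - 4 : ℤ) - 2 ^ (4 * s + 8 * m - 2 : ℤ))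
          + (735 * 2 ^ (5 * s - 1 : ℤ) - 1629 * 2 ^ (4 * s - 1 : ℤ))
            * (2 ^ (k + 6 * m - 6 : ℤ) - 2 ^ (2 * s + 8 * m - 5 : ℤ))
          + 21 * (5 * 2 ^ (8 * s + 8 * m - 6 : ℤ) + 3 * 2 ^ (6 * s + 8 * m - 8 : ℤ)
            - 15 * 2 ^ (7 * s + 8 * m - 8 : ℤ))) ∧
    (∀ k j : ℕ, j + 2 ≤ s → 2 * s + 2 * m + 2 + j ≤ k →
      (TriplePersymmetric.Γ s m k (2 * s + 2 * m + 1 + j) : ℚ) =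
        105 * (2 ^ (2 * k + 2 * s + 4 * m + 4 * j - 2 : ℤ)
            + 7 * 2 ^ (k + 5 * s + 6 * m + 4 * j - 3 : ℤ)
            - 31 * 2 ^ (k + 4 * s + 6 * m + 5 * j - 3 : ℤ))
          + 105 * (2 ^ (8 * s + 8 * m + 4 * j - 2 : ℤ)
            - 31 * 2 ^ (7 * s + 8 * m + 5 * j - 3 : ℤ)
            + 93 * 2 ^ (6 * s + 8 * m + 6 * j - 3 : ℤ))) ∧
    (∀ k : ℕ, 3 * s + 2 * m ≤ k →
      (TriplePersymmetric.Γ s m k (3 * s + 2 * m) : ℚ) =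
        2 ^ (3 * k + 2 * m + 3 * s - 3 : ℤ) - 7 * 2 ^ (2 * k + 4 * m + 6 * s - 6 : ℤ)
          + 7 * 2 ^ (k + 6 * m + 9 * s - 8 : ℤ) - 2 ^ (8 * m + 12 * s - 9 : ℤ)) ∧
    -- the formulas for `k = i`
    (∀ i : ℕ, 1 ≤ i → i ≤ s + 1 →
      (TriplePersymmetric.Γ s m i i : ℚ) =
        2 ^ (3 * s + 2 * m + 3 * i - 3 : ℤ) - 7 * 2 ^ (4 * i - 6 : ℤ)
          + 3 * 2 ^ (3 * i - 5 : ℤ)) ∧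
    (∀ j : ℕ, 1 ≤ j → j ≤ m + 1 →
      (TriplePersymmetric.Γ s m (s + j) (s + j) : ℚ) =
        2 ^ (6 * s + 2 * m + 3 * j - 3 : ℤ) - 7 * 2 ^ (4 * s + 4 * j - 6 : ℤ)
          + 3 * 2 ^ (3 * s + 3 * j - 5 : ℤ)
          + (2 ^ (j - 1 : ℤ) - 1) * 2 ^ (2 * s + 3 * j - 5 : ℤ)) ∧
    (∀ j : ℕ, 1 ≤ j → j + 1 ≤ s →
      (TriplePersymmetric.Γ s m (s + m + j) (s + m + j) : ℚ) =
        2 ^ (6 * s + 5 * m + 3 * j - 3 : ℤ) - 7 * 2 ^ (4 * s + 4 * m + 4 * j - 6 : ℤ)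
          + 3 * 2 ^ (3 * s + 3 * m + 3 * j - 5 : ℤ) + 2 ^ (2 * s + 4 * m + 4 * j - 6 : ℤ)
          + 7 * 2 ^ (2 * s + 3 * m + 5 * j - 8 : ℤ)
          - 9 * 2 ^ (2 * s + 3 * m + 4 * j - 7 : ℤ)) ∧
    ((TriplePersymmetric.Γ s m (2 * s + m) (2 * s + m) : ℚ) =
        2 ^ (9 * s + 5 * m - 3 : ℤ) - 7 * 2 ^ (8 * s + 4 * m - 6 : ℤ)
          + 7 * 2 ^ (7 * s + 3 * m - 8 : ℤ) + 3 * 2 ^ (6 * s + 3 * m - 7 : ℤ)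
          + 2 ^ (6 * s + 4 * m - 6 : ℤ)) ∧
    (∀ j : ℕ, j + 2 ≤ m →
      (TriplePersymmetric.Γ s m (2 * s + m + 1 + j) (2 * s + m + 1 + j) : ℚ) =
        2 ^ (9 * s + 5 * m + 3 * j : ℤ) - 7 * 2 ^ (8 * s + 4 * m + 4 * j - 2 : ℤ)
          + 7 * 2 ^ (7 * s + 3 * m + 5 * j - 3 : ℤ) - 3 * 2 ^ (6 * s + 3 * m + 5 * j - 3 : ℤ)
          + 2 ^ (6 * s + 4 * m + 4 * j - 2 : ℤ)) ∧
    ((TriplePersymmetric.Γ s m (2 * s + 2 * m) (2 * s + 2 * m) : ℚ) =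
        2 ^ (9 * s + 8 * m - 3 : ℤ) - 7 * 2 ^ (8 * s + 8 * m - 6 : ℤ)
          + 7 * 2 ^ (7 * s + 8 * m - 8 : ℤ) + 2 ^ (6 * s + 8 * m - 8 : ℤ)) ∧
    (∀ j : ℕ, j + 2 ≤ s →
      (TriplePersymmetric.Γ s m (2 * s + 2 * m + 1 + j) (2 * s + 2 * m + 1 + j) : ℚ) =
        2 ^ (9 * s + 8 * m + 3 * j : ℤ) - 7 * 2 ^ (8 * s + 8 * m + 4 * j - 2 : ℤ)
          + 7 * 2 ^ (7 * s + 8 * m + 5 * j - 3 : ℤ)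
          - 2 ^ (6 * s + 8 * m + 6 * j - 3 : ℤ)) ∧
    ((TriplePersymmetric.Γ s m (3 * s + 2 * m) (3 * s + 2 * m) : ℚ) =
        21 * 2 ^ (8 * m + 12 * s - 9 : ℤ)) ∧
    -- the reduction formulas
    (∀ k j : ℕ, j + 2 ≤ m → 2 * s + m + 2 + j ≤ k →
      TriplePersymmetric.Γ s m k (2 * s + m + 1 + j) =
        16 ^ (2 * j) * TriplePersymmetric.Γ s (m - j) (k - 2 * j) (2 * s + 1 + (m - j))) ∧
    (∀ k : ℕ, 2 * s + 2 * m + 1 ≤ k →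
      TriplePersymmetric.Γ s m k (2 * s + 2 * m) =
        16 ^ (2 * m - 2) * TriplePersymmetric.Γ s 1 (k - 2 * (m - 1)) (2 * s + 2)) ∧
    (∀ k j : ℕ, j + 2 ≤ s → 2 * s + 2 * m + 2 + j ≤ k →
      TriplePersymmetric.Γ s m k (2 * s + 2 * m + 1 + j) =
        16 ^ (2 * m + 3 * j) *
          TriplePersymmetric.Γ (s - j) 0 (k - 2 * m - 3 * j) (2 * (s - j) + 1)) ∧
    (∀ k : ℕ, 3 * s + 2 * m ≤ k →
      TriplePersymmetric.Γ s m k (3 * s + 2 * m) =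
        16 ^ (2 * m + 3 * s - 3) * TriplePersymmetric.Γ 1 0 (k - 2 * m - (3 * s - 3)) 3) ∧
    -- the exponential sum, its moments, and the number of solutions
    (∀ k : ℕ, 1 ≤ k →
      (∀ t ∈ TriplePersymmetric.unitInterval, ∀ η ∈ TriplePersymmetric.unitInterval,
        ∀ ξ ∈ TriplePersymmetric.unitInterval,
          TriplePersymmetric.g k s m t η ξ =
            2 ^ (3 * s + 2 * m + k - (TriplePersymmetric.D s m k t η ξ).rank)) ∧
      ∀ q : ℕ, 1 ≤ q →
        (∫ x, (TriplePersymmetric.g k s m x.1 x.2.1 x.2.2 : ℝ) ^ q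
            ∂(TriplePersymmetric.haarP.prod
              (TriplePersymmetric.haarP.prod TriplePersymmetric.haarP))) =
          2 ^ (((k : ℤ) + 3 * s + 2 * m) * q - (3 * k + 3 * s + 2 * m - 3)) *
            ∑ i ∈ Finset.range (min k (3 * s + 2 * m) + 1),
              (TriplePersymmetric.Γ s m k i : ℝ) * 2 ^ (-((i : ℤ) * q)) ∧
        (TriplePersymmetric.R q k s m : ℝ) =
          ∫ x, (TriplePersymmetric.g k s m x.1 x.2.1 x.2.2 : ℝ) ^ q
            ∂(TriplePersymmetric.haarP.prod
              (TriplePersymmetric.haarP.prod TriplePersymmetric.haarP))) := by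
  open PersymmetricRank in
  exact ⟨rank_count_zero s m hs, rank_count_low s m hs hm, rank_count_firstCorner s m hs hm,
    rank_count_firstGap s m hs hm, rank_count_secondCorner s m hs hm,
    rank_count_secondGap s m hs hm, rank_count_thirdCorner s m hs hm, rank_count_thirdGap s m hs,
    rank_count_fourthCorner s m hs (by omega), rank_count_fourthGap s m hs,
    rank_count_top s m hs, rank_count_square_low s m hs hm, rank_count_square_firstGap s m hs hm,
    rank_count_square_secondGap s m hs hm, rank_count_square_thirdCorner s m hs hm,
    rank_count_square_thirdGap s m hs hm, rank_count_square_fourthCorner s m hs hm,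
    rank_count_square_fourthGap s m hs, rank_count_square_top s m hs,
    rank_count_reduction_thirdGap s m hs, rank_count_reduction_fourthCorner s m hs (by omega),
    rank_count_reduction_fourthGap s m hs, rank_count_reduction_top s m hs,
    fun k hk => ⟨fun t _ η _ ξ _ => g_eq_two_pow s m k hs t η ξ,
      fun q _ => ⟨moment_eq s m k q hs hk, R_eq_integral s m k q hs⟩⟩⟩
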